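/- Let $\mathbb R_+=(0,\infty)$, let $H=L^2(\mathbb R_+^2)$ and let $W=\{W(h): h\in H\}$ be a space-time white noise on a probability space $(\Omega,\mathcal F,\mathbb P)$, i.e. a centered Gaussian family with $\mathbb E[W(g)W(h)]=\langle g,h\rangle_{H}$, where $\mathcal F$ is generated by $W$ (up to null sets). Let $u_0\in C_b(\mathbb R_+)$ with $\|u_0\|_u=\sup_{z>0}|u_0(z)|$. For $z\ge 0$ and $w,t>0$ put $$q_0(z,w,t)=\sqrt{\frac zw}\,\frac{e^{-(z+w)/t}}{t}\,I_1\!\Big(\frac{2\sqrt{zw}}{t}\Big),\qquad I_1(x)=\sum_{m\ge0}\frac{(x/2)^{2m+1}}{m!\,(m+1)!},$$ and let $u_0(z,t)=\int_0^\infty q_0(z,w,t)u_0(w)\,dw$ for $z,t>0$, $u_0(z,0)=u_0(z)$ for $z>0$, and $u_0(0,t)=0$ for $t\ge0$. Define kernels, for $z,t\ge0$, by $f_0(z,t)=u_0(z,t)$ and $$f_{n}(z_1,t_1,\dots,z_n,t_n;z,t)=\mathbf 1_{(0,t)}(t_n)\,q_0(z,z_n,t-t_n)\,f_{n-1}(z_1,t_1,\dots,z_{n-1},t_{n-1};z_n,t_n),\quad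 n\ge1,$$ and let $\mathcal I_n$ be the $n$-fold multiple Wiener integral with respect to $W$ on $L^2((\mathbb R_+^2)^n)$. Let $\delta$ be the Skorohod integral, i.e. the adjoint of the Malliavin derivative $D:\mathbb D^{1,2}\subseteq L^2(\Omega)\to L^2(\Omega;H)$. A random field $u=\{u(z,t): z,t\ge0\}$ is called a mild solution of $$\partial_t u=z\,\partial_z^2u+u\,\dot W\quad(z,t>0),\qquad u(z,0)=u_0(z)\ (z>0),\qquad u(0,t)=0\ (t>0)\tag{1}$$ if $\mathbb E[u(z,t)^2]<\infty$ for all $z,t\ge 0$, $u$ has a jointly measurable modification (again denoted $u$), and for all $z,t>0$ the process $(w,\tau)\mapsto \mathbf 1_{(0,t)}(\tau)q_0(z,w,t-\tau)u(w,\tau)$ belongs to $L^2(\Omega;H)$, is Skorohod integrable, and almost surely $$u(z,t)=\int_0^\infty q_0(z,w,t)u_0(w)\,dw+\int_0^t\!\!\int_0^\infty q_0(z,w,t-\tau)u(w,\tau)\,W(dw,d\tau).$$ Then: 1. For all $z,t\ge0$ and $n\ge0$, $f_n(\cdot;z,t)\in L^2((\mathbb R_+^2)^n)$, and the series $u(z,t)=\sum_{n=0}^\infty\mathcal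 I_n(f_n(\cdot;z,t))$ converges in $L^2(\Omega)$. 2. $\sup_{z,t\ge0}\mathbb E[u(z,t)^2]\le 2\|u_0\|_u^2$; in particular the bound is $2$ when $u_0\equiv1$. 3. $u$ is a mild solution of (1), and $u(z,0)=u_0(z)$ for $z>0$ and $u(0,t)=0$ for $t>0$ almost surely. 4. $u$ is the unique mild solution up to modification: every mild solution $v$ satisfies $v(z,t)=u(z,t)$ almost surely for each $z,t>0$, and if moreover $v(z,0)=u_0(z)$ for $z>0$ and $v(0,t)=0$ for $t>0$ almost surely, then this holds for each $z,t\ge0$ with $(z,t)\ne(0,0)$. -/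

import Mathlib

open MeasureTheory ProbabilityTheory Set
open scoped BoundedContinuousFunction ENNReal

noncomputable section

namespace StochasticKimura

/-- The modified Bessel function of the first kind of integer order `k`,
`I_k(x) = ∑ m, (x / 2) ^ (2 m + k) / (m! (m + k)!)`. -/
def besselI (k : ℕ) (x : ℝ) : ℝ :=
  ∑' m : ℕ, (x / 2) ^ (2 * m + k) / ((m.factorial : ℝ) * ((m + k).factorial : ℝ))

/-- The fundamental solution `q₀(z, w, t)` of `∂ₜ u = z ∂_z² u` on `(0, ∞)` with Dirichlet
condition at `0`. It is used for `w, t > 0` and `z ≥ 0`, and it vanishes at `z = 0`. -/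
def kimuraKernel (z w t : ℝ) : ℝ :=
  Real.sqrt (z / w) * (Real.exp (-(z + w) / t) / t) * besselI 1 (2 * Real.sqrt (z * w) / t)

/-- The deterministic solution `u₀(z, t) = ∫₀^∞ q₀(z, w, t) u₀(w) dw` for `z, t > 0`, with its
initial values `u₀(z)` at `t = 0`, `z > 0` and its boundary value `0` at `z = 0`. -/
def detSolution (u₀ : Ioi (0 : ℝ) →ᵇ ℝ) (z t : ℝ) : ℝ :=
  if hz : 0 < z then
    if 0 < t then
      ∫ w : Ioi (0 : ℝ), kimuraKernel z w t * u₀ w ∂(Measure.comap Subtype.val volume)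
    else u₀ ⟨z, hz⟩
  else 0

/-- Lebesgue measure on the space-time quadrant `(0, ∞) × (0, ∞)`; points are `(z, t)`. -/
def quadrant : Measure (ℝ × ℝ) :=
  volume.restrict (Ioi 0 ×ˢ Ioi 0)

/-- The Hilbert space `L²((0, ∞)²)` of space-time white noise. -/
abbrev NoiseSpace : Type := Lp ℝ 2 quadrant

/-- The kernels of the chaos expansion: `f₀(z, t)` is the deterministic solution, and
`fₙ₊₁(x₁, …, xₙ₊₁; z, t) = 1_{(0,t)}(tₙ₊₁) q₀(z, zₙ₊₁, t - tₙ₊₁) fₙ(x₁, …, xₙ; zₙ₊₁, tₙ₊₁)`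
where `xᵢ = (zᵢ, tᵢ)`. -/
def chaosKernel (u₀ : Ioi (0 : ℝ) →ᵇ ℝ) : (n : ℕ) → ℝ → ℝ → (Fin n → ℝ × ℝ) → ℝ
  | 0, z, t, _ => detSolution u₀ z t
  | n + 1, z, t, x =>
      (Ioo 0 t).indicator
        (fun τ => kimuraKernel z (x (Fin.last n)).1 (t - τ) *
          chaosKernel u₀ n (x (Fin.last n)).1 τ (Fin.init x))
        (x (Fin.last n)).2

variable {Ω : Type*} [MeasurableSpace Ω]

/-- `W` is a space-time white noise on `(0, ∞)²`: an isonormal Gaussian process over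
`L²((0, ∞)²)`, i.e. a centered Gaussian family with `E[W(g) W(h)] = ⟨g, h⟩`. -/
structure IsWhiteNoise (P : Measure Ω) (W : NoiseSpace → Ω → ℝ) : Prop where
  measurable : ∀ h, Measurable (W h)
  gaussian : IsGaussianProcess W P
  centered : ∀ h, ∫ ω, W h ω ∂P = 0
  covariance : ∀ g h, ∫ ω, W g ω * W h ω ∂P = inner ℝ g h

/-- The σ-algebra of `Ω` is generated by `W`, up to `P`-null sets. -/
def IsGeneratedBy (P : Measure Ω) (W : NoiseSpace → Ω → ℝ) : Prop :=
  ∀ A : Set Ω, MeasurableSet A → ∃ B : Set Ω,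
    MeasurableSet[⨆ h : NoiseSpace, MeasurableSpace.comap (W h) inferInstance] B ∧ A =ᵐ[P] B

/-- The pairs `(1_{A₁ × ⋯ × Aₙ}, W(A₁) ⋯ W(Aₙ))` for pairwise disjoint measurable sets `Aᵢ` of
finite measure, where `W(A) = W(1_A)`. -/
def elementaryIntegrals (P : Measure Ω) (W : NoiseSpace → Ω → ℝ) (n : ℕ) :
    Set (Lp ℝ 2 (Measure.pi fun _ : Fin n => quadrant) × Lp ℝ 2 P) :=
  {p | ∃ (A : Fin n → Set (ℝ × ℝ)) (hA : ∀ i, MeasurableSet (A i))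
      (hA' : ∀ i, quadrant (A i) ≠ ∞),
      Pairwise (fun i j => Disjoint (A i) (A j)) ∧
      p.1 =ᵐ[Measure.pi fun _ : Fin n => quadrant]
        (Set.pi univ A).indicator (fun _ => (1 : ℝ)) ∧
      p.2 =ᵐ[P] fun ω => ∏ i, W (indicatorConstLp 2 (hA i) (hA' i) (1 : ℝ)) ω}

/-- The graph of the `n`-fold multiple Wiener-Itô integral: the closure in `L² × L²` of the linear
extension of `1_{A₁ × ⋯ × Aₙ} ↦ W(A₁) ⋯ W(Aₙ)`, for pairwise disjoint `Aᵢ`. -/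
def multipleIntegralGraph (P : Measure Ω) (W : NoiseSpace → Ω → ℝ) (n : ℕ) :
    Submodule ℝ (Lp ℝ 2 (Measure.pi fun _ : Fin n => quadrant) × Lp ℝ 2 P) :=
  (Submodule.span ℝ (elementaryIntegrals P W n)).topologicalClosure

open Classical in
/-- The multiple Wiener-Itô integral `Iₙ(f) ∈ L²(Ω)` of a square-integrable `f` with respect
to `W` (and `0` if `f` is not square-integrable). -/
def multipleIntegral (P : Measure Ω) (W : NoiseSpace → Ω → ℝ) (n : ℕ)
    (f : (Fin n → ℝ × ℝ) → ℝ) : Lp ℝ 2 P :=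
  if h : ∃ (hf : MemLp f 2 (Measure.pi fun _ : Fin n => quadrant)) (Y : Lp ℝ 2 P),
      (hf.toLp f, Y) ∈ multipleIntegralGraph P W n
  then h.choose_spec.choose else 0

/-- The sum `u(z, t) = ∑ n, Iₙ(fₙ(·; z, t))` of the Wiener chaos series in `L²(Ω)`. -/
def chaosSolution (P : Measure Ω) [IsProbabilityMeasure P] (W : NoiseSpace → Ω → ℝ)
    (u₀ : Ioi (0 : ℝ) →ᵇ ℝ) (z t : ℝ) : Lp ℝ 2 P :=
  ∑' n : ℕ, multipleIntegral P W n (chaosKernel u₀ n z t)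

/-- The pairs `(X, DX)` where `X = F(W(h₁), …, W(h_N))` is a smooth random variable, with `F`
smooth and of at most polynomial growth together with all its derivatives, and
`DX = ∑ⱼ ∂ⱼF(W(h₁), …, W(h_N)) hⱼ` is its Malliavin derivative. -/
def smoothMalliavinGraph (P : Measure Ω) (W : NoiseSpace → Ω → ℝ) :
    Set (Lp ℝ 2 P × Lp NoiseSpace 2 P) :=
  {p | ∃ (N : ℕ) (F : (Fin N → ℝ) → ℝ) (h : Fin N → NoiseSpace),
      F.HasTemperateGrowth ∧
      p.1 =ᵐ[P] (fun ω => F (fun j => W (h j) ω)) ∧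
      p.2 =ᵐ[P] (fun ω => ∑ i, fderiv ℝ F (fun j => W (h j) ω) (Pi.single i 1) • h i)}

/-- The graph `{(X, DX) | X ∈ 𝔻^{1,2}}` of the Malliavin derivative, the closure of its
restriction to the smooth random variables. -/
def malliavinGraph (P : Measure Ω) (W : NoiseSpace → Ω → ℝ) :
    Set (Lp ℝ 2 P × Lp NoiseSpace 2 P) :=
  closure (smoothMalliavinGraph P W)

/-- `Φ ∈ L²(Ω; H)` is Skorohod integrable and `δ(Φ) = Y ∈ L²(Ω)`, where `δ` is the adjoint of the
Malliavin derivative: `E[Y X] = E[⟨DX, Φ⟩]` for all `X ∈ 𝔻^{1,2}`. -/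
def IsSkorohodIntegral (P : Measure Ω) (W : NoiseSpace → Ω → ℝ)
    (Φ : Lp NoiseSpace 2 P) (Y : Lp ℝ 2 P) : Prop :=
  ∀ p ∈ malliavinGraph P W, ∫ ω, Y ω * p.1 ω ∂P = ∫ ω, inner ℝ (p.2 ω) (Φ ω) ∂P

/-- `u = {u(z, t) | z, t ≥ 0}` is a mild solution of `∂ₜ u = z ∂_z² u + u Ẇ` with initial
condition `u₀`: it is square integrable, it has a jointly measurable modification `v`, and for all
`z, t > 0` the process `(w, τ) ↦ 1_{(0,t)}(τ) q₀(z, w, t - τ) v(w, τ)` is (an element `Φ` of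
`L²(Ω; H)` which is) Skorohod integrable, with
`u(z, t) = ∫₀^∞ q₀(z, w, t) u₀(w) dw + δ(Φ)` almost surely. -/
def IsMildSolution (P : Measure Ω) (W : NoiseSpace → Ω → ℝ)
    (u₀ : Ioi (0 : ℝ) →ᵇ ℝ) (u : ℝ → ℝ → Ω → ℝ) : Prop :=
  (∀ z t : ℝ, 0 ≤ z → 0 ≤ t → MemLp (u z t) 2 P) ∧
  ∃ v : ℝ → ℝ → Ω → ℝ,
    Measurable (fun p : ℝ × ℝ × Ω => v p.1 p.2.1 p.2.2) ∧
    (∀ z t : ℝ, 0 ≤ z → 0 ≤ t → v z t =ᵐ[P] u z t) ∧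
    ∀ z t : ℝ, 0 < z → 0 < t →
      ∃ (Φ : Lp NoiseSpace 2 P) (Y : Lp ℝ 2 P),
        (∀ᵐ ω ∂P, Φ ω =ᵐ[quadrant] fun x : ℝ × ℝ =>
          (Ioo 0 t).indicator (fun τ => kimuraKernel z x.1 (t - τ) * v x.1 τ ω) x.2) ∧
        IsSkorohodIntegral P W Φ Y ∧
        u z t =ᵐ[P] fun ω => detSolution u₀ z t + Y ω

/-- The initial condition `u(z, 0) = u₀(z)`, `z > 0`, and the Dirichlet condition `u(0, t) = 0`,
`t > 0`. -/
def HasBoundaryValues (P : Measure Ω) (u₀ : Ioi (0 : ℝ) →ᵇ ℝ) (u : ℝ → ℝ → Ω → ℝ) : Prop :=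
  (∀ z : Ioi (0 : ℝ), u z 0 =ᵐ[P] fun _ => u₀ z) ∧
  ∀ t : ℝ, 0 < t → u 0 t =ᵐ[P] fun _ => 0

end StochasticKimura

end

open StochasticKimura

/-! The analysis rests on one computation: the integral of `kimuraKernel` squared over all w and t
is at most 1/2, uniformly in z (`lintegral_sq_kimuraKernel_le`). Expanding q₀ in its positive power
series reduces it to Gamma integrals, Vandermonde's identity and a telescoping sum of central
binomial coefficients. Since q₀(z, ·, t) is also sub-Markovian, each iteration costs a factor 1/2,
so ‖fₙ‖² ≤ ‖u₀‖² 2⁻ⁿ, and the geometric series gives the bound 2‖u₀‖².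

The probability is reduced to the exponentials exp(ζ W(h)). The real ones are total in L²(Ω)
(`eq_zero_of_integral_mul_exp`), and a multiple integral with kernel f has the transform
exp(ζ²‖h‖²/2) ζⁿ ⟨f, h ⊗ ⋯ ⊗ h⟩ (`expPairing_of_mem_graph`). The fₙ are supported on increasing
times, so no symmetrization is needed and no n! appears. For such kernels
`norm_sq_le_of_hasSum_pairing` proves ‖Y‖² ≤ ∑ ‖fₙ‖² by duality against combinations of Wick
exponentials. This single inequality replaces the Itô isometry and the orthogonality of the chaoses:
it yields the existence of the multiple integrals, the convergence of the series and the moment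
bound.

That the series solves the equation: the recursion of the kernels, summed over n, is the mild
equation tested against exp(ζ W(h)) (`expPairing_chaosSolution_eq`). At ζ = i this is the duality
defining the Skorohod integral, restricted to characters; Fourier inversion and a cutoff extend it
to all smooth random variables (`isSkorohodIntegral_of_integral_exp`).

Uniqueness needs no chaos expansion of the competitor. The Malliavin derivative of W(h)ⁿ is n
W(h)ⁿ⁻¹ h, so the mild equation expresses E[u(z,t) W(h)ⁿ] through the moments with exponent n - 1.
By induction two mild solutions have the same moments against all powers W(h)ⁿ, and these powers are
total. -/

noncomputable section

namespace StochasticKimura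

/-! ### The kernel `q₀` -/

/-- The terms of the power series of `q₀`. -/
def kernelTerm (z w t : ℝ) (m : ℕ) : ℝ :=
  Real.exp (-(z + w) / t) * z ^ (m + 1) * w ^ m /
    (t ^ (2 * m + 2) * ((m.factorial : ℝ) * ((m + 1).factorial : ℝ)))

theorem kernelTerm_nonneg {z w t : ℝ} (hz : 0 ≤ z) (hw : 0 < w) (ht : 0 < t) (m : ℕ) :
    0 ≤ kernelTerm z w t m := by
  unfold kernelTerm; positivity

theorem summable_besselI_one {x : ℝ} (hx : 0 ≤ x) :
    Summable fun m : ℕ => (x / 2) ^ (2 * m + 1) / ((m.factorial : ℝ) * ((m + 1).factorial : ℝ)) := by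
  have h := (Real.summable_pow_div_factorial ((x / 2) ^ 2)).mul_left (x / 2)
  refine Summable.of_nonneg_of_le (fun m => by positivity) (fun m => ?_) h
  rw [← pow_mul, ← mul_div_assoc, ← pow_succ']
  gcongr
  have : (1 : ℝ) ≤ ((m + 1).factorial : ℝ) := by exact_mod_cast Nat.one_le_iff_ne_zero.2 (Nat.factorial_ne_zero _)
  nlinarith [show (0:ℝ) ≤ (m.factorial : ℝ) by positivity]

/-- The prefactor √(z/w) absorbs the odd power of √(zw) in I₁, leaving monomials in z and w. Their
nonnegativity permits termwise integration throughout. -/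
theorem hasSum_kimuraKernel {z w t : ℝ} (hz : 0 ≤ z) (hw : 0 < w) (ht : 0 < t) :
    HasSum (kernelTerm z w t) (kimuraKernel z w t) := by
  have h := (summable_besselI_one (x := 2 * Real.sqrt (z * w) / t) (by positivity)).hasSum.mul_left
    (Real.sqrt (z / w) * (Real.exp (-(z + w) / t) / t))
  refine h.congr_fun fun m => ?_
  have h1 : Real.sqrt (z / w) * Real.sqrt (z * w) = z := by
    rw [← Real.sqrt_mul (by positivity), show z / w * (z * w) = z ^ 2 by field_simp, Real.sqrt_sq hz]
  have h2 : (2 * Real.sqrt (z * w) / t / 2) ^ (2 * m + 1) =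
      (z * w) ^ m * Real.sqrt (z * w) / t ^ (2 * m + 1) := by
    rw [show 2 * Real.sqrt (z * w) / t / 2 = Real.sqrt (z * w) / t by ring, div_pow, pow_succ,
      pow_mul, Real.sq_sqrt (by positivity)]
  rw [h2, kernelTerm]
  rw [show Real.sqrt (z / w) * (Real.exp (-(z + w) / t) / t) *
      ((z * w) ^ m * Real.sqrt (z * w) / t ^ (2 * m + 1) /
        ((m.factorial : ℝ) * ((m + 1).factorial : ℝ))) =
      (Real.sqrt (z / w) * Real.sqrt (z * w)) * Real.exp (-(z + w) / t) * (z * w) ^ m /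
        (t * t ^ (2 * m + 1) * ((m.factorial : ℝ) * ((m + 1).factorial : ℝ))) by
      field_simp, h1, mul_pow, ← pow_succ']
  ring

theorem kimuraKernel_nonneg {z w t : ℝ} (hz : 0 ≤ z) (hw : 0 < w) (ht : 0 < t) :
    0 ≤ kimuraKernel z w t :=
  (hasSum_kimuraKernel hz hw ht).nonneg (kernelTerm_nonneg hz hw ht)

theorem kimuraKernel_zero_left (w t : ℝ) : kimuraKernel 0 w t = 0 := by
  simp [kimuraKernel]

theorem ofReal_kimuraKernel {z w t : ℝ} (hz : 0 ≤ z) (hw : 0 < w) (ht : 0 < t) :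
    ENNReal.ofReal (kimuraKernel z w t) = ∑' m, ENNReal.ofReal (kernelTerm z w t m) := by
  have h := hasSum_kimuraKernel hz hw ht
  rw [← h.tsum_eq, ENNReal.ofReal_tsum_of_nonneg (kernelTerm_nonneg hz hw ht) h.summable]

theorem measurable_besselI (k : ℕ) : Measurable (besselI k) := by
  unfold besselI
  fun_prop

theorem measurable_kimuraKernel : Measurable fun p : ℝ × ℝ × ℝ => kimuraKernel p.1 p.2.1 p.2.2 := by
  have := measurable_besselI 1
  unfold kimuraKernel
  fun_prop

/-! ### Gamma integrals and the mass of q₀ -/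

theorem integral_pow_mul_exp_neg_mul_Ioi (k : ℕ) {a : ℝ} (ha : 0 < a) :
    ∫ x in Ioi (0 : ℝ), x ^ k * Real.exp (-(a * x)) = k.factorial / a ^ (k + 1) := by
  have h := Real.integral_rpow_mul_exp_neg_mul_Ioi (a := k + 1) (by positivity) ha
  rw [Real.Gamma_nat_eq_factorial] at h
  have e : (1 / a) ^ ((k : ℝ) + 1) = 1 / a ^ (k + 1) := by
    rw [← Nat.cast_succ, Real.rpow_natCast, div_pow, one_pow]
  rw [e] at h
  rw [div_eq_mul_one_div, mul_comm, ← h]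
  refine setIntegral_congr_fun measurableSet_Ioi fun x _ => ?_
  simp

theorem lintegral_ofReal_eq_of_integral {α : Type*} [MeasurableSpace α] {μ : Measure α}
    {f : α → ℝ} {c : ℝ} (hc : c ≠ 0) (hf : 0 ≤ᵐ[μ] f) (h : ∫ x, f x ∂μ = c) :
    ∫⁻ x, ENNReal.ofReal (f x) ∂μ = ENNReal.ofReal c := by
  -- A nonzero Bochner integral certifies integrability, since the integral of a non-integrable
  -- function is 0 by convention.
  rw [← h, ofReal_integral_eq_lintegral_ofReal (.of_integral_ne_zero (h ▸ hc)) hf]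

theorem lintegral_pow_mul_exp_neg_mul_Ioi (k : ℕ) {a : ℝ} (ha : 0 < a) :
    ∫⁻ x in Ioi (0 : ℝ), ENNReal.ofReal (x ^ k * Real.exp (-(a * x))) =
      ENNReal.ofReal (k.factorial / a ^ (k + 1)) := by
  refine lintegral_ofReal_eq_of_integral (by positivity) ?_ (integral_pow_mul_exp_neg_mul_Ioi k ha)
  filter_upwards [self_mem_ae_restrict measurableSet_Ioi] with x hx
  have : (0 : ℝ) < x := hx
  simp only [Pi.zero_apply]
  positivity

/-- The substitution x ↦ 1/x turns this into a Gamma integral; its Jacobian x⁻² accounts for the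
exponent k + 2. -/
theorem lintegral_exp_neg_div_div_pow_Ioi (k : ℕ) {a : ℝ} (ha : 0 < a) :
    ∫⁻ x in Ioi (0 : ℝ), ENNReal.ofReal (Real.exp (-(a / x)) / x ^ (k + 2)) =
      ENNReal.ofReal (k.factorial / a ^ (k + 1)) := by
  refine lintegral_ofReal_eq_of_integral (by positivity) ?_ ?_
  · filter_upwards [self_mem_ae_restrict measurableSet_Ioi] with x hx
    have : (0 : ℝ) < x := hx
    simp only [Pi.zero_apply]
    positivity
  · rw [← integral_pow_mul_exp_neg_mul_Ioi k ha,
      ← integral_comp_rpow_Ioi _ (show (-1 : ℝ) ≠ 0 by norm_num)]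
    refine setIntegral_congr_fun measurableSet_Ioi fun x hx => ?_
    have hx : (0 : ℝ) < x := hx
    have e : x ^ ((-1 : ℝ) - 1) = (x ^ 2)⁻¹ := by
      rw [show (-1 : ℝ) - 1 = -((2 : ℕ) : ℝ) by norm_num, Real.rpow_neg hx.le, Real.rpow_natCast]
    simp only [e, Real.rpow_neg_one, smul_eq_mul, abs_neg, abs_one, one_mul]
    rw [inv_pow, pow_add]
    field_simp

/-- The m-th term integrates to the Poisson weight of index m + 1 with parameter z/t. Only index 0
is missing: it is the mass absorbed at the boundary. -/
theorem lintegral_kimuraKernel_le {z t : ℝ} (hz : 0 ≤ z) (ht : 0 < t) :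
    ∫⁻ w in Ioi (0 : ℝ), ENNReal.ofReal (kimuraKernel z w t) ≤ 1 := by
  have h1 : ∫⁻ w in Ioi (0 : ℝ), ENNReal.ofReal (kimuraKernel z w t) =
      ∫⁻ w in Ioi (0 : ℝ), ∑' m, ENNReal.ofReal (kernelTerm z w t m) :=
    setLIntegral_congr_fun measurableSet_Ioi fun w hw => ofReal_kimuraKernel hz hw ht
  have h2 (m : ℕ) : ∫⁻ w in Ioi (0 : ℝ), ENNReal.ofReal (kernelTerm z w t m) =
      ENNReal.ofReal (Real.exp (-(z / t)) * ((z / t) ^ (m + 1) / ((m + 1).factorial : ℝ))) := by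
    have e (w : ℝ) : ENNReal.ofReal (kernelTerm z w t m) =
        ENNReal.ofReal (Real.exp (-(z / t)) * z ^ (m + 1) /
          (t ^ (2 * m + 2) * ((m.factorial : ℝ) * ((m + 1).factorial : ℝ)))) *
        ENNReal.ofReal (w ^ m * Real.exp (-(t⁻¹ * w))) := by
      rw [← ENNReal.ofReal_mul (by positivity), kernelTerm,
        show -(z + w) / t = -(z / t) + -(t⁻¹ * w) by field_simp; ring, Real.exp_add]
      congr 1
      ring
    simp_rw [e]
    rw [lintegral_const_mul _ (by fun_prop), lintegral_pow_mul_exp_neg_mul_Ioi m (by positivity),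
      ← ENNReal.ofReal_mul (by positivity)]
    congr 1
    rw [inv_pow, div_pow]
    field_simp
    ring
  rw [h1, lintegral_tsum fun m => by unfold kernelTerm; fun_prop]
  simp_rw [h2]
  have h3 := (NormedSpace.expSeries_div_hasSum_exp (z / t))
  have h4 := (Real.summable_pow_div_factorial (z / t))
  have h5 : Real.exp (z / t) = ∑' n : ℕ, (z / t) ^ n / (n.factorial : ℝ) := by
    rw [Real.exp_eq_exp_ℝ, h3.tsum_eq]
  have h6 := (summable_nat_add_iff 1).2 h4
  rw [← ENNReal.ofReal_tsum_of_nonneg (fun m => by positivity) (h6.mul_left _), tsum_mul_left,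
    ENNReal.ofReal_le_one]
  have h7 : ∑' n : ℕ, (z / t) ^ (n + 1) / ((n + 1).factorial : ℝ) ≤ Real.exp (z / t) := by
    rw [h5, h4.tsum_eq_zero_add]
    simp
  calc _ ≤ Real.exp (-(z / t)) * Real.exp (z / t) := by gcongr
    _ = 1 := by rw [← Real.exp_add]; simp

/-! ### The square integral of q₀ over space and time -/

/-- The scaled central binomial coefficients `C(2j, j) / 4^j`. -/
def scaledCentralBinom (j : ℕ) : ℝ := (j.centralBinom : ℝ) / 4 ^ j

/-- Each summand is C(k+1, m) C(k+1, n) / ((k+1) 2^(2k+3)) with m + n = k, so Vandermonde sums them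
to C(2k+2, k). This is a multiple of the central coefficient C(2k+2, k+1), and the recursion of
central coefficients turns the result into a difference. -/
theorem sum_antidiagonal_scaledCentralBinom (k : ℕ) :
    ∑ p ∈ Finset.HasAntidiagonal.antidiagonal k, (k.factorial : ℝ) * ((k + 1).factorial : ℝ) /
      (2 ^ (2 * k + 3) * (p.1.factorial * (p.1 + 1).factorial) *
        (p.2.factorial * (p.2 + 1).factorial)) =
      scaledCentralBinom (k + 1) - scaledCentralBinom (k + 2) := by
  have h1 : ∀ p ∈ Finset.HasAntidiagonal.antidiagonal k, (k.factorial : ℝ) * ((k + 1).factorial : ℝ) /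
      (2 ^ (2 * k + 3) * (p.1.factorial * (p.1 + 1).factorial) *
        (p.2.factorial * (p.2 + 1).factorial)) =
      (((k + 1).choose p.1 * (k + 1).choose p.2 : ℕ) : ℝ) / ((k + 1) * 2 ^ (2 * k + 3)) := by
    rintro ⟨m, n⟩ hp
    obtain rfl : m + n = k := by simpa using hp
    have e1 : ((m + n + 1).choose m : ℝ) * (m.factorial * (n + 1).factorial) =
        (m + n + 1).factorial := by
      have := Nat.add_choose_mul_factorial_mul_factorial m (n + 1)
      rw [← Nat.choose_symm_add, ← add_assoc] at this
      rw [← mul_assoc]; exact_mod_cast this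
    have e2 : ((m + n + 1).choose n : ℝ) * (n.factorial * (m + 1).factorial) =
        (m + n + 1).factorial := by
      have := Nat.add_choose_mul_factorial_mul_factorial n (m + 1)
      rw [← Nat.choose_symm_add, show n + (m + 1) = m + n + 1 by ring] at this
      rw [← mul_assoc]; exact_mod_cast this
    have e3 : ((m + n + 1).factorial : ℝ) = (m + n + 1) * (m + n).factorial := by
      rw [Nat.factorial_succ]; push_cast; ring
    push_cast
    rw [div_eq_div_iff (by positivity) (by positivity)]
    have e4 : ((m + n).factorial : ℝ) * (m + n + 1) = (m + n + 1).factorial := by rw [e3]; ring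
    calc _ = (((m + n).factorial : ℝ) * (m + n + 1)) * (m + n + 1).factorial * 2 ^ (2 * (m + n) + 3) := by
          ring
      _ = _ := by
        rw [e4]
        nth_rewrite 1 [← e1]
        rw [← e2]
        ring
  rw [Finset.sum_congr rfl h1, ← Finset.sum_div, ← Nat.cast_sum, ← Nat.add_choose_eq]
  have h2 : (k + 2) * (k + 1 + (k + 1)).choose k = (k + 1) * (k + 1).centralBinom := by
    have := Nat.choose_succ_right_eq (2 * (k + 1)) k
    rw [Nat.centralBinom, show k + 1 + (k + 1) = 2 * (k + 1) by ring]
    rw [show 2 * (k + 1) - k = k + 2 by omega] at this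
    linarith
  have h3 := Nat.succ_mul_centralBinom_succ (k + 1)
  have h2' : ((k : ℝ) + 2) * ((k + 1 + (k + 1)).choose k : ℕ) = (k + 1) * (k + 1).centralBinom := by
    exact_mod_cast h2
  have h3' : ((k : ℝ) + 2) * (k + 2).centralBinom = 2 * (2 * k + 3) * (k + 1).centralBinom := by
    have : ((k : ℝ) + 1 + 1) * (k + 2).centralBinom = 2 * (2 * (k + 1) + 1) * (k + 1).centralBinom := by
      exact_mod_cast h3
    linarith
  have h2'' : (((k + 1 + (k + 1)).choose k : ℕ) : ℝ) = (k + 1) * (k + 1).centralBinom / (k + 2) := by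
    field_simp; linarith
  have h3'' : ((k + 2).centralBinom : ℝ) = 2 * (2 * k + 3) * (k + 1).centralBinom / (k + 2) := by
    field_simp; linarith
  rw [scaledCentralBinom, scaledCentralBinom, h2'', h3'',
    show (2 : ℝ) ^ (2 * k + 3) = 4 ^ k * 8 by rw [pow_add, pow_mul]; norm_num,
    pow_succ, pow_add]
  field_simp
  ring

theorem tsum_prod_eq_tsum_sum_antidiagonal (f : ℕ × ℕ → ℝ≥0∞) :
    ∑' p, f p = ∑' k, ∑ p ∈ Finset.HasAntidiagonal.antidiagonal k, f p := by
  rw [← Finset.HasAntidiagonal.sigmaAntidiagonalEquivProd.tsum_eq, ENNReal.tsum_sigma']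
  refine tsum_congr fun k => ?_
  rw [tsum_fintype]
  exact Finset.sum_coe_sort (Finset.HasAntidiagonal.antidiagonal k) f

/-- The w-integral is a Gamma integral with rate 2/t, and the t-integral one in 1/t with rate 2z.
The powers of z cancel, as scaling z, w and t together predicts. -/
theorem lintegral_kernelTerm_mul {z : ℝ} (hz : 0 < z) (m n : ℕ) :
    ∫⁻ t in Ioi (0 : ℝ), ∫⁻ w in Ioi (0 : ℝ),
      ENNReal.ofReal (kernelTerm z w t m) * ENNReal.ofReal (kernelTerm z w t n) =
    ENNReal.ofReal (((m + n).factorial : ℝ) * ((m + n + 1).factorial : ℝ) /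
      (2 ^ (2 * (m + n) + 3) * (m.factorial * (m + 1).factorial) *
        (n.factorial * (n + 1).factorial))) := by
  set C : ℝ := ((m.factorial : ℝ) * ((m + 1).factorial : ℝ)) *
    ((n.factorial : ℝ) * ((n + 1).factorial : ℝ)) with hC
  have hC0 : 0 < C := by positivity
  have h1 : ∀ t ∈ Ioi (0 : ℝ), ∫⁻ w in Ioi (0 : ℝ),
      ENNReal.ofReal (kernelTerm z w t m) * ENNReal.ofReal (kernelTerm z w t n) =
      ENNReal.ofReal (z ^ (m + n + 2) * (m + n).factorial / (2 ^ (m + n + 1) * C)) *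
        ENNReal.ofReal (Real.exp (-(2 * z / t)) / t ^ (m + n + 1 + 2)) := by
    intro t ht
    have ht : (0 : ℝ) < t := ht
    have e : ∀ w ∈ Ioi (0 : ℝ),
        ENNReal.ofReal (kernelTerm z w t m) * ENNReal.ofReal (kernelTerm z w t n) =
        ENNReal.ofReal (Real.exp (-(2 * z / t)) * z ^ (m + n + 2) / (t ^ (2 * (m + n) + 4) * C)) *
        ENNReal.ofReal (w ^ (m + n) * Real.exp (-(2 / t * w))) := by
      intro w hw
      rw [← ENNReal.ofReal_mul (kernelTerm_nonneg hz.le hw ht m),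
        ← ENNReal.ofReal_mul (by positivity), kernelTerm, kernelTerm]
      congr 1
      have : Real.exp (-(z + w) / t) * Real.exp (-(z + w) / t) =
          Real.exp (-(2 * z / t)) * Real.exp (-(2 / t * w)) := by
        rw [← Real.exp_add, ← Real.exp_add]
        congr 1
        field_simp
        ring
      rw [div_mul_div_comm, show Real.exp (-(z + w) / t) * z ^ (m + 1) * w ^ m *
          (Real.exp (-(z + w) / t) * z ^ (n + 1) * w ^ n) =
          (Real.exp (-(z + w) / t) * Real.exp (-(z + w) / t)) * (z ^ (m + n + 2) * w ^ (m + n)) by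
          ring, this, hC]
      ring
    rw [setLIntegral_congr_fun measurableSet_Ioi e, lintegral_const_mul _ (by fun_prop),
      lintegral_pow_mul_exp_neg_mul_Ioi _ (by positivity), ← ENNReal.ofReal_mul (by positivity),
      ← ENNReal.ofReal_mul (by positivity)]
    congr 1
    rw [div_pow]
    field_simp
    ring
  rw [setLIntegral_congr_fun measurableSet_Ioi h1, lintegral_const_mul _ (by fun_prop),
    lintegral_exp_neg_div_div_pow_Ioi _ (by positivity), ← ENNReal.ofReal_mul (by positivity)]
  congr 1
  rw [hC, mul_pow]
  field_simp
  ring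

/-- Squaring the series and grouping by k = m + n gives a telescoping sum. Its partial sums stay
below the first coefficient C(2, 1)/4 = 1/2, which is the constant behind the factor 2 in the
theorem. -/
theorem lintegral_sq_kimuraKernel_le {z : ℝ} (hz : 0 ≤ z) :
    ∫⁻ t in Ioi (0 : ℝ), ∫⁻ w in Ioi (0 : ℝ), ENNReal.ofReal (kimuraKernel z w t) ^ 2 ≤ 1 / 2 := by
  rcases hz.eq_or_lt with rfl | hz
  · simp [kimuraKernel_zero_left]
  have hm (m : ℕ) : Measurable fun p : ℝ × ℝ => ENNReal.ofReal (kernelTerm z p.2 p.1 m) := by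
    unfold kernelTerm; fun_prop
  have hm' (m : ℕ) (t : ℝ) : Measurable fun w : ℝ => ENNReal.ofReal (kernelTerm z w t m) := by
    unfold kernelTerm; fun_prop
  have h1 : ∀ t ∈ Ioi (0 : ℝ), ∫⁻ w in Ioi (0 : ℝ), ENNReal.ofReal (kimuraKernel z w t) ^ 2 =
      ∑' p : ℕ × ℕ, ∫⁻ w in Ioi (0 : ℝ),
        ENNReal.ofReal (kernelTerm z w t p.1) * ENNReal.ofReal (kernelTerm z w t p.2) := by
    intro t ht
    have hm2 (p : ℕ × ℕ) : Measurable fun w =>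
        ENNReal.ofReal (kernelTerm z w t p.1) * ENNReal.ofReal (kernelTerm z w t p.2) :=
      (hm' _ t).mul (hm' _ t)
    rw [← lintegral_tsum fun p => (hm2 p).aemeasurable]
    refine setLIntegral_congr_fun measurableSet_Ioi fun w hw => ?_
    rw [ofReal_kimuraKernel hz.le hw ht, sq, ← ENNReal.tsum_mul_right,
      ENNReal.tsum_prod (f := fun m n =>
        ENNReal.ofReal (kernelTerm z w t m) * ENNReal.ofReal (kernelTerm z w t n))]
    exact tsum_congr fun m => ENNReal.tsum_mul_left.symm
  have hm3 (p : ℕ × ℕ) : Measurable fun t => ∫⁻ w in Ioi (0 : ℝ),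
      ENNReal.ofReal (kernelTerm z w t p.1) * ENNReal.ofReal (kernelTerm z w t p.2) :=
    ((hm p.1).mul (hm p.2)).lintegral_prod_right'
  rw [setLIntegral_congr_fun measurableSet_Ioi h1, lintegral_tsum fun p => (hm3 p).aemeasurable,
    tsum_prod_eq_tsum_sum_antidiagonal]
  simp_rw [lintegral_kernelTerm_mul hz]
  refine ENNReal.tsum_le_of_sum_range_le fun n => ?_
  have h2 (k : ℕ) : ∑ p ∈ Finset.HasAntidiagonal.antidiagonal k,
      ENNReal.ofReal (((p.1 + p.2).factorial : ℝ) * ((p.1 + p.2 + 1).factorial : ℝ) /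
      (2 ^ (2 * (p.1 + p.2) + 3) * (p.1.factorial * (p.1 + 1).factorial) *
        (p.2.factorial * (p.2 + 1).factorial))) =
      ENNReal.ofReal (scaledCentralBinom (k + 1) - scaledCentralBinom (k + 2)) := by
    rw [← sum_antidiagonal_scaledCentralBinom, ENNReal.ofReal_sum_of_nonneg fun _ _ => by positivity]
    refine Finset.sum_congr rfl fun p hp => ?_
    rw [Finset.HasAntidiagonal.mem_antidiagonal.1 hp]
  simp_rw [h2]
  rw [← ENNReal.ofReal_sum_of_nonneg fun k _ => by
      rw [← sum_antidiagonal_scaledCentralBinom]; positivity,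
    Finset.sum_range_sub' (fun k => scaledCentralBinom (k + 1))]
  have h3 : scaledCentralBinom (0 + 1) = 1 / 2 := by
    simp [scaledCentralBinom, Nat.centralBinom, Nat.choose]; norm_num
  have h4 : 0 ≤ scaledCentralBinom (n + 1) := by unfold scaledCentralBinom; positivity
  calc _ ≤ ENNReal.ofReal (1 / 2) := by
        gcongr; linarith
    _ = 1 / 2 := by
      rw [ENNReal.ofReal_div_of_pos (by norm_num)]; simp

/-! ### Integration over powers of a measure space -/

section Pi

variable {α : Type*}

/-- The tensor power `h ⊗ ⋯ ⊗ h`. -/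
def tensorPow (n : ℕ) (h : α → ℝ) (x : Fin n → α) : ℝ := ∏ i, h (x i)

theorem tensorPow_zero (h : α → ℝ) (x : Fin 0 → α) : tensorPow 0 h x = 1 := by simp [tensorPow]

theorem tensorPow_snoc {n : ℕ} (h : α → ℝ) (x : Fin n → α) (y : α) :
    tensorPow (n + 1) h (Fin.snoc x y) = tensorPow n h x * h y := by
  simp [tensorPow, Fin.prod_univ_castSucc]

variable [MeasurableSpace α] {μ : Measure α} [SigmaFinite μ]

theorem measurable_snoc (n : ℕ) :
    Measurable fun p : α × (Fin n → α) => (Fin.snoc p.2 p.1 : Fin (n + 1) → α) := by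
  refine measurable_pi_lambda _ fun i => ?_
  induction i using Fin.lastCases with
  | last => simpa using measurable_fst
  | cast i => simpa [Function.comp_def] using (measurable_pi_apply i).comp measurable_snd

theorem measurable_init (n : ℕ) : Measurable fun x : Fin (n + 1) → α => (Fin.init x : Fin n → α) :=
  measurable_pi_lambda _ fun i => measurable_pi_apply (i.castSucc)

variable (μ) in
theorem measurePreserving_snoc (n : ℕ) :
    MeasurePreserving (fun p : α × (Fin n → α) => (Fin.snoc p.2 p.1 : Fin (n + 1) → α))
      (μ.prod (Measure.pi fun _ => μ)) (Measure.pi fun _ => μ) := by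
  have h := (measurePreserving_piFinSuccAbove (fun _ : Fin (n + 1) => μ) (Fin.last n)).symm
  convert h using 2 with p
  exact (Fin.insertNth_last' p.1 p.2).symm

theorem lintegral_pi_succ {n : ℕ} {f : (Fin (n + 1) → α) → ℝ≥0∞} (hf : Measurable f) :
    ∫⁻ x, f x ∂(Measure.pi fun _ => μ) =
      ∫⁻ y, ∫⁻ x, f (Fin.snoc x y) ∂(Measure.pi fun _ => μ) ∂μ := by
  rw [← (measurePreserving_snoc μ n).lintegral_comp hf]
  exact lintegral_prod _ (hf.comp (measurable_snoc n)).aemeasurable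

theorem integral_pi_succ {n : ℕ} {f : (Fin (n + 1) → α) → ℝ}
    (hf : Integrable f (Measure.pi fun _ => μ)) :
    ∫ x, f x ∂(Measure.pi fun _ => μ) =
      ∫ y, ∫ x, f (Fin.snoc x y) ∂(Measure.pi fun _ => μ) ∂μ := by
  have h := measurePreserving_snoc μ n
  have e : MeasurableEmbedding
      (fun p : α × (Fin n → α) => (Fin.snoc p.2 p.1 : Fin (n + 1) → α)) := by
    convert (MeasurableEquiv.piFinSuccAbove (fun _ : Fin (n + 1) => α)
      (Fin.last n)).symm.measurableEmbedding using 2 with p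
    exact (Fin.insertNth_last' p.1 p.2).symm
  rw [← h.integral_comp e]
  exact integral_prod _ ((h.integrable_comp_emb e).2 hf)

theorem memLp_tensorPow (n : ℕ) {h : α → ℝ} (hh : MemLp h 2 μ) :
    MemLp (tensorPow n h) 2 (Measure.pi fun _ => μ) := by
  have hm : AEStronglyMeasurable (tensorPow n h) (Measure.pi fun _ => μ) := by
    unfold tensorPow
    refine (Finset.aestronglyMeasurable_fun_prod _ fun i _ => ?_)
    exact hh.1.comp_quasiMeasurePreserving (Measure.quasiMeasurePreserving_eval _ i)
  rw [memLp_two_iff_integrable_sq hm]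
  simp_rw [tensorPow, ← Finset.prod_pow]
  exact Integrable.fintype_prod (f := fun _ y => h y ^ 2) fun _ => hh.integrable_sq

theorem integral_tensorPow_mul (n : ℕ) (h k : α → ℝ) :
    ∫ x, tensorPow n h x * tensorPow n k x ∂(Measure.pi fun _ => μ) = (∫ y, h y * k y ∂μ) ^ n := by
  simp_rw [tensorPow, ← Finset.prod_mul_distrib]
  rw [integral_fintype_prod_eq_pow (fun y => h y * k y), Fintype.card_fin]

end Pi

/-! ### The deterministic solution -/

instance : SigmaFinite quadrant := by unfold quadrant; infer_instance

theorem quadrant_eq_prod :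
    quadrant = (volume.restrict (Ioi (0 : ℝ))).prod (volume.restrict (Ioi (0 : ℝ))) := by
  rw [Measure.prod_restrict]; rfl

theorem ae_quadrant_pos : ∀ᵐ y ∂quadrant, 0 < y.1 ∧ 0 < y.2 :=
  ae_restrict_of_forall_mem (measurableSet_Ioi.prod measurableSet_Ioi) fun _ hy => hy

open Classical in
/-- The initial condition, extended by `0`. -/
def extendedDatum (u₀ : Ioi (0 : ℝ) →ᵇ ℝ) (z : ℝ) : ℝ := if hz : 0 < z then u₀ ⟨z, hz⟩ else 0

theorem measurable_extendedDatum (u₀ : Ioi (0 : ℝ) →ᵇ ℝ) : Measurable (extendedDatum u₀) := by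
  classical
  exact Measurable.dite (s := Ioi (0 : ℝ)) (f := fun z => u₀ z) (g := fun _ => 0)
    u₀.continuous.measurable measurable_const measurableSet_Ioi

theorem norm_extendedDatum_le (u₀ : Ioi (0 : ℝ) →ᵇ ℝ) (z : ℝ) : ‖extendedDatum u₀ z‖ ≤ ‖u₀‖ := by
  unfold extendedDatum
  split_ifs
  · exact u₀.norm_coe_le_norm _
  · simp

theorem detSolution_eq (u₀ : Ioi (0 : ℝ) →ᵇ ℝ) (z t : ℝ) :
    detSolution u₀ z t = if 0 < z then if 0 < t then
      ∫ w in Ioi (0 : ℝ), kimuraKernel z w t * extendedDatum u₀ w else extendedDatum u₀ z else 0 := by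
  unfold detSolution
  split_ifs with hz ht
  · rw [← integral_subtype_comap measurableSet_Ioi]
    refine integral_congr_ae (.of_forall fun w => ?_)
    have : 0 < (w : ℝ) := w.2
    simp [extendedDatum, this]
  · simp [extendedDatum, hz]
  · rfl

theorem measurable_detSolution (u₀ : Ioi (0 : ℝ) →ᵇ ℝ) :
    Measurable fun p : ℝ × ℝ => detSolution u₀ p.1 p.2 := by
  simp_rw [detSolution_eq]
  refine Measurable.ite (measurableSet_lt measurable_const measurable_fst)
    (Measurable.ite (measurableSet_lt measurable_const measurable_snd) ?_ ?_) measurable_const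
  · have : Measurable fun q : (ℝ × ℝ) × ℝ => kimuraKernel q.1.1 q.2 q.1.2 * extendedDatum u₀ q.2 :=
      (measurable_kimuraKernel.comp (f := fun q : (ℝ × ℝ) × ℝ => (q.1.1, q.2, q.1.2))
        (by fun_prop)).mul ((measurable_extendedDatum u₀).comp measurable_snd)
    exact (this.stronglyMeasurable.integral_prod_right').measurable
  · exact (measurable_extendedDatum u₀).comp measurable_fst

/-- The mass of q₀ is at most 1. Stating the bound with `enorm` avoids any integrability argument.
-/
theorem enorm_detSolution_le (u₀ : Ioi (0 : ℝ) →ᵇ ℝ) (z t : ℝ) : ‖detSolution u₀ z t‖ₑ ≤ ‖u₀‖ₑ := by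
  have h0 (w : ℝ) : ‖extendedDatum u₀ w‖ₑ ≤ ‖u₀‖ₑ :=
    enorm_le_iff_norm_le.2 (norm_extendedDatum_le u₀ w)
  rw [detSolution_eq]
  split_ifs with hz ht
  · refine (enorm_integral_le_lintegral_enorm _).trans ?_
    calc ∫⁻ w in Ioi (0 : ℝ), ‖kimuraKernel z w t * extendedDatum u₀ w‖ₑ
        ≤ ∫⁻ w in Ioi (0 : ℝ), ‖u₀‖ₑ * ENNReal.ofReal (kimuraKernel z w t) := by
          refine setLIntegral_mono' measurableSet_Ioi fun w hw => ?_
          rw [enorm_mul, mul_comm, Real.enorm_of_nonneg (kimuraKernel_nonneg hz.le hw ht)]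
          gcongr
          exact h0 w
      _ = ‖u₀‖ₑ * ∫⁻ w in Ioi (0 : ℝ), ENNReal.ofReal (kimuraKernel z w t) := by
          refine lintegral_const_mul _ ?_
          exact (measurable_kimuraKernel.comp (f := fun w : ℝ => (z, w, t)) (by fun_prop)).ennreal_ofReal
      _ ≤ ‖u₀‖ₑ * 1 := by gcongr; exact lintegral_kimuraKernel_le hz.le ht
      _ = ‖u₀‖ₑ := mul_one _
  · exact h0 z
  · simp

/-! ### The kernels of the chaos expansion -/

/-- The integrand `(w, τ) ↦ 1_{(0,t)}(τ) q₀(z, w, t - τ)` of the mild equation. -/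
def noiseKernel (z t : ℝ) (y : ℝ × ℝ) : ℝ :=
  (Ioo 0 t).indicator (fun τ => kimuraKernel z y.1 (t - τ)) y.2

theorem indicator_kernel_mul (z t : ℝ) (y : ℝ × ℝ) (f : ℝ → ℝ) :
    (Ioo 0 t).indicator (fun τ => kimuraKernel z y.1 (t - τ) * f τ) y.2 =
      noiseKernel z t y * f y.2 := by
  unfold noiseKernel
  by_cases h : y.2 ∈ Ioo 0 t <;> simp [h]

theorem noiseKernel_eq_ite (z t : ℝ) (y : ℝ × ℝ) :
    noiseKernel z t y = if 0 < y.2 ∧ y.2 < t then kimuraKernel z y.1 (t - y.2) else 0 := by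
  simp [noiseKernel, indicator_apply]

theorem measurable_noiseKernel_prod :
    Measurable fun p : (ℝ × ℝ) × ℝ × ℝ => noiseKernel p.1.1 p.1.2 p.2 := by
  simp_rw [noiseKernel_eq_ite]
  refine Measurable.ite (p := fun p : (ℝ × ℝ) × ℝ × ℝ => 0 < p.2.2 ∧ p.2.2 < p.1.2) ?_
    (measurable_kimuraKernel.comp (f := fun p : (ℝ × ℝ) × ℝ × ℝ => (p.1.1, p.2.1, p.1.2 - p.2.2))
      (by fun_prop)) measurable_const
  exact (measurableSet_lt (f := fun _ : (ℝ × ℝ) × ℝ × ℝ => (0 : ℝ)) (by fun_prop)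
    (by fun_prop)).inter (measurableSet_lt (f := fun p : (ℝ × ℝ) × ℝ × ℝ => p.2.2)
      (by fun_prop) (by fun_prop))

theorem measurable_noiseKernel (z t : ℝ) : Measurable (noiseKernel z t) :=
  measurable_noiseKernel_prod.comp (measurable_prodMk_left (x := (z, t)))

theorem noiseKernel_zero_left (t : ℝ) (y : ℝ × ℝ) : noiseKernel 0 t y = 0 := by
  simp [noiseKernel_eq_ite, kimuraKernel_zero_left]

theorem noiseKernel_zero_right (z : ℝ) (y : ℝ × ℝ) : noiseKernel z 0 y = 0 := by
  simp [noiseKernel]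

/-- Reflecting τ ↦ t - τ and enlarging the time interval to the half-line makes the bound uniform in
t. -/
theorem lintegral_sq_noiseKernel_le {z : ℝ} (hz : 0 ≤ z) (t : ℝ) :
    ∫⁻ y, ‖noiseKernel z t y‖ₑ ^ 2 ∂quadrant ≤ 1 / 2 := by
  set G : ℝ → ℝ≥0∞ := fun s => ∫⁻ w in Ioi (0 : ℝ), ENNReal.ofReal (kimuraKernel z w s) ^ 2
  have hG : Measurable ((Ioi (0 : ℝ)).indicator G) := by
    refine Measurable.indicator ?_ measurableSet_Ioi
    refine Measurable.lintegral_prod_right'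
      (f := fun p : ℝ × ℝ => ENNReal.ofReal (kimuraKernel z p.2 p.1) ^ 2) ?_
    exact ((measurable_kimuraKernel.comp (f := fun p : ℝ × ℝ => (z, p.2, p.1))
      (by fun_prop)).ennreal_ofReal).pow_const 2
  rw [quadrant_eq_prod, lintegral_prod_symm' _ ((measurable_noiseKernel z t).enorm.pow_const 2)]
  calc ∫⁻ τ in Ioi (0 : ℝ), ∫⁻ w in Ioi (0 : ℝ), ‖noiseKernel z t (w, τ)‖ₑ ^ 2
      ≤ ∫⁻ τ in Ioi (0 : ℝ), (Ioi (0 : ℝ)).indicator G (t - τ) := by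
        refine lintegral_mono fun τ => ?_
        by_cases h : 0 < τ ∧ τ < t
        · have h' : 0 < t - τ := sub_pos.2 h.2
          rw [indicator_of_mem (show t - τ ∈ Ioi (0 : ℝ) from h')]
          refine setLIntegral_mono' measurableSet_Ioi fun w hw => ?_
          simp only [noiseKernel_eq_ite, h, and_self, if_true]
          rw [Real.enorm_of_nonneg (kimuraKernel_nonneg hz hw h')]
        · simp [noiseKernel_eq_ite, h]
    _ ≤ ∫⁻ τ, (Ioi (0 : ℝ)).indicator G (t - τ) := setLIntegral_le_lintegral _ _
    _ = ∫⁻ τ in Ioi (0 : ℝ), G τ := by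
        rw [lintegral_sub_left_eq_self (fun s => (Ioi (0 : ℝ)).indicator G s) t,
          lintegral_indicator measurableSet_Ioi]
    _ ≤ 1 / 2 := lintegral_sq_kimuraKernel_le hz

theorem memLp_two_of_lintegral {α : Type*} [MeasurableSpace α] {μ : Measure α} {f : α → ℝ}
    (hf : AEStronglyMeasurable f μ) (h : ∫⁻ x, ‖f x‖ₑ ^ 2 ∂μ ≠ ∞) : MemLp f 2 μ := by
  refine ⟨hf, ?_⟩
  rw [eLpNorm_lt_top_iff_lintegral_rpow_enorm_lt_top (by norm_num) (by norm_num)]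
  simpa using h.lt_top

theorem memLp_noiseKernel {z : ℝ} (hz : 0 ≤ z) (t : ℝ) : MemLp (noiseKernel z t) 2 quadrant :=
  memLp_two_of_lintegral (measurable_noiseKernel z t).aestronglyMeasurable
    (ne_top_of_le_ne_top (by simp) (lintegral_sq_noiseKernel_le hz t))

variable (u₀ : Ioi (0 : ℝ) →ᵇ ℝ)

theorem chaosKernel_succ (n : ℕ) (z t : ℝ) (x : Fin (n + 1) → ℝ × ℝ) :
    chaosKernel u₀ (n + 1) z t x = noiseKernel z t (x (Fin.last n)) *
      chaosKernel u₀ n (x (Fin.last n)).1 (x (Fin.last n)).2 (Fin.init x) :=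
  indicator_kernel_mul z t (x (Fin.last n)) fun τ =>
    chaosKernel u₀ n (x (Fin.last n)).1 τ (Fin.init x)

theorem chaosKernel_snoc (n : ℕ) (z t : ℝ) (x : Fin n → ℝ × ℝ) (y : ℝ × ℝ) :
    chaosKernel u₀ (n + 1) z t (Fin.snoc x y) = noiseKernel z t y * chaosKernel u₀ n y.1 y.2 x := by
  simp [chaosKernel_succ, -Prod.mk.eta]

theorem measurable_chaosKernel_prod (n : ℕ) :
    Measurable fun p : (ℝ × ℝ) × (Fin n → ℝ × ℝ) => chaosKernel u₀ n p.1.1 p.1.2 p.2 := by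
  induction n with
  | zero => exact (measurable_detSolution u₀).comp measurable_fst
  | succ n ih =>
    simp_rw [chaosKernel_succ]
    have hl : Measurable fun p : (ℝ × ℝ) × (Fin (n + 1) → ℝ × ℝ) => p.2 (Fin.last n) :=
      (measurable_pi_apply _).comp measurable_snd
    exact (measurable_noiseKernel_prod.comp (measurable_fst.prodMk hl)).mul
      (ih.comp (hl.prodMk ((measurable_init n).comp measurable_snd)))

theorem measurable_chaosKernel (n : ℕ) (z t : ℝ) : Measurable (chaosKernel u₀ n z t) :=
  (measurable_chaosKernel_prod u₀ n).comp (measurable_prodMk_left (x := (z, t)))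

/-- Integrating out the earlier variables first leaves the induction hypothesis at the point (zₙ,
tₙ). Its bound does not depend on that point, so the last kernel contributes exactly its factor 1/2.
-/
theorem lintegral_sq_chaosKernel_le (n : ℕ) {z : ℝ} (hz : 0 ≤ z) (t : ℝ) :
    ∫⁻ x, ‖chaosKernel u₀ n z t x‖ₑ ^ 2 ∂(Measure.pi fun _ => quadrant) ≤
      ‖u₀‖ₑ ^ 2 * (1 / 2) ^ n := by
  induction n generalizing z t with
  | zero =>
    calc _ ≤ ∫⁻ _ : Fin 0 → ℝ × ℝ, ‖u₀‖ₑ ^ 2 ∂(Measure.pi fun _ => quadrant) := by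
          refine lintegral_mono fun x => ?_
          gcongr
          exact enorm_detSolution_le u₀ z t
      _ ≤ _ := by simp
  | succ n ih =>
    rw [lintegral_pi_succ ((measurable_chaosKernel u₀ _ z t).enorm.pow_const 2)]
    simp_rw [chaosKernel_snoc, enorm_mul, mul_pow]
    calc ∫⁻ y, ∫⁻ x, ‖noiseKernel z t y‖ₑ ^ 2 * ‖chaosKernel u₀ n y.1 y.2 x‖ₑ ^ 2
          ∂(Measure.pi fun _ => quadrant) ∂quadrant
        ≤ ∫⁻ y, ‖noiseKernel z t y‖ₑ ^ 2 * (‖u₀‖ₑ ^ 2 * (1 / 2) ^ n) ∂quadrant := by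
          refine lintegral_mono_ae ?_
          filter_upwards [ae_quadrant_pos] with y hy
          rw [lintegral_const_mul _ ((measurable_chaosKernel u₀ n y.1 y.2).enorm.pow_const 2)]
          gcongr
          exact ih hy.1.le y.2
      _ = (∫⁻ y, ‖noiseKernel z t y‖ₑ ^ 2 ∂quadrant) * (‖u₀‖ₑ ^ 2 * (1 / 2) ^ n) :=
          lintegral_mul_const _ ((measurable_noiseKernel z t).enorm.pow_const 2)
      _ ≤ 1 / 2 * (‖u₀‖ₑ ^ 2 * (1 / 2) ^ n) := by
          gcongr
          exact lintegral_sq_noiseKernel_le hz t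
      _ = _ := by rw [pow_succ]; ring

theorem memLp_chaosKernel (n : ℕ) {z : ℝ} (hz : 0 ≤ z) (t : ℝ) :
    MemLp (chaosKernel u₀ n z t) 2 (Measure.pi fun _ : Fin n => quadrant) := by
  refine memLp_two_of_lintegral (measurable_chaosKernel u₀ n z t).aestronglyMeasurable
    (ne_top_of_le_ne_top ?_ (lintegral_sq_chaosKernel_le u₀ n hz t))
  exact ENNReal.mul_ne_top (by simp) (by simp)

theorem integral_sq_chaosKernel_le (n : ℕ) {z : ℝ} (hz : 0 ≤ z) (t : ℝ) :
    ∫ x, chaosKernel u₀ n z t x ^ 2 ∂(Measure.pi fun _ => quadrant) ≤ ‖u₀‖ ^ 2 * (1 / 2) ^ n := by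
  rw [integral_eq_lintegral_of_nonneg_ae (.of_forall fun x => sq_nonneg _)
    ((measurable_chaosKernel u₀ n z t).pow_const 2).aestronglyMeasurable]
  have h := lintegral_sq_chaosKernel_le u₀ n hz t
  have e (r : ℝ) : ENNReal.ofReal (r ^ 2) = ‖r‖ₑ ^ 2 := by
    rw [← Real.enorm_of_nonneg (sq_nonneg r), enorm_pow]
  simp_rw [e]
  refine ENNReal.toReal_le_of_le_ofReal (by positivity) (h.trans_eq ?_)
  rw [ENNReal.ofReal_mul (by positivity), ENNReal.ofReal_pow (by positivity),
    ENNReal.ofReal_pow (by positivity), ofReal_norm, ENNReal.ofReal_div_of_pos (by norm_num)]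
  simp

/-! ### Time-ordered support and pairings with tensor powers -/

/-- The set of points with increasing times. -/
def timeSimplex (n : ℕ) : Set (Fin n → ℝ × ℝ) := {x | StrictMono fun i => (x i).2}

theorem chaosKernel_ne_zero {n : ℕ} {z t : ℝ} {x : Fin n → ℝ × ℝ}
    (h : chaosKernel u₀ n z t x ≠ 0) : x ∈ timeSimplex n ∧ ∀ i, (x i).2 < t := by
  induction n generalizing z t with
  | zero => exact ⟨fun i => i.elim0, fun i => i.elim0⟩
  | succ n ih =>
    rw [chaosKernel_succ] at h
    have h1 := left_ne_zero_of_mul h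
    obtain ⟨h2, h3⟩ := ih (right_ne_zero_of_mul h)
    have h4 : (x (Fin.last n)).2 < t := by
      rw [noiseKernel_eq_ite] at h1
      by_contra h5
      exact h1 (if_neg fun h => h5 h.2)
    refine ⟨fun i j hij => ?_, fun i => ?_⟩
    · induction j using Fin.lastCases with
      | last =>
        obtain ⟨i, rfl⟩ := Fin.exists_castSucc_eq.2 hij.ne
        exact h3 i
      | cast j =>
        obtain ⟨i, rfl⟩ := Fin.exists_castSucc_eq.2 (hij.trans (Fin.castSucc_lt_last j)).ne
        exact h2 (Fin.castSucc_lt_castSucc_iff.1 hij)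
    · induction i using Fin.lastCases with
      | last => exact h4
      | cast i => exact (h3 i).trans h4

/-- The pairing `⟨fₙ(·; z, t), h ⊗ ⋯ ⊗ h⟩`. -/
def chaosPairing (n : ℕ) (z t : ℝ) (h : ℝ × ℝ → ℝ) : ℝ :=
  ∫ x, chaosKernel u₀ n z t x * tensorPow n h x ∂(Measure.pi fun _ => quadrant)

theorem chaosPairing_zero (z t : ℝ) (h : ℝ × ℝ → ℝ) :
    chaosPairing u₀ 0 z t h = detSolution u₀ z t := by
  simp [chaosPairing, tensorPow_zero, chaosKernel, integral_const, Measure.real]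

/-- This is the mild equation tested against a Wick exponential, one degree at a time. -/
theorem chaosPairing_succ (n : ℕ) {z : ℝ} (hz : 0 ≤ z) (t : ℝ) {h : ℝ × ℝ → ℝ}
    (hh : MemLp h 2 quadrant) :
    chaosPairing u₀ (n + 1) z t h =
      ∫ y, noiseKernel z t y * h y * chaosPairing u₀ n y.1 y.2 h ∂quadrant := by
  have hi : Integrable (fun x => chaosKernel u₀ (n + 1) z t x * tensorPow (n + 1) h x)
      (Measure.pi fun _ => quadrant) :=
    (memLp_chaosKernel u₀ (n + 1) hz t).integrable_mul (memLp_tensorPow (n + 1) hh)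
  rw [chaosPairing, integral_pi_succ hi]
  refine integral_congr_ae (.of_forall fun y => ?_)
  dsimp only
  simp_rw [chaosKernel_snoc, tensorPow_snoc, chaosPairing]
  rw [← integral_const_mul]
  refine integral_congr_ae (.of_forall fun x => ?_)
  dsimp only
  ring

theorem measurable_chaosPairing (n : ℕ) {h : ℝ × ℝ → ℝ} (hh : Measurable h) :
    Measurable fun y : ℝ × ℝ => chaosPairing u₀ n y.1 y.2 h := by
  have : Measurable fun p : (ℝ × ℝ) × (Fin n → ℝ × ℝ) =>
      chaosKernel u₀ n p.1.1 p.1.2 p.2 * tensorPow n h p.2 := by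
    refine (measurable_chaosKernel_prod u₀ n).mul ?_
    unfold tensorPow
    exact Finset.measurable_fun_prod _ fun i _ =>
      hh.comp ((measurable_pi_apply i).comp measurable_snd)
  exact this.stronglyMeasurable.integral_prod_right'.measurable

/-! ### Gaussian computations -/

namespace IsWhiteNoise

variable {Ω : Type*} [MeasurableSpace Ω] {P : Measure Ω} {W : NoiseSpace → Ω → ℝ}

theorem memLp (hW : IsWhiteNoise P W) (h : NoiseSpace) {p : ℝ≥0∞} (hp : p ≠ ∞) :
    MemLp (W h) p P :=
  (hW.gaussian.hasGaussianLaw_eval h).memLp hp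

theorem integral_sq (hW : IsWhiteNoise P W) (h : NoiseSpace) :
    ∫ ω, W h ω ^ 2 ∂P = ‖h‖ ^ 2 := by
  simp_rw [sq (W h _), hW.covariance, real_inner_self_eq_norm_sq]

/-- Linearity of W is not assumed: it follows from the covariance, because the defect has second
moment zero. -/
theorem map_add_smul (hW : IsWhiteNoise P W) (a b : ℝ) (g h : NoiseSpace) :
    W (a • g + b • h) =ᵐ[P] fun ω => a * W g ω + b * W h ω := by
  have i (g h : NoiseSpace) : Integrable (fun ω => W g ω * W h ω) P :=
    (hW.memLp g (p := 2) (by simp)).integrable_mul (hW.memLp h (p := 2) (by simp))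
  set k := a • g + b • h with hk
  have h0 : ∫ ω, (W k ω - (a * W g ω + b * W h ω)) ^ 2 ∂P = 0 := by
    have e : (fun ω => (W k ω - (a * W g ω + b * W h ω)) ^ 2) = fun ω =>
        W k ω * W k ω - 2 * a * (W k ω * W g ω) - 2 * b * (W k ω * W h ω) +
        a ^ 2 * (W g ω * W g ω) + 2 * a * b * (W g ω * W h ω) + b ^ 2 * (W h ω * W h ω) := by
      ext ω; ring
    rw [e, integral_add (by fun_prop) (by fun_prop), integral_add (by fun_prop) (by fun_prop),
      integral_add (by fun_prop) (by fun_prop), integral_sub (by fun_prop) (by fun_prop),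
      integral_sub (by fun_prop) (by fun_prop)]
    simp only [integral_const_mul, hW.covariance, hk, inner_add_left, inner_add_right,
      inner_smul_left, inner_smul_right, real_inner_comm g h]
    simp
    ring
  have hm : MemLp (fun ω => W k ω - (a * W g ω + b * W h ω)) 2 P :=
    (hW.memLp k (by simp)).sub (((hW.memLp g (by simp)).const_mul a).add
      ((hW.memLp h (by simp)).const_mul b))
  have := (integral_eq_zero_iff_of_nonneg (fun ω => sq_nonneg _) hm.integrable_sq).1 h0
  filter_upwards [this] with ω hω
  exact sub_eq_zero.1 (pow_eq_zero_iff (two_ne_zero)|>.1 hω)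

theorem map_smul (hW : IsWhiteNoise P W) (a : ℝ) (h : NoiseSpace) :
    W (a • h) =ᵐ[P] fun ω => a * W h ω := by
  simpa using hW.map_add_smul a 0 h 0

theorem map_add (hW : IsWhiteNoise P W) (g h : NoiseSpace) :
    W (g + h) =ᵐ[P] fun ω => W g ω + W h ω := by
  simpa using hW.map_add_smul 1 1 g h

theorem map_sum (hW : IsWhiteNoise P W) {ι : Type*} (s : Finset ι) (c : ι → ℝ)
    (h : ι → NoiseSpace) :
    W (∑ i ∈ s, c i • h i) =ᵐ[P] fun ω => ∑ i ∈ s, c i * W (h i) ω := by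
  classical
  induction s using Finset.induction_on with
  | empty => simpa using hW.map_smul 0 0
  | insert a s ha ih =>
    rw [Finset.sum_insert ha]
    filter_upwards [ih, hW.map_add (c a • h a) (∑ i ∈ s, c i • h i), hW.map_smul (c a) (h a)]
      with ω h1 h2 h3
    rw [h2, h3, h1, Finset.sum_insert ha]

theorem map_eq_gaussianReal (hW : IsWhiteNoise P W) (h : NoiseSpace) :
    P.map (W h) = gaussianReal 0 (‖h‖ ^ 2).toNNReal := by
  rw [(hW.gaussian.hasGaussianLaw_eval h).map_eq_gaussianReal, hW.centered,
    variance_of_integral_eq_zero (hW.measurable h).aemeasurable (hW.centered h)]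
  congr
  exact hW.integral_sq h

theorem integrable_exp_mul (hW : IsWhiteNoise P W) (h : NoiseSpace) (s : ℝ) :
    Integrable (fun ω => Real.exp (s * W h ω)) P := by
  have := integrable_exp_mul_gaussianReal (μ := 0) (v := (‖h‖ ^ 2).toNNReal) s
  rw [← hW.map_eq_gaussianReal] at this
  exact this.comp_measurable (hW.measurable h)

theorem integrableExpSet_eq (hW : IsWhiteNoise P W) (h : NoiseSpace) :
    integrableExpSet (W h) P = univ :=
  eq_univ_of_forall fun s => hW.integrable_exp_mul h s

theorem memLp_exp_mul (hW : IsWhiteNoise P W) (h : NoiseSpace) (s : ℝ) :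
    MemLp (fun ω => Real.exp (s * W h ω)) 2 P := by
  have hm := hW.measurable h
  rw [memLp_two_iff_integrable_sq (by fun_prop)]
  refine (hW.integrable_exp_mul h (2 * s)).congr (.of_forall fun ω => ?_)
  dsimp only
  rw [← Real.exp_nat_mul]
  push_cast
  ring_nf

theorem memLp_exp (hW : IsWhiteNoise P W) (h : NoiseSpace) :
    MemLp (fun ω => Real.exp (W h ω)) 2 P := by
  simpa using hW.memLp_exp_mul h 1

theorem memLp_cexp_mul (hW : IsWhiteNoise P W) (h : NoiseSpace) (ζ : ℂ) :
    MemLp (fun ω => Complex.exp (ζ * W h ω)) 2 P := by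
  have hm := hW.measurable h
  refine (hW.memLp_exp_mul h ζ.re).of_le (by fun_prop) (.of_forall fun ω => ?_)
  simp [Complex.norm_exp]

theorem integral_cexp_mul (hW : IsWhiteNoise P W) (h : NoiseSpace) (ζ : ℂ) :
    ∫ ω, Complex.exp (ζ * W h ω) ∂P = Complex.exp (ζ ^ 2 * ‖h‖ ^ 2 / 2) := by
  have := complexMGF_gaussianReal (hW.map_eq_gaussianReal h) ζ
  rw [complexMGF] at this
  rw [this]
  congr 1
  rw [Real.coe_toNNReal _ (by positivity)]
  push_cast
  ring

/-- Obtained by differentiating the complex moment generating function, which is entire. -/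
theorem integral_mul_cexp_mul (hW : IsWhiteNoise P W) (h : NoiseSpace) (ζ : ℂ) :
    ∫ ω, W h ω * Complex.exp (ζ * W h ω) ∂P =
      ζ * ‖h‖ ^ 2 * Complex.exp (ζ ^ 2 * ‖h‖ ^ 2 / 2) := by
  have h1 : HasDerivAt (complexMGF (W h) P) (∫ ω, W h ω * Complex.exp (ζ * W h ω) ∂P) ζ :=
    hasDerivAt_complexMGF (by rw [hW.integrableExpSet_eq]; simp)
  have h2 : complexMGF (W h) P = fun ζ => Complex.exp (ζ ^ 2 * ‖h‖ ^ 2 / 2) :=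
    funext fun ζ => hW.integral_cexp_mul h ζ
  rw [h2] at h1
  have h3 : HasDerivAt (fun ζ : ℂ => Complex.exp (ζ ^ 2 * ‖h‖ ^ 2 / 2))
      (Complex.exp (ζ ^ 2 * ‖h‖ ^ 2 / 2) * (2 * ζ * ‖h‖ ^ 2 / 2)) ζ := by
    have := (((hasDerivAt_id ζ).pow 2).mul_const ((‖h‖ : ℂ) ^ 2)).div_const 2
    simpa using this.cexp
  rw [h1.unique h3]
  ring

theorem integral_exp (hW : IsWhiteNoise P W) (h : NoiseSpace) :
    ∫ ω, Real.exp (W h ω) ∂P = Real.exp (‖h‖ ^ 2 / 2) := by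
  have := hW.integral_cexp_mul h 1
  simp only [one_mul, one_pow] at this
  apply Complex.ofReal_injective
  rw [← integral_complex_ofReal]
  push_cast
  exact this

/-- Uncorrelated members of a jointly Gaussian family are independent. -/
theorem indepFun (hW : IsWhiteNoise P W) {ι : Type*} (g : NoiseSpace) (k : ι → NoiseSpace)
    (hgk : ∀ i, inner ℝ g (k i) = 0) : IndepFun (W g) (fun ω i => W (k i) ω) P := by
  have hP := hW.gaussian.isProbabilityMeasure
  have h1 : IsGaussianProcess
      (Sum.elim (fun _ : Unit => W g) (fun i => W (k i))) P := by
    have e : Sum.elim (fun _ : Unit => W g) (fun i => W (k i)) =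
        W ∘ Sum.elim (fun _ : Unit => g) k := by
      funext x
      cases x <;> rfl
    rw [e]
    exact hW.gaussian.comp_right _
  have h2 := h1.indepFun_of_covariance_eq_zero (fun _ => (hW.measurable g).aemeasurable)
    (fun i => (hW.measurable (k i)).aemeasurable) fun _ i => by
      rw [covariance_eq_sub (hW.memLp g (by simp)) (hW.memLp (k i) (by simp))]
      simp only [Pi.mul_apply, hW.covariance, hgk, hW.centered]
      simp
  exact h2.comp (φ := fun x : Unit → ℝ => x ()) (measurable_pi_apply _) measurable_id

/-- The exponential transform of a product `W(g₁) ⋯ W(gₙ)` with orthogonal `gᵢ`. -/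
theorem integral_prod_mul_cexp (hW : IsWhiteNoise P W) {n : ℕ} (g : Fin n → NoiseSpace)
    (hg : Pairwise fun i j => inner ℝ (g i) (g j) = 0) (h : NoiseSpace) (ζ : ℂ) :
    ∫ ω, ((∏ i, W (g i) ω : ℝ) : ℂ) * Complex.exp (ζ * W h ω) ∂P =
      Complex.exp (ζ ^ 2 * ‖h‖ ^ 2 / 2) * (ζ ^ n * ((∏ i, inner ℝ (g i) h : ℝ) : ℂ)) := by
  induction n generalizing h with
  | zero => simpa using hW.integral_cexp_mul h ζ
  | succ n ih =>
    set e := g (Fin.last n) with he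
    -- Splitting h along the last factor e gives h = a e + h' with h' ⊥ e, so W(e) is independent of
    -- W(h') and of the other factors. If e = 0, division by zero makes a = 0, which is still
    -- correct.
    set a : ℝ := inner ℝ e h / ‖e‖ ^ 2 with ha
    set h' := h - a • e with hh'
    have hae : a * ‖e‖ ^ 2 = inner ℝ e h := by
      rcases eq_or_ne e 0 with h0 | h0
      · simp [h0]
      · have : ‖e‖ ≠ 0 := norm_ne_zero_iff.2 h0
        rw [ha]; field_simp
    have heh' : inner ℝ e h' = 0 := by
      rw [hh', inner_sub_right, inner_smul_right, real_inner_self_eq_norm_sq, hae, sub_self]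
    have hge (i : Fin n) : inner ℝ (g i.castSucc) e = 0 := hg (Fin.castSucc_lt_last i).ne
    have hgh' (i : Fin n) : inner ℝ (g i.castSucc) h' = inner ℝ (g i.castSucc) h := by
      rw [hh', inner_sub_right, inner_smul_right, hge, mul_zero, sub_zero]
    have hnorm : ‖h‖ ^ 2 = a ^ 2 * ‖e‖ ^ 2 + ‖h'‖ ^ 2 := by
      have : h = a • e + h' := by rw [hh']; abel
      nth_rewrite 1 [this]
      rw [norm_add_sq_real, inner_smul_left, heh', norm_smul, mul_pow]
      simp
    have hlin : W h =ᵐ[P] fun ω => a * W e ω + W h' ω := by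
      have := hW.map_add_smul a 1 e h'
      rwa [one_smul, show a • e + h' = h by rw [hh']; abel, show
        (fun ω => a * W e ω + 1 * W h' ω) = fun ω => a * W e ω + W h' ω by simp] at this
    -- The index `none` carries h', and `some i` carries the remaining factors.
    have hind := hW.indepFun e (fun o : Option (Fin n) => o.elim h' fun i => g i.castSucc) (by
      rintro (_ | i)
      · exact heh'
      · rw [real_inner_comm]; exact hge i)
    have hind' := hind.integral_fun_comp_mul_comp (hW.measurable e).aemeasurable
      (measurable_pi_lambda _ fun o => hW.measurable _).aemeasurable
      (f := fun x : ℝ => (x : ℂ) * Complex.exp (ζ * a * x))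
      (g := fun y : Option (Fin n) → ℝ => ((∏ i : Fin n, y (some i) : ℝ) : ℂ) *
        Complex.exp (ζ * y none))
      (Measurable.aestronglyMeasurable (by fun_prop))
      (Measurable.aestronglyMeasurable (by fun_prop))
    have hL : ∫ ω, ((∏ i, W (g i) ω : ℝ) : ℂ) * Complex.exp (ζ * W h ω) ∂P =
        ∫ ω, (W e ω : ℂ) * Complex.exp (ζ * a * W e ω) *
          (((∏ i : Fin n, W (g i.castSucc) ω : ℝ) : ℂ) * Complex.exp (ζ * W h' ω)) ∂P := by
      refine integral_congr_ae ?_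
      filter_upwards [hlin] with ω hω
      rw [hω, Fin.prod_univ_castSucc]
      push_cast
      rw [mul_add, Complex.exp_add, ← mul_assoc ζ]
      ring
    have h1 : ∫ ω, (W e ω : ℂ) * Complex.exp (ζ * a * W e ω) ∂P =
        ζ * inner ℝ e h * Complex.exp ((ζ * a) ^ 2 * ‖e‖ ^ 2 / 2) := by
      rw [hW.integral_mul_cexp_mul e (ζ * a), ← hae]
      push_cast
      ring
    have h2 := ih (fun i => g i.castSucc)
      (fun i j hij => hg ((Fin.castSucc_injective n).ne hij)) h'
    simp only [Option.elim] at hind'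
    rw [hL, hind', h1, h2, Fin.prod_univ_castSucc]
    simp_rw [hgh']
    have h3 : (‖h‖ : ℂ) ^ 2 = a ^ 2 * ‖e‖ ^ 2 + ‖h'‖ ^ 2 := by exact_mod_cast hnorm
    rw [h3, mul_add, add_div, Complex.exp_add, show (ζ * a) ^ 2 * ‖e‖ ^ 2 = ζ ^ 2 * (a ^ 2 * ‖e‖ ^ 2)
      by ring]
    push_cast
    ring

/-! ### Exponentials are total -/

/-- The exponential `exp(W(h) - ‖h‖² / 2)`. -/
def wickExp (hW : IsWhiteNoise P W) (h : NoiseSpace) : Lp ℝ 2 P :=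
  Real.exp (-(‖h‖ ^ 2 / 2)) • (hW.memLp_exp h).toLp

theorem coeFn_wickExp (hW : IsWhiteNoise P W) (h : NoiseSpace) :
    hW.wickExp h =ᵐ[P] fun ω => Real.exp (-(‖h‖ ^ 2 / 2)) * Real.exp (W h ω) := by
  filter_upwards [Lp.coeFn_smul (Real.exp (-(‖h‖ ^ 2 / 2))) (hW.memLp_exp h).toLp,
    (hW.memLp_exp h).coeFn_toLp] with ω h1 h2
  rw [wickExp, h1, Pi.smul_apply, h2, smul_eq_mul]

theorem inner_wickExp_right (hW : IsWhiteNoise P W) (X : Lp ℝ 2 P) (h : NoiseSpace) :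
    inner ℝ X (hW.wickExp h) =
      Real.exp (-(‖h‖ ^ 2 / 2)) * ∫ ω, X ω * Real.exp (W h ω) ∂P := by
  rw [L2.inner_def, ← integral_const_mul]
  refine integral_congr_ae ?_
  filter_upwards [hW.coeFn_wickExp h] with ω hω
  rw [hω]
  simp
  ring

theorem inner_wickExp_wickExp (hW : IsWhiteNoise P W) (g h : NoiseSpace) :
    inner ℝ (hW.wickExp g) (hW.wickExp h) = Real.exp (inner ℝ g h) := by
  rw [inner_wickExp_right]
  have : ∫ ω, hW.wickExp g ω * Real.exp (W h ω) ∂P =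
      ∫ ω, Real.exp (-(‖g‖ ^ 2 / 2)) * Real.exp (W (g + h) ω) ∂P := by
    refine integral_congr_ae ?_
    filter_upwards [hW.coeFn_wickExp g, hW.map_add g h] with ω h1 h2
    rw [h1, h2, Real.exp_add]
    ring
  rw [this, integral_const_mul, hW.integral_exp, ← Real.exp_add, ← Real.exp_add,
    norm_add_sq_real]
  congr 1
  ring

end IsWhiteNoise

namespace IsWhiteNoise

variable {Ω : Type*} [MeasurableSpace Ω] {P : Measure Ω} {W : NoiseSpace → Ω → ℝ}

/-- Two finite measures with the same exponential moments of the white noise agree. -/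
theorem measure_ext_of_integral_exp (hW : IsWhiteNoise P W) (hgen : IsGeneratedBy P W)
    {μ ν : Measure Ω} [IsFiniteMeasure μ] [IsFiniteMeasure ν] (hμ : μ ≪ P) (hν : ν ≪ P)
    (iμ : ∀ h s, Integrable (fun ω => Real.exp (s * W h ω)) μ)
    (h : ∀ h, ∫ ω, Real.exp (W h ω) ∂μ = ∫ ω, Real.exp (W h ω) ∂ν) : μ = ν := by
  have h1 (k : NoiseSpace) : mgf (W k) μ = mgf (W k) ν := by
    ext s
    have e := hW.map_smul s k
    calc ∫ ω, Real.exp (s * W k ω) ∂μ = ∫ ω, Real.exp (W (s • k) ω) ∂μ :=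
          integral_congr_ae ((e.filter_mono hμ.ae_le).mono fun ω hω => by dsimp only; rw [hω])
      _ = ∫ ω, Real.exp (W (s • k) ω) ∂ν := h _
      _ = ∫ ω, Real.exp (s * W k ω) ∂ν :=
          integral_congr_ae ((e.filter_mono hν.ae_le).mono fun ω hω => by dsimp only; rw [hω])
  -- A side condition of the analytic continuation below; the total masses are the moment generating
  -- functions at 0.
  have h0 : μ = 0 ↔ ν = 0 := by
    have := congr_fun (h1 0) 0
    rw [mgf_zero', mgf_zero'] at this
    rw [← Measure.measure_univ_eq_zero, ← Measure.measure_univ_eq_zero,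
      ← measureReal_eq_zero_iff, ← measureReal_eq_zero_iff, this]
  -- Equality of moment generating functions on the real line continues analytically to the point i.
  have h2 (k : NoiseSpace) : ∫ ω, Complex.exp (W k ω * Complex.I) ∂μ =
      ∫ ω, Complex.exp (W k ω * Complex.I) ∂ν := by
    have hu : integrableExpSet (W k) μ = univ := eq_univ_of_forall fun s => iμ k s
    have := eqOn_complexMGF_of_mgf' (h1 k) h0 (x := Complex.I) (by simp [hu])
    simpa only [complexMGF, mul_comm] using this
  have hWm : Measurable fun ω (k : NoiseSpace) => W k ω :=
    measurable_pi_lambda _ fun k => hW.measurable k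
  have h3 (I : Finset NoiseSpace) : (μ.map fun ω (k : NoiseSpace) => W k ω).map I.restrict =
      (ν.map fun ω (k : NoiseSpace) => W k ω).map I.restrict := by
    have hr : Measurable (I.restrict : (NoiseSpace → ℝ) → I → ℝ) :=
      measurable_pi_lambda _ fun k => measurable_pi_apply _
    rw [Measure.map_map hr hWm, Measure.map_map hr hWm]
    have hm := hr.comp hWm
    refine Measure.ext_of_charFunDual (funext fun L => ?_)
    classical
    set k : NoiseSpace := ∑ i : I, L (Pi.single i 1) • (i : NoiseSpace)
    -- A linear functional of finitely many noise values is a single noise value, so one-dimensional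
    -- transforms determine the finite-dimensional laws.
    have e : (fun ω => L (I.restrict fun k => W k ω)) =ᵐ[P] W k := by
      filter_upwards [hW.map_sum Finset.univ (fun i : I => L (Pi.single i 1)) (fun i => i)]
        with ω hω
      rw [hω]
      conv_lhs => rw [show I.restrict (fun k => W k ω) =
        ∑ i : I, W i ω • (Pi.single i (1 : ℝ) : I → ℝ) by
          rw [← Finset.univ_sum_single (I.restrict fun k => W k ω)]
          refine Finset.sum_congr rfl fun i _ => ?_
          rw [← Pi.single_smul]; simp, _root_.map_sum]
      refine Finset.sum_congr rfl fun i _ => ?_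
      rw [_root_.map_smul, smul_eq_mul, mul_comm]
    rw [charFunDual_apply, charFunDual_apply,
      integral_map hm.aemeasurable (Measurable.aestronglyMeasurable (by fun_prop)),
      integral_map hm.aemeasurable (Measurable.aestronglyMeasurable (by fun_prop))]
    calc ∫ ω, Complex.exp (L (I.restrict fun k => W k ω) * Complex.I) ∂μ
        = ∫ ω, Complex.exp (W k ω * Complex.I) ∂μ :=
          integral_congr_ae ((e.filter_mono hμ.ae_le).mono fun ω hω => by dsimp only at hω ⊢; rw [hω])
      _ = ∫ ω, Complex.exp (W k ω * Complex.I) ∂ν := h2 k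
      _ = ∫ ω, Complex.exp (L (I.restrict fun k => W k ω) * Complex.I) ∂ν :=
          integral_congr_ae ((e.filter_mono hν.ae_le).mono fun ω hω => by dsimp only at hω ⊢; rw [hω])
  have h4 : (μ.map fun ω (k : NoiseSpace) => W k ω) = ν.map fun ω (k : NoiseSpace) => W k ω :=
    IsProjectiveLimit.unique
      (P := fun I => (ν.map fun ω (k : NoiseSpace) => W k ω).map I.restrict) h3 fun _ => rfl
  ext A hA
  obtain ⟨B, hB, hAB⟩ := hgen A hA
  have hB' : ∃ C : Set (NoiseSpace → ℝ), MeasurableSet C ∧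
      (fun ω (k : NoiseSpace) => W k ω) ⁻¹' C = B := by
    have e : (⨆ h : NoiseSpace, MeasurableSpace.comap (W h) inferInstance) =
        MeasurableSpace.comap (fun ω (k : NoiseSpace) => W k ω) MeasurableSpace.pi := by
      simp only [MeasurableSpace.pi, MeasurableSpace.comap_iSup, MeasurableSpace.comap_comp]
      rfl
    rw [e] at hB
    exact hB
  obtain ⟨C, hC, rfl⟩ := hB'
  rw [measure_congr (hμ.ae_le hAB), measure_congr (hν.ae_le hAB), ← Measure.map_apply hWm hC, h4,
    Measure.map_apply hWm hC]

/-- Exponentials of the white noise are total in `L²(Ω)`. -/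
theorem eq_zero_of_integral_mul_exp (hW : IsWhiteNoise P W) (hgen : IsGeneratedBy P W)
    (X : Lp ℝ 2 P) (hX : ∀ h, ∫ ω, X ω * Real.exp (W h ω) ∂P = 0) : X = 0 := by
  have hP := hW.gaussian.isProbabilityMeasure
  have hXm : Measurable X := (Lp.stronglyMeasurable X).measurable
  have hXi : Integrable X P := (Lp.memLp X).integrable (by norm_num)
  have iX (h : NoiseSpace) (s : ℝ) : Integrable (fun ω => X ω * Real.exp (s * W h ω)) P :=
    (Lp.memLp X).integrable_mul (hW.memLp_exp_mul h s)
  have key (Y : Ω → ℝ) (hY : Measurable Y) (h : NoiseSpace) (s : ℝ)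
      (iY : Integrable (fun ω => Y ω * Real.exp (s * W h ω)) P) :
      Integrable (fun ω => max (Y ω) 0 * Real.exp (s * W h ω)) P := by
    have hm := hW.measurable h
    refine iY.mono (by fun_prop) (.of_forall fun ω => ?_)
    rw [norm_mul, norm_mul]
    gcongr
    rw [Real.norm_eq_abs, Real.norm_eq_abs, abs_of_nonneg (le_max_right _ _)]
    exact max_le (le_abs_self _) (abs_nonneg _)
  have iXneg (h : NoiseSpace) (s : ℝ) :
      Integrable (fun ω => -X ω * Real.exp (s * W h ω)) P := by
    simpa only [neg_mul] using! (iX h s).neg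
  have := isFiniteMeasure_withDensity_ofReal (μ := P) (f := X) hXi.2
  have := isFiniteMeasure_withDensity_ofReal (μ := P) (f := fun ω => -X ω) hXi.neg.2
  -- The positive and negative parts of X, taken as densities, define two finite measures with the
  -- same exponential moments.
  have e : P.withDensity (fun ω => ENNReal.ofReal (X ω)) =
      P.withDensity (fun ω => ENNReal.ofReal (-X ω)) := by
    refine hW.measure_ext_of_integral_exp hgen (withDensity_absolutelyContinuous _ _)
      (withDensity_absolutelyContinuous _ _) (fun h s => ?_) fun h => ?_
    · rw [integrable_withDensity_iff_integrable_smul' (by fun_prop) (by simp)]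
      simp only [ENNReal.toReal_ofReal', smul_eq_mul]
      exact key X hXm h s (iX h s)
    · rw [integral_withDensity_eq_integral_toReal_smul (by fun_prop) (by simp),
        integral_withDensity_eq_integral_toReal_smul (by fun_prop) (by simp), ← sub_eq_zero]
      simp only [ENNReal.toReal_ofReal', smul_eq_mul]
      have i1 := key X hXm h 1 (iX h 1)
      have i2 := key (fun ω => -X ω) hXm.neg h 1 (iXneg h 1)
      simp only [one_mul] at i1 i2
      rw [← integral_sub i1 i2]
      refine Eq.trans ?_ (hX h)
      refine integral_congr_ae (.of_forall fun ω => ?_)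
      dsimp only
      rw [← sub_mul]
      congr 1
      rcases le_total (X ω) 0 with h | h
      · rw [max_eq_right h, max_eq_left (by linarith)]; ring
      · rw [max_eq_left h, max_eq_right (by linarith)]; ring
  have h2 := (withDensity_eq_iff (by fun_prop) (by fun_prop)
    hXi.lintegral_lt_top.ne).1 e
  rw [Lp.eq_zero_iff_ae_eq_zero]
  filter_upwards [h2] with ω hω
  change X ω = 0
  rcases le_total (X ω) 0 with h | h
  · rw [ENNReal.ofReal_of_nonpos h, eq_comm, ENNReal.ofReal_eq_zero] at hω
    exact le_antisymm h (by linarith)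
  · rw [ENNReal.ofReal_of_nonpos (show -X ω ≤ 0 by linarith), ENNReal.ofReal_eq_zero] at hω
    exact le_antisymm hω h

theorem ext_of_integral_mul_exp (hW : IsWhiteNoise P W) (hgen : IsGeneratedBy P W)
    {X Y : Lp ℝ 2 P}
    (h : ∀ h, ∫ ω, X ω * Real.exp (W h ω) ∂P = ∫ ω, Y ω * Real.exp (W h ω) ∂P) : X = Y := by
  rw [← sub_eq_zero]
  refine hW.eq_zero_of_integral_mul_exp hgen _ fun k => ?_
  have i (X : Lp ℝ 2 P) : Integrable (fun ω => X ω * Real.exp (W k ω)) P :=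
    (Lp.memLp X).integrable_mul (hW.memLp_exp k)
  rw [← sub_eq_zero.2 (h k), ← integral_sub (i X) (i Y)]
  refine integral_congr_ae ?_
  filter_upwards [Lp.coeFn_sub X Y] with ω hω
  rw [hω, Pi.sub_apply, sub_mul]

theorem topologicalClosure_span_wickExp (hW : IsWhiteNoise P W) (hgen : IsGeneratedBy P W) :
    (Submodule.span ℝ (range hW.wickExp)).topologicalClosure = ⊤ := by
  rw [Submodule.topologicalClosure_eq_top_iff, Submodule.eq_bot_iff]
  intro X hX
  refine hW.eq_zero_of_integral_mul_exp hgen X fun h => ?_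
  have := (Submodule.mem_orthogonal' _ X).1 hX _ (Submodule.subset_span (mem_range_self h))
  rw [inner_wickExp_right] at this
  exact (mul_eq_zero.1 this).resolve_left (Real.exp_pos _).ne'

end IsWhiteNoise

/-! ### The norm of a random variable in terms of its kernels -/

theorem measurableSet_timeSimplex (n : ℕ) : MeasurableSet (timeSimplex n) := by
  have : timeSimplex n = ⋂ (i : Fin n) (j : Fin n) (_ : i < j), {x | (x i).2 < (x j).2} := by
    ext x
    simp [timeSimplex, StrictMono]
  rw [this]
  refine MeasurableSet.iInter fun i => MeasurableSet.iInter fun j => MeasurableSet.iInter fun _ => ?_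
  exact measurableSet_lt (by fun_prop) (by fun_prop)

theorem measurePreserving_comp_perm {α : Type*} [MeasurableSpace α] (μ : Measure α) [SigmaFinite μ]
    {n : ℕ} (σ : Equiv.Perm (Fin n)) :
    MeasurePreserving (fun x : Fin n → α => x ∘ σ) (Measure.pi fun _ => μ)
      (Measure.pi fun _ => μ) := by
  have h := measurePreserving_piCongrLeft (fun _ : Fin n => μ) σ.symm
  convert h using 1
  ext x i
  obtain ⟨j, rfl⟩ := σ.symm.surjective i
  simp [MeasurableEquiv.coe_piCongrLeft, Equiv.piCongrLeft_apply_apply]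

/-- Two sortings differ by an order automorphism of `Fin n`, which must be the identity. -/
theorem eq_of_comp_perm_mem_timeSimplex {n : ℕ} {x : Fin n → ℝ × ℝ} {σ τ : Equiv.Perm (Fin n)}
    (hσ : x ∘ σ ∈ timeSimplex n) (hτ : x ∘ τ ∈ timeSimplex n) : σ = τ := by
  have hσ' : StrictMono fun i => (x (σ i)).2 := hσ
  have hτ' : StrictMono fun i => (x (τ i)).2 := hτ
  have h : StrictMono (σ.trans τ.symm) := by
    intro i j hij
    refine hτ'.lt_iff_lt.1 ?_
    simpa using hσ' hij
  let e : Fin n ≃o Fin n := StrictMono.orderIsoOfSurjective _ h (Equiv.surjective _)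
  have he : e = OrderIso.refl _ := Subsingleton.elim _ _
  ext i
  have h2 : e i = i := by rw [he]; rfl
  have h3 : τ.symm (σ i) = i := h2
  rw [Equiv.symm_apply_eq] at h3
  rw [h3]

/-- The n! permuted copies of the simplex are disjoint and contribute equally. An inequality
suffices, so coinciding times need not be shown negligible. -/
theorem factorial_mul_setLIntegral_timeSimplex_le {n : ℕ} {F : (Fin n → ℝ × ℝ) → ℝ≥0∞}
    (hF : Measurable F) (hsymm : ∀ (σ : Equiv.Perm (Fin n)) x, F (x ∘ σ) = F x) :
    n.factorial * ∫⁻ x in timeSimplex n, F x ∂(Measure.pi fun _ => quadrant) ≤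
      ∫⁻ x, F x ∂(Measure.pi fun _ => quadrant) := by
  have hm (σ : Equiv.Perm (Fin n)) : MeasurableSet
      ((fun x : Fin n → ℝ × ℝ => x ∘ σ) ⁻¹' timeSimplex n) :=
    (measurePreserving_comp_perm quadrant σ).measurable (measurableSet_timeSimplex n)
  have h1 (σ : Equiv.Perm (Fin n)) :
      ∫⁻ x in (fun x : Fin n → ℝ × ℝ => x ∘ σ) ⁻¹' timeSimplex n, F x
        ∂(Measure.pi fun _ => quadrant) =
      ∫⁻ x in timeSimplex n, F x ∂(Measure.pi fun _ => quadrant) := by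
    rw [← (measurePreserving_comp_perm quadrant σ).setLIntegral_comp_preimage
      (measurableSet_timeSimplex n) hF]
    simp_rw [hsymm σ]
  calc _ = ∑ σ : Equiv.Perm (Fin n),
        ∫⁻ x in (fun x : Fin n → ℝ × ℝ => x ∘ σ) ⁻¹' timeSimplex n, F x
          ∂(Measure.pi fun _ => quadrant) := by
        simp_rw [h1]
        simp [Fintype.card_perm]
    _ = ∫⁻ x in ⋃ σ : Equiv.Perm (Fin n), (fun x : Fin n → ℝ × ℝ => x ∘ σ) ⁻¹' timeSimplex n, F x
          ∂(Measure.pi fun _ => quadrant) := by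
        rw [lintegral_iUnion hm, tsum_fintype]
        intro σ τ hστ
        refine Set.disjoint_left.2 fun x hx hx' => hστ (eq_of_comp_perm_mem_timeSimplex hx hx')
    _ ≤ _ := setLIntegral_le_lintegral _ _

theorem tensorPow_comp_perm {α : Type*} {n : ℕ} (h : α → ℝ) (σ : Equiv.Perm (Fin n))
    (x : Fin n → α) : tensorPow n h (x ∘ σ) = tensorPow n h x :=
  Equiv.prod_comp σ fun i => h (x i)

theorem measurable_tensorPow {α : Type*} [MeasurableSpace α] (n : ℕ) {h : α → ℝ}
    (hh : Measurable h) : Measurable (tensorPow n h) := by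
  unfold tensorPow
  fun_prop

theorem setIntegral_timeSimplex_sq_le {n : ℕ} {G : (Fin n → ℝ × ℝ) → ℝ} (hG : Measurable G)
    (hG2 : MemLp G 2 (Measure.pi fun _ => quadrant))
    (hsymm : ∀ (σ : Equiv.Perm (Fin n)) x, G (x ∘ σ) = G x) :
    ∫ x in timeSimplex n, G x ^ 2 ∂(Measure.pi fun _ => quadrant) ≤
      (∫ x, G x ^ 2 ∂(Measure.pi fun _ => quadrant)) / n.factorial := by
  rw [le_div_iff₀ (by positivity), integral_eq_lintegral_of_nonneg_ae (.of_forall fun _ => sq_nonneg _)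
    (by fun_prop), integral_eq_lintegral_of_nonneg_ae (.of_forall fun _ => sq_nonneg _) (by fun_prop),
    mul_comm, ← ENNReal.toReal_natCast, ← ENNReal.toReal_mul]
  refine ENNReal.toReal_mono ?_ (factorial_mul_setLIntegral_timeSimplex_le (by fun_prop) ?_)
  · have := hG2.integrable_sq.lintegral_lt_top
    exact this.ne
  · intro σ x
    rw [hsymm]

theorem memLp_coeFn_tensorPow (n : ℕ) (h : NoiseSpace) :
    MemLp (tensorPow n h) 2 (Measure.pi fun _ => quadrant) :=
  memLp_tensorPow n (Lp.memLp h)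

theorem integral_coeFn_mul (g h : NoiseSpace) : ∫ y, g y * h y ∂quadrant = inner ℝ g h := by
  rw [L2.inner_def]
  refine integral_congr_ae (.of_forall fun y => ?_)
  simp [mul_comm]

/-- The `n`-th kernel of `∑ h, c h • wickExp h`, up to the factor `1 / n!`. -/
def expKernel (c : NoiseSpace →₀ ℝ) (n : ℕ) (x : Fin n → ℝ × ℝ) : ℝ :=
  ∑ h ∈ c.support, c h * tensorPow n h x

theorem measurable_expKernel (c : NoiseSpace →₀ ℝ) (n : ℕ) : Measurable (expKernel c n) :=
  Finset.measurable_fun_sum _ fun h _ => (measurable_tensorPow n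
    (Lp.stronglyMeasurable h).measurable).const_mul _

theorem memLp_expKernel (c : NoiseSpace →₀ ℝ) (n : ℕ) :
    MemLp (expKernel c n) 2 (Measure.pi fun _ => quadrant) :=
  memLp_finsetSum _ fun h _ => (memLp_coeFn_tensorPow n h).const_mul _

theorem expKernel_comp_perm (c : NoiseSpace →₀ ℝ) {n : ℕ} (σ : Equiv.Perm (Fin n))
    (x : Fin n → ℝ × ℝ) : expKernel c n (x ∘ σ) = expKernel c n x := by
  simp only [expKernel, tensorPow_comp_perm]

theorem integral_mul_expKernel (c : NoiseSpace →₀ ℝ) {n : ℕ} {f : (Fin n → ℝ × ℝ) → ℝ}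
    (hf : MemLp f 2 (Measure.pi fun _ => quadrant)) :
    ∫ x, f x * expKernel c n x ∂(Measure.pi fun _ => quadrant) =
      ∑ h ∈ c.support, c h * ∫ x, f x * tensorPow n h x ∂(Measure.pi fun _ => quadrant) := by
  have iff (h : NoiseSpace) : Integrable (fun x => f x * tensorPow n h x)
      (Measure.pi fun _ => quadrant) := hf.integrable_mul (memLp_coeFn_tensorPow n h)
  simp only [expKernel, Finset.mul_sum]
  rw [integral_finsetSum]
  · refine Finset.sum_congr rfl fun h _ => ?_
    rw [← integral_const_mul]
    refine integral_congr_ae (.of_forall fun x => ?_)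
    dsimp only
    ring
  · intro h _
    refine ((iff h).const_mul (c h)).congr (.of_forall fun x => ?_)
    dsimp only
    ring

theorem integral_sq_expKernel (c : NoiseSpace →₀ ℝ) (n : ℕ) :
    ∫ x, expKernel c n x ^ 2 ∂(Measure.pi fun _ => quadrant) =
      ∑ h ∈ c.support, ∑ k ∈ c.support, c h * (c k * (inner ℝ h k) ^ n) := by
  have igg (h k : NoiseSpace) : Integrable (fun x => tensorPow n h x * tensorPow n k x)
      (Measure.pi fun _ => quadrant) :=
    (memLp_coeFn_tensorPow n h).integrable_mul (memLp_coeFn_tensorPow n k)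
  simp_rw [sq]
  rw [integral_mul_expKernel c (memLp_expKernel c n)]
  refine Finset.sum_congr rfl fun h _ => ?_
  rw [← Finset.mul_sum]
  congr 1
  simp_rw [mul_comm (expKernel c n _)]
  rw [integral_mul_expKernel c (memLp_coeFn_tensorPow n h)]
  refine Finset.sum_congr rfl fun k _ => ?_
  rw [integral_tensorPow_mul, integral_coeFn_mul]

theorem norm_sq_sum_smul {E ι : Type*} [NormedAddCommGroup E] [InnerProductSpace ℝ E]
    (s : Finset ι) (c : ι → ℝ) (v : ι → E) :
    ‖∑ i ∈ s, c i • v i‖ ^ 2 = ∑ i ∈ s, ∑ j ∈ s, c i * (c j * inner ℝ (v i) (v j)) := by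
  rw [← real_inner_self_eq_norm_sq, sum_inner]
  simp_rw [inner_sum, real_inner_smul_left, real_inner_smul_right]

theorem hasSum_pow_div_factorial (x : ℝ) :
    HasSum (fun n : ℕ => x ^ n / (n.factorial : ℝ)) (Real.exp x) := by
  rw [Real.exp_eq_exp_ℝ]
  exact NormedSpace.expSeries_div_hasSum_exp x

namespace IsWhiteNoise

variable {Ω : Type*} [MeasurableSpace Ω] {P : Measure Ω} {W : NoiseSpace → Ω → ℝ}

/-- Wick exponentials have Gram matrix exp⟨h, k⟩, and the n-th term of the exponential series is ⟨h,
k⟩ⁿ/n!, the pairing of tensor powers divided by n!. -/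
theorem hasSum_integral_sq_expKernel (hW : IsWhiteNoise P W) (c : NoiseSpace →₀ ℝ) :
    HasSum (fun n => (∫ x, expKernel c n x ^ 2 ∂(Measure.pi fun _ => quadrant)) / n.factorial)
      (‖c.sum fun h a => a • hW.wickExp h‖ ^ 2) := by
  have e : ‖c.sum fun h a => a • hW.wickExp h‖ ^ 2 =
      ∑ h ∈ c.support, ∑ k ∈ c.support, c h * (c k * Real.exp (inner ℝ h k)) := by
    rw [Finsupp.sum, norm_sq_sum_smul]
    simp_rw [inner_wickExp_wickExp]
  rw [e]
  simp_rw [integral_sq_expKernel, Finset.sum_div, mul_div_assoc]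
  exact hasSum_sum fun h _ => hasSum_sum fun k _ =>
    ((hasSum_pow_div_factorial _).mul_left _).mul_left _

theorem hasSum_integral_mul_expKernel (hW : IsWhiteNoise P W) (c : NoiseSpace →₀ ℝ)
    {Y : Lp ℝ 2 P} {f : (n : ℕ) → (Fin n → ℝ × ℝ) → ℝ}
    (hf : ∀ n, MemLp (f n) 2 (Measure.pi fun _ => quadrant))
    (hY : ∀ h : NoiseSpace, HasSum
      (fun n => ∫ x, f n x * tensorPow n h x ∂(Measure.pi fun _ => quadrant))
      (inner ℝ Y (hW.wickExp h))) :
    HasSum (fun n => ∫ x, f n x * expKernel c n x ∂(Measure.pi fun _ => quadrant))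
      (inner ℝ Y (c.sum fun h a => a • hW.wickExp h)) := by
  simp_rw [fun n => integral_mul_expKernel c (hf n)]
  rw [Finsupp.sum, inner_sum]
  refine hasSum_sum fun h _ => ?_
  rw [real_inner_smul_right]
  exact (hY h).mul_left (c h)

/-- Since f vanishes off the simplex, 2fg ≤ f² + g² is only needed there, and the symmetric g² has
at most the fraction 1/n! of its mass on the simplex. -/
theorem two_mul_integral_mul_expKernel_le (c : NoiseSpace →₀ ℝ) {n : ℕ}
    {f : (Fin n → ℝ × ℝ) → ℝ} (hf : MemLp f 2 (Measure.pi fun _ => quadrant))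
    (hsupp : ∀ x, f x ≠ 0 → x ∈ timeSimplex n) :
    2 * ∫ x, f x * expKernel c n x ∂(Measure.pi fun _ => quadrant) ≤
      (∫ x, f x ^ 2 ∂(Measure.pi fun _ => quadrant)) +
        (∫ x, expKernel c n x ^ 2 ∂(Measure.pi fun _ => quadrant)) / n.factorial := by
  have i1 : Integrable (fun x => f x * expKernel c n x) (Measure.pi fun _ => quadrant) :=
    (hf).integrable_mul (memLp_expKernel c n)
  have i2 := (hf).integrable_sq
  have i3 := (memLp_expKernel c n).integrable_sq
  have i4 := i3.indicator (measurableSet_timeSimplex n)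
  calc 2 * ∫ x, f x * expKernel c n x ∂(Measure.pi fun _ => quadrant)
      = ∫ x, 2 * (f x * expKernel c n x) ∂(Measure.pi fun _ => quadrant) := (integral_const_mul _ _).symm
    _ ≤ ∫ x, f x ^ 2 + (timeSimplex n).indicator (fun x => expKernel c n x ^ 2) x
          ∂(Measure.pi fun _ => quadrant) := by
        refine integral_mono (i1.const_mul 2) (i2.add i4) fun x => ?_
        dsimp only
        by_cases hx : x ∈ timeSimplex n
        · rw [indicator_of_mem hx]
          nlinarith [sq_nonneg (f x - expKernel c n x)]
        · rw [indicator_of_notMem hx, show f x = 0 by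
            by_contra h0; exact hx (hsupp x h0)]
          simp
    _ = (∫ x, f x ^ 2 ∂(Measure.pi fun _ => quadrant)) +
          ∫ x in timeSimplex n, expKernel c n x ^ 2 ∂(Measure.pi fun _ => quadrant) := by
        rw [integral_add i2 i4, integral_indicator (measurableSet_timeSimplex n)]
    _ ≤ _ := by
        gcongr
        exact setIntegral_timeSimplex_sq_le (measurable_expKernel c n) (memLp_expKernel c n)
          (expKernel_comp_perm c)

/-- If the exponential transform of `Y` is given by kernels `fₙ` that are supported in the simplices
of increasing times, then `‖Y‖² ≤ ∑ ‖fₙ‖²`. -/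
theorem norm_sq_le_of_hasSum_pairing (hW : IsWhiteNoise P W) (hgen : IsGeneratedBy P W)
    {Y : Lp ℝ 2 P} {f : (n : ℕ) → (Fin n → ℝ × ℝ) → ℝ}
    (hf : ∀ n, MemLp (f n) 2 (Measure.pi fun _ => quadrant))
    (hsupp : ∀ n x, f n x ≠ 0 → x ∈ timeSimplex n) {A : ℝ}
    (hA : HasSum (fun n => ∫ x, f n x ^ 2 ∂(Measure.pi fun _ => quadrant)) A)
    (hY : ∀ h : NoiseSpace, HasSum
      (fun n => ∫ x, f n x * tensorPow n h x ∂(Measure.pi fun _ => quadrant))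
      (inner ℝ Y (hW.wickExp h))) :
    ‖Y‖ ^ 2 ≤ A := by
  -- This inequality is closed in X and the span is dense, so X = Y is admissible and gives the
  -- claim.
  have key : ∀ X ∈ Submodule.span ℝ (range hW.wickExp), 2 * inner ℝ Y X ≤ A + ‖X‖ ^ 2 := by
    intro X hX
    obtain ⟨c, rfl⟩ := (Finsupp.mem_span_range_iff_exists_finsupp (R := ℝ)).1 hX
    exact hasSum_le (fun n => two_mul_integral_mul_expKernel_le c (hf n) (hsupp n))
      ((hW.hasSum_integral_mul_expKernel c hf hY).mul_left 2)
      (hA.add (hW.hasSum_integral_sq_expKernel c))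
  have hc : IsClosed {X : Lp ℝ 2 P | 2 * inner ℝ Y X ≤ A + ‖X‖ ^ 2} :=
    isClosed_le (by fun_prop) (by fun_prop)
  have h3 : Y ∈ {X : Lp ℝ 2 P | 2 * inner ℝ Y X ≤ A + ‖X‖ ^ 2} := by
    have : Y ∈ (Submodule.span ℝ (range hW.wickExp)).topologicalClosure := by
      rw [hW.topologicalClosure_span_wickExp hgen]; trivial
    exact closure_minimal key hc this
  have h4 : 2 * inner ℝ Y Y ≤ A + ‖Y‖ ^ 2 := h3
  rw [real_inner_self_eq_norm_sq] at h4
  linarith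

end IsWhiteNoise

/-! ### Rectangles of increasing times are total -/

theorem ae_eq_zero_of_setIntegral_pi_eq_zero {n : ℕ} {α : Type*} [MeasurableSpace α]
    {μ : Measure (Fin n → α)} {g : (Fin n → α) → ℝ} (hg : Integrable g μ)
    (h : ∀ A : Fin n → Set α, (∀ i, MeasurableSet (A i)) → ∫ x in univ.pi A, g x ∂μ = 0) :
    g =ᵐ[μ] 0 := by
  suffices H : ∀ s, MeasurableSet s → ∫ x in s, g x ∂μ = 0 from
    hg.ae_eq_zero_of_forall_setIntegral_eq_zero fun s hs _ => H s hs
  intro s hs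
  refine MeasurableSpace.induction_on_inter (C := fun s _ => ∫ x in s, g x ∂μ = 0)
    generateFrom_pi.symm isPiSystem_pi (by simp) ?_ ?_ ?_ s hs
  · rintro _ ⟨A, hA, rfl⟩
    exact h A fun i => hA i (mem_univ i)
  · intro t ht ih
    have h1 := integral_add_compl ht hg
    have h2 := h (fun _ => univ) fun _ => MeasurableSet.univ
    rw [pi_univ, setIntegral_univ] at h2
    linarith
  · intro f hd hm ih
    rw [integral_iUnion hm hd hg.integrableOn]
    simp [ih]

theorem isOpen_timeSimplex (n : ℕ) : IsOpen (timeSimplex n) := by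
  have : timeSimplex n = ⋂ (i : Fin n) (j : Fin n) (_ : i < j), {x | (x i).2 < (x j).2} := by
    ext x
    simp [timeSimplex, StrictMono]
  rw [this]
  refine isOpen_iInter_of_finite fun i => isOpen_iInter_of_finite fun j =>
    isOpen_iInter_of_finite fun _ => ?_
  exact isOpen_lt (by fun_prop) (by fun_prop)

/-- A point y common to two sides could be placed in both coordinates, giving a point of the
rectangle with two equal times. -/
theorem disjoint_of_pi_subset_timeSimplex {n : ℕ} {A : Fin n → Set (ℝ × ℝ)}
    (hne : ∀ i, (A i).Nonempty) (hA : univ.pi A ⊆ timeSimplex n) :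
    Pairwise fun i j => Disjoint (A i) (A j) := by
  intro i j hij
  refine Set.disjoint_left.2 fun y hyi hyj => ?_
  choose x hx using hne
  set x' : Fin n → ℝ × ℝ := Function.update (Function.update x i y) j y with hx'
  have hmem : x' ∈ univ.pi A := by
    intro k _
    by_cases hkj : k = j
    · subst hkj; simpa [hx'] using hyj
    · by_cases hki : k = i
      · subst hki; simpa [hx', hkj] using hyi
      · simpa [hx', hkj, hki] using hx k
  have hs : StrictMono fun i => (x' i).2 := hA hmem
  exact hij (hs.injective (by simp [hx', hij]))

/-- The simplex is open, so each of its points has a rectangular neighbourhood inside it. A π-λ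
argument shows g = 0 a.e. on that neighbourhood, and locally null sets are null. -/
theorem ae_eq_zero_of_setIntegral_rectangle_eq_zero {n : ℕ}
    (g : Lp ℝ 2 (Measure.pi fun _ : Fin n => quadrant))
    (h : ∀ A : Fin n → Set (ℝ × ℝ), (∀ i, MeasurableSet (A i)) → (∀ i, quadrant (A i) ≠ ∞) →
      (Pairwise fun i j => Disjoint (A i) (A j)) → univ.pi A ⊆ timeSimplex n →
      ∫ x in univ.pi A, g x ∂(Measure.pi fun _ => quadrant) = 0) :
    ∀ᵐ x ∂(Measure.pi fun _ : Fin n => quadrant), x ∈ timeSimplex n → g x = 0 := by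
  suffices H : (Measure.pi fun _ : Fin n => quadrant) {x | x ∈ timeSimplex n ∧ g x ≠ 0} = 0 by
    rw [ae_iff]
    convert H using 2
    ext x
    simp
  refine measure_null_of_locally_null _ fun x hx => ?_
  obtain ⟨ε, hε, hball⟩ := Metric.isOpen_iff.1 (isOpen_timeSimplex n) x hx.1
  -- In the sup metric a ball is a product of balls.
  rw [ball_pi x hε] at hball
  set B : Fin n → Set (ℝ × ℝ) := fun i => Metric.ball (x i) ε
  have hBm (i : Fin n) : MeasurableSet (B i) := Metric.isOpen_ball.measurableSet
  have hBf (i : Fin n) : quadrant (B i) ≠ ∞ :=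
    ((Measure.restrict_apply_le _ _).trans_lt Metric.isBounded_ball.measure_lt_top).ne
  have hBd : Pairwise fun i j => Disjoint (B i) (B j) :=
    disjoint_of_pi_subset_timeSimplex (fun i => ⟨x i, Metric.mem_ball_self hε⟩) hball
  have hBpi : MeasurableSet (univ.pi B) := MeasurableSet.univ_pi hBm
  have hBμ : (Measure.pi fun _ : Fin n => quadrant) (univ.pi B) ≠ ∞ := by
    rw [Measure.pi_pi]
    exact ENNReal.prod_ne_top fun i _ => hBf i
  have hint : IntegrableOn g (univ.pi B) (Measure.pi fun _ : Fin n => quadrant) := by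
    have : IsFiniteMeasure ((Measure.pi fun _ : Fin n => quadrant).restrict (univ.pi B)) := isFiniteMeasure_restrict.2 hBμ
    exact ((Lp.memLp g).restrict _).integrable (by norm_num)
  have h0 : g =ᵐ[(Measure.pi fun _ : Fin n => quadrant).restrict (univ.pi B)] 0 := by
    refine ae_eq_zero_of_setIntegral_pi_eq_zero hint fun A hA => ?_
    rw [Measure.restrict_restrict (MeasurableSet.univ_pi hA), ← pi_inter_distrib]
    refine h _ (fun i => (hA i).inter (hBm i)) (fun i => ?_) ?_ ?_
    · exact ne_top_of_le_ne_top (hBf i) (measure_mono inter_subset_right)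
    · exact fun i j hij => (hBd hij).mono inter_subset_right inter_subset_right
    · exact (pi_mono fun i _ => inter_subset_right).trans hball
  refine ⟨univ.pi B ∩ {x | x ∈ timeSimplex n ∧ g x ≠ 0}, ?_, ?_⟩
  · refine Filter.inter_mem (mem_nhdsWithin_of_mem_nhds ?_) self_mem_nhdsWithin
    rw [← ball_pi x hε]
    exact Metric.ball_mem_nhds x hε
  · rw [Filter.EventuallyEq, ae_restrict_iff' hBpi, ae_iff] at h0
    refine measure_mono_null (fun y hy => ?_) h0
    exact fun h => hy.2.2 (h hy.1)

/-! ### Multiple integrals -/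

theorem inner_indicatorConstLp_eq_zero {A B : Set (ℝ × ℝ)} (hA : MeasurableSet A)
    (hA' : quadrant A ≠ ∞) (hB : MeasurableSet B) (hB' : quadrant B ≠ ∞) (h : Disjoint A B) :
    inner ℝ (indicatorConstLp 2 hA hA' (1 : ℝ)) (indicatorConstLp 2 hB hB' (1 : ℝ)) = 0 := by
  rw [L2.inner_indicatorConstLp_one,
    setIntegral_congr_ae (g := fun _ => (0 : ℝ)) hA, integral_zero]
  filter_upwards [indicatorConstLp_coeFn (hs := hB) (hμs := hB') (c := (1 : ℝ)) (p := 2)]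
    with x hx hxA
  rw [hx, indicator_of_notMem (Set.disjoint_left.1 h hxA)]

theorem integral_indicator_pi_mul_tensorPow {n : ℕ} {A : Fin n → Set (ℝ × ℝ)}
    (hA : ∀ i, MeasurableSet (A i)) (h : ℝ × ℝ → ℝ) :
    ∫ x, (univ.pi A).indicator (fun _ => (1 : ℝ)) x * tensorPow n h x
      ∂(Measure.pi fun _ => quadrant) = ∏ i, ∫ y in A i, h y ∂quadrant := by
  simp_rw [← fun i => integral_indicator (μ := quadrant) (f := h) (hA i)]
  rw [← integral_fintype_prod_eq_prod]
  refine integral_congr_ae (.of_forall fun x => ?_)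
  dsimp only
  by_cases hx : x ∈ univ.pi A
  · rw [indicator_of_mem hx, one_mul, tensorPow]
    exact Finset.prod_congr rfl fun i _ => (indicator_of_mem (hx i trivial) _).symm
  · rw [indicator_of_notMem hx, zero_mul]
    rw [mem_univ_pi, not_forall] at hx
    obtain ⟨i, hi⟩ := hx
    exact (Finset.prod_eq_zero (Finset.mem_univ i) (indicator_of_notMem hi _)).symm

namespace IsWhiteNoise

variable {Ω : Type*} [MeasurableSpace Ω] {P : Measure Ω} {W : NoiseSpace → Ω → ℝ}

theorem memLp_prod (hW : IsWhiteNoise P W) {n : ℕ} (g : Fin n → NoiseSpace) :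
    MemLp (fun ω => ∏ i, W (g i) ω) 2 P := by
  have := hW.gaussian.isProbabilityMeasure
  rcases n with _ | n
  · simpa using memLp_const (μ := P) (1 : ℝ)
  · have := MemLp.prod' (s := Finset.univ) (μ := P) (f := fun i => W (g i))
      (p := fun _ : Fin (n + 1) => 2 * ((n + 1 : ℕ) : ℝ≥0∞)) fun i _ =>
      hW.memLp (g i) (ENNReal.mul_ne_top (by simp) (ENNReal.natCast_ne_top _))
    convert this using 1
    have e : ((n + 1 : ℕ) : ℝ≥0∞) * (2 * ((n + 1 : ℕ) : ℝ≥0∞))⁻¹ = 2⁻¹ := by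
      rw [ENNReal.mul_inv (by simp) (by simp), mul_left_comm,
        ENNReal.mul_inv_cancel (by simp) (ENNReal.natCast_ne_top _), mul_one]
    rw [Finset.sum_const, Finset.card_univ, Fintype.card_fin, nsmul_eq_mul, e, inv_inv]

/-! ### The exponential transform and existence of multiple integrals -/

/-- The functional `Y ↦ E[Y exp(ζ W(h))]`. -/
def expPairing (hW : IsWhiteNoise P W) (h : NoiseSpace) (ζ : ℂ) : Lp ℝ 2 P →L[ℝ] ℂ :=
  Complex.ofRealCLM ∘L innerSL ℝ (hW.memLp_cexp_mul h ζ).re.toLp +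
    Complex.I • (Complex.ofRealCLM ∘L innerSL ℝ (hW.memLp_cexp_mul h ζ).im.toLp)

theorem expPairing_apply (hW : IsWhiteNoise P W) (h : NoiseSpace) (ζ : ℂ) (Y : Lp ℝ 2 P) :
    hW.expPairing h ζ Y = ∫ ω, (Y ω : ℂ) * Complex.exp (ζ * W h ω) ∂P := by
  have hY : MemLp (fun ω => (Y ω : ℂ)) 2 P := (Lp.memLp Y).ofReal
  have hi : Integrable (fun ω => (Y ω : ℂ) * Complex.exp (ζ * W h ω)) P :=
    hY.integrable_mul (hW.memLp_cexp_mul h ζ)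
  have h1 : inner ℝ (hW.memLp_cexp_mul h ζ).re.toLp Y =
      (∫ ω, (Y ω : ℂ) * Complex.exp (ζ * W h ω) ∂P).re := by
    rw [L2.inner_def, ← RCLike.re_eq_complex_re, ← integral_re hi]
    refine integral_congr_ae ?_
    filter_upwards [(hW.memLp_cexp_mul h ζ).re.coeFn_toLp] with ω hω
    rw [hω]
    simp
  have h2 : inner ℝ (hW.memLp_cexp_mul h ζ).im.toLp Y =
      (∫ ω, (Y ω : ℂ) * Complex.exp (ζ * W h ω) ∂P).im := by
    rw [L2.inner_def, ← RCLike.im_eq_complex_im, ← integral_im hi]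
    refine integral_congr_ae ?_
    filter_upwards [(hW.memLp_cexp_mul h ζ).im.coeFn_toLp] with ω hω
    rw [hω]
    simp
  simp only [expPairing, _root_.add_apply, ContinuousLinearMap.comp_apply,
    _root_.smul_apply, innerSL_apply_apply, h1, h2, Complex.ofRealCLM_apply]
  rw [smul_eq_mul, mul_comm Complex.I, Complex.re_add_im]

theorem inner_wickExp_eq_of_expPairing (hW : IsWhiteNoise P W) (h : NoiseSpace) {Y : Lp ℝ 2 P}
    {r : ℝ} (hr : hW.expPairing h 1 Y = Complex.exp (‖h‖ ^ 2 / 2) * r) :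
    inner ℝ Y (hW.wickExp h) = r := by
  rw [expPairing_apply] at hr
  have : ∫ ω, Y ω * Real.exp (W h ω) ∂P = Real.exp (‖h‖ ^ 2 / 2) * r := by
    apply Complex.ofReal_injective
    rw [← integral_complex_ofReal]
    push_cast
    simpa using hr
  rw [inner_wickExp_right, this, ← mul_assoc, ← Real.exp_add]
  simp

/-- The exponential transform of a multiple integral. -/
theorem expPairing_of_mem_graph (hW : IsWhiteNoise P W) {n : ℕ}
    {p : Lp ℝ 2 (Measure.pi fun _ : Fin n => quadrant) × Lp ℝ 2 P}
    (hp : p ∈ multipleIntegralGraph P W n) (h : NoiseSpace) (ζ : ℂ) :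
    hW.expPairing h ζ p.2 = Complex.exp (ζ ^ 2 * ‖h‖ ^ 2 / 2) *
      (ζ ^ n * (∫ x, p.1 x * tensorPow n h x ∂(Measure.pi fun _ => quadrant) : ℝ)) := by
  set T := (memLp_coeFn_tensorPow n h).toLp
  set L : Lp ℝ 2 (Measure.pi fun _ : Fin n => quadrant) × Lp ℝ 2 P →L[ℝ] ℂ :=
    hW.expPairing h ζ ∘L ContinuousLinearMap.snd ℝ _ _ -
      (Complex.exp (ζ ^ 2 * ‖h‖ ^ 2 / 2) * ζ ^ n) •
        (Complex.ofRealCLM ∘L innerSL ℝ T ∘L ContinuousLinearMap.fst ℝ _ _) with hL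
  have hT (f : Lp ℝ 2 (Measure.pi fun _ : Fin n => quadrant)) :
      inner ℝ T f = ∫ x, f x * tensorPow n h x ∂(Measure.pi fun _ => quadrant) := by
    rw [L2.inner_def]
    refine integral_congr_ae ?_
    filter_upwards [(memLp_coeFn_tensorPow n h).coeFn_toLp] with x hx
    rw [hx]
    simp
  have hLa (q) : L q = hW.expPairing h ζ q.2 - Complex.exp (ζ ^ 2 * ‖h‖ ^ 2 / 2) *
      (ζ ^ n * (∫ x, q.1 x * tensorPow n h x ∂(Measure.pi fun _ => quadrant) : ℝ)) := by
    rw [← hT, ← mul_assoc]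
    rfl
  -- The formula is a closed linear condition on the graph, so it suffices to check it on products
  -- over disjoint sets, whose indicators are orthogonal.
  have hle : multipleIntegralGraph P W n ≤ LinearMap.ker L.toLinearMap := by
    refine Submodule.topologicalClosure_minimal _ (Submodule.span_le.2 ?_) L.isClosed_ker
    rintro q ⟨A, hA, hA', hd, h1, h2⟩
    change L q = 0
    rw [hLa, sub_eq_zero, expPairing_apply]
    have e1 : ∫ x, q.1 x * tensorPow n h x ∂(Measure.pi fun _ => quadrant) =
        ∏ i, inner ℝ (indicatorConstLp 2 (hA i) (hA' i) (1 : ℝ)) h := by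
      simp_rw [L2.inner_indicatorConstLp_one]
      rw [← integral_indicator_pi_mul_tensorPow hA]
      refine integral_congr_ae ?_
      filter_upwards [h1] with x hx
      rw [hx]
    rw [e1, ← hW.integral_prod_mul_cexp _ (fun i j hij =>
      inner_indicatorConstLp_eq_zero (hA i) (hA' i) (hA j) (hA' j) (hd hij)) h ζ]
    refine integral_congr_ae ?_
    filter_upwards [h2] with ω hω
    rw [hω]
  have : L p = 0 := hle hp
  rwa [hLa, sub_eq_zero] at this

/-- The duality bound applied to a family of kernels concentrated in the single degree n. -/
theorem norm_le_of_mem_graph (hW : IsWhiteNoise P W) (hgen : IsGeneratedBy P W) {n : ℕ}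
    {p : Lp ℝ 2 (Measure.pi fun _ : Fin n => quadrant) × Lp ℝ 2 P}
    (hp : p ∈ multipleIntegralGraph P W n)
    (h0 : ∀ᵐ x ∂(Measure.pi fun _ : Fin n => quadrant), x ∉ timeSimplex n → p.1 x = 0) :
    ‖p.2‖ ≤ ‖p.1‖ := by
  classical
  set f : (Fin n → ℝ × ℝ) → ℝ := (timeSimplex n).indicator p.1 with hf
  have hfp : f =ᵐ[Measure.pi fun _ : Fin n => quadrant] p.1 := by
    filter_upwards [h0] with x hx
    by_cases hxs : x ∈ timeSimplex n
    · rw [hf, indicator_of_mem hxs]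
    · rw [hf, indicator_of_notMem hxs, hx hxs]
  have hfm : MemLp f 2 (Measure.pi fun _ => quadrant) := (memLp_congr_ae hfp).2 (Lp.memLp p.1)
  set F : (m : ℕ) → (Fin m → ℝ × ℝ) → ℝ := Pi.single n f with hF
  have hFn : F n = f := by rw [hF, Pi.single_eq_same]
  have hFm (m : ℕ) (hm : m ≠ n) : F m = 0 := by rw [hF, Pi.single_eq_of_ne hm]
  have hn : ∫ x, f x ^ 2 ∂(Measure.pi fun _ => quadrant) = ‖p.1‖ ^ 2 := by
    rw [← real_inner_self_eq_norm_sq, L2.inner_def]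
    refine integral_congr_ae ?_
    filter_upwards [hfp] with x hx
    rw [hx]
    simp [sq]
  have := hW.norm_sq_le_of_hasSum_pairing hgen (Y := p.2) (f := F) (A := ‖p.1‖ ^ 2)
    (fun m => by
      by_cases hm : m = n
      · subst hm; rwa [hFn]
      · rw [hFm m hm]; exact MemLp.zero')
    (fun m x hx => by
      by_cases hm : m = n
      · subst hm
        rw [hFn] at hx
        exact mem_of_indicator_ne_zero hx
      · rw [hFm m hm] at hx
        exact absurd rfl hx)
    (by
      rw [← hn, ← hFn]
      exact hasSum_single n fun m hm => by rw [hFm m hm]; simp)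
    (fun h => by
      have e : inner ℝ p.2 (hW.wickExp h) =
          ∫ x, F n x * tensorPow n h x ∂(Measure.pi fun _ => quadrant) := by
        refine hW.inner_wickExp_eq_of_expPairing h ?_
        rw [hW.expPairing_of_mem_graph hp, hFn]
        simp only [one_pow, one_mul]
        congr 2
        refine integral_congr_ae ?_
        filter_upwards [hfp] with x hx
        rw [hx]
      rw [e]
      exact hasSum_single n fun m hm => by rw [hFm m hm]; simp)
  exact abs_le_of_sq_le_sq' this (norm_nonneg _) |>.2

/-- Rectangles inside the simplex approximate f, and the contraction bound makes the corresponding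
integrals a Cauchy sequence; the graph is closed. -/
theorem exists_mem_graph (hW : IsWhiteNoise P W) (hgen : IsGeneratedBy P W) {n : ℕ}
    {f : Lp ℝ 2 (Measure.pi fun _ : Fin n => quadrant)}
    (hf : ∀ᵐ x ∂(Measure.pi fun _ : Fin n => quadrant), x ∉ timeSimplex n → f x = 0) :
    ∃ Y : Lp ℝ 2 P, (f, Y) ∈ multipleIntegralGraph P W n := by
  set S : Set (Lp ℝ 2 (Measure.pi fun _ : Fin n => quadrant) × Lp ℝ 2 P) :=
    {p ∈ elementaryIntegrals P W n |
      ∀ᵐ x ∂(Measure.pi fun _ : Fin n => quadrant), x ∉ timeSimplex n → p.1 x = 0} with hS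
  set M := Submodule.span ℝ S with hM
  have hMle : M ≤ multipleIntegralGraph P W n :=
    (Submodule.span_mono fun p hp => hp.1).trans (Submodule.le_topologicalClosure _)
  have hM0 : ∀ p ∈ M, ∀ᵐ x ∂(Measure.pi fun _ : Fin n => quadrant),
      x ∉ timeSimplex n → p.1 x = 0 := by
    intro p hp
    induction hp using Submodule.span_induction with
    | mem p hp => exact hp.2
    | zero =>
      filter_upwards [Lp.coeFn_zero ℝ 2 (Measure.pi fun _ : Fin n => quadrant)] with x hx _
      exact hx
    | add p q _ _ ihp ihq =>
      filter_upwards [ihp, ihq, Lp.coeFn_add p.1 q.1] with x h1 h2 h3 hx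
      rw [Prod.fst_add, h3, Pi.add_apply, h1 hx, h2 hx, add_zero]
    | smul a p _ ihp =>
      filter_upwards [ihp, Lp.coeFn_smul a p.1] with x h1 h3 hx
      rw [Prod.smul_fst, h3, Pi.smul_apply, h1 hx, smul_zero]
  set V := M.map (LinearMap.fst ℝ (Lp ℝ 2 (Measure.pi fun _ : Fin n => quadrant)) (Lp ℝ 2 P))
    with hV
  have hfV : f ∈ V.topologicalClosure := by
    -- Any g orthogonal to the rectangles vanishes on the simplex, while f vanishes off it, so g ⊥
    -- f.
    rw [← Submodule.orthogonal_orthogonal_eq_closure, Submodule.mem_orthogonal]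
    intro g hg
    have h0 := ae_eq_zero_of_setIntegral_rectangle_eq_zero g fun A hA hA' hd hAs => by
      have hApi : MeasurableSet (univ.pi A) := MeasurableSet.univ_pi hA
      have hAμ : (Measure.pi fun _ : Fin n => quadrant) (univ.pi A) ≠ ∞ := by
        rw [Measure.pi_pi]
        exact ENNReal.prod_ne_top fun i _ => hA' i
      have hm := hW.memLp_prod fun i => indicatorConstLp 2 (hA i) (hA' i) (1 : ℝ)
      have hmem : indicatorConstLp 2 hApi hAμ (1 : ℝ) ∈ V := by
        refine ⟨(indicatorConstLp 2 hApi hAμ (1 : ℝ), hm.toLp),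
          Submodule.subset_span ⟨?_, ?_⟩, rfl⟩
        · exact ⟨A, hA, hA', hd, indicatorConstLp_coeFn (hs := hApi) (hμs := hAμ) (c := (1 : ℝ))
            (p := 2), hm.coeFn_toLp⟩
        · filter_upwards [indicatorConstLp_coeFn (hs := hApi) (hμs := hAμ) (c := (1 : ℝ))
            (p := 2)] with x hx hxs
          rw [hx, indicator_of_notMem fun h => hxs (hAs h)]
      have := (Submodule.mem_orthogonal _ g).1 hg _ hmem
      rwa [L2.inner_indicatorConstLp_one] at this
    rw [L2.inner_def]
    refine integral_eq_zero_of_ae ?_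
    filter_upwards [h0, hf] with x h1 h2
    by_cases hx : x ∈ timeSimplex n
    · simp [h1 hx]
    · simp [h2 hx]
  obtain ⟨v, hv, hlim⟩ := mem_closure_iff_seq_limit.1 hfV
  choose p hpM hpv using hv
  have hcauchy : CauchySeq fun k => (p k).2 := by
    have hc := hlim.cauchySeq
    rw [Metric.cauchySeq_iff] at hc ⊢
    intro ε hε
    obtain ⟨N, hN⟩ := hc ε hε
    refine ⟨N, fun a ha b hb => lt_of_le_of_lt ?_ (hN a ha b hb)⟩
    have hab := M.sub_mem (hpM a) (hpM b)
    have := hW.norm_le_of_mem_graph hgen (hMle hab) (hM0 _ hab)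
    rw [dist_eq_norm, dist_eq_norm, ← hpv a, ← hpv b]
    exact this
  obtain ⟨Y, hY⟩ := cauchySeq_tendsto_of_complete hcauchy
  refine ⟨Y, ?_⟩
  have hclosed : IsClosed (multipleIntegralGraph P W n :
      Set (Lp ℝ 2 (Measure.pi fun _ : Fin n => quadrant) × Lp ℝ 2 P)) :=
    Submodule.isClosed_topologicalClosure _
  refine hclosed.mem_of_tendsto (hlim.prodMk_nhds hY) (.of_forall fun k => ?_)
  rw [← hpv k]
  exact hMle (hpM k)

variable {n : ℕ} {f : (Fin n → ℝ × ℝ) → ℝ}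

/-- For time-ordered kernels the existence clause in `multipleIntegral` holds, so the default value
0 is not taken. -/
theorem multipleIntegral_mem_graph (hW : IsWhiteNoise P W) (hgen : IsGeneratedBy P W)
    (hf : MemLp f 2 (Measure.pi fun _ : Fin n => quadrant))
    (hsupp : ∀ x, f x ≠ 0 → x ∈ timeSimplex n) :
    (hf.toLp f, multipleIntegral P W n f) ∈ multipleIntegralGraph P W n := by
  have hex : ∃ (hf : MemLp f 2 (Measure.pi fun _ : Fin n => quadrant)) (Y : Lp ℝ 2 P),
      (hf.toLp f, Y) ∈ multipleIntegralGraph P W n := by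
    refine ⟨hf, hW.exists_mem_graph hgen ?_⟩
    filter_upwards [hf.coeFn_toLp] with x hx hxs
    rw [hx]
    by_contra h0
    exact hxs (hsupp x h0)
  rw [multipleIntegral, dif_pos hex]
  exact hex.choose_spec.choose_spec

theorem expPairing_multipleIntegral (hW : IsWhiteNoise P W) (hgen : IsGeneratedBy P W)
    (hf : MemLp f 2 (Measure.pi fun _ : Fin n => quadrant))
    (hsupp : ∀ x, f x ≠ 0 → x ∈ timeSimplex n) (h : NoiseSpace) (ζ : ℂ) :
    hW.expPairing h ζ (multipleIntegral P W n f) = Complex.exp (ζ ^ 2 * ‖h‖ ^ 2 / 2) *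
      (ζ ^ n * (∫ x, f x * tensorPow n h x ∂(Measure.pi fun _ => quadrant) : ℝ)) := by
  have := hW.expPairing_of_mem_graph (hW.multipleIntegral_mem_graph hgen hf hsupp) h ζ
  rw [this]
  congr 3
  refine integral_congr_ae ?_
  filter_upwards [hf.coeFn_toLp] with x hx
  rw [hx]

theorem norm_sq_multipleIntegral_le (hW : IsWhiteNoise P W) (hgen : IsGeneratedBy P W)
    (hf : MemLp f 2 (Measure.pi fun _ : Fin n => quadrant))
    (hsupp : ∀ x, f x ≠ 0 → x ∈ timeSimplex n) :
    ‖multipleIntegral P W n f‖ ^ 2 ≤ ∫ x, f x ^ 2 ∂(Measure.pi fun _ => quadrant) := by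
  have h1 := hW.norm_le_of_mem_graph hgen (hW.multipleIntegral_mem_graph hgen hf hsupp) (by
    filter_upwards [hf.coeFn_toLp] with x hx hxs
    rw [hx]
    by_contra h0
    exact hxs (hsupp x h0))
  have h2 : ‖hf.toLp f‖ ^ 2 = ∫ x, f x ^ 2 ∂(Measure.pi fun _ => quadrant) := by
    rw [← real_inner_self_eq_norm_sq, L2.inner_def]
    refine integral_congr_ae ?_
    filter_upwards [hf.coeFn_toLp] with x hx
    rw [hx]
    simp [sq]
  rw [← h2]
  gcongr

end IsWhiteNoise

/-! ### The chaos series -/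

namespace IsWhiteNoise

variable {Ω : Type*} [MeasurableSpace Ω] {P : Measure Ω} {W : NoiseSpace → Ω → ℝ}

theorem coeFn_wickExp_zero (hW : IsWhiteNoise P W) : hW.wickExp 0 =ᵐ[P] fun _ => 1 := by
  filter_upwards [hW.coeFn_wickExp 0, hW.map_smul 0 0] with ω h1 h2
  rw [zero_smul, zero_mul] at h2
  simp [h1, h2]

theorem inner_smul_wickExp_zero (hW : IsWhiteNoise P W) (c : ℝ) (h : NoiseSpace) :
    inner ℝ (c • hW.wickExp 0) (hW.wickExp h) = c := by
  rw [real_inner_smul_left, inner_wickExp_wickExp]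
  simp

theorem ext_of_inner_wickExp (hW : IsWhiteNoise P W) (hgen : IsGeneratedBy P W) {X Y : Lp ℝ 2 P}
    (h : ∀ h, inner ℝ X (hW.wickExp h) = inner ℝ Y (hW.wickExp h)) : X = Y := by
  refine hW.ext_of_integral_mul_exp hgen fun k => ?_
  have := h k
  simp only [inner_wickExp_right] at this
  exact mul_left_cancel₀ (Real.exp_pos _).ne' this

variable (u₀ : Ioi (0 : ℝ) →ᵇ ℝ)

theorem norm_multipleIntegral_chaosKernel_le (hW : IsWhiteNoise P W) (hgen : IsGeneratedBy P W)
    (n : ℕ) {z : ℝ} (hz : 0 ≤ z) (t : ℝ) :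
    ‖multipleIntegral P W n (chaosKernel u₀ n z t)‖ ≤ ‖u₀‖ * Real.sqrt (1 / 2) ^ n := by
  refine le_of_sq_le_sq ?_ (by positivity)
  refine (hW.norm_sq_multipleIntegral_le hgen (memLp_chaosKernel u₀ n hz t)
    fun x hx => (chaosKernel_ne_zero u₀ hx).1).trans ?_
  rw [mul_pow, ← pow_mul, mul_comm n 2, pow_mul, Real.sq_sqrt (by norm_num)]
  exact integral_sq_chaosKernel_le u₀ n hz t

theorem summable_multipleIntegral_chaosKernel (hW : IsWhiteNoise P W) (hgen : IsGeneratedBy P W)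
    {z : ℝ} (hz : 0 ≤ z) (t : ℝ) :
    Summable fun n => multipleIntegral P W n (chaosKernel u₀ n z t) := by
  have hs : Real.sqrt (1 / 2) < 1 := by
    rw [Real.sqrt_lt' one_pos]
    norm_num
  exact .of_norm_bounded ((summable_geometric_of_lt_one (Real.sqrt_nonneg _) hs).mul_left ‖u₀‖)
    fun n => hW.norm_multipleIntegral_chaosKernel_le u₀ hgen n hz t

theorem hasSum_expPairing_chaosSolution [IsProbabilityMeasure P] (hW : IsWhiteNoise P W)
    (hgen : IsGeneratedBy P W) {z : ℝ} (hz : 0 ≤ z) (t : ℝ) (h : NoiseSpace) (ζ : ℂ) :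
    HasSum (fun n => Complex.exp (ζ ^ 2 * ‖h‖ ^ 2 / 2) * (ζ ^ n * (chaosPairing u₀ n z t h : ℂ)))
      (hW.expPairing h ζ (chaosSolution P W u₀ z t)) := by
  have := (hW.summable_multipleIntegral_chaosKernel u₀ hgen hz t).hasSum.mapL
    (hW.expPairing h ζ)
  simp_rw [hW.expPairing_multipleIntegral hgen (memLp_chaosKernel u₀ _ hz t)
    (fun x hx => (chaosKernel_ne_zero u₀ hx).1) h ζ] at this
  exact this

theorem hasSum_inner_chaosSolution [IsProbabilityMeasure P] (hW : IsWhiteNoise P W)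
    (hgen : IsGeneratedBy P W) {z : ℝ} (hz : 0 ≤ z) (t : ℝ) (h : NoiseSpace) :
    HasSum (fun n => chaosPairing u₀ n z t h)
      (inner ℝ (chaosSolution P W u₀ z t) (hW.wickExp h)) := by
  have h1 := (hW.summable_multipleIntegral_chaosKernel u₀ hgen hz t).hasSum.mapL
    (innerSL ℝ (hW.wickExp h))
  have h2 (n : ℕ) : innerSL ℝ (hW.wickExp h) (multipleIntegral P W n (chaosKernel u₀ n z t)) =
      chaosPairing u₀ n z t h := by
    rw [innerSL_apply_apply, real_inner_comm]
    refine hW.inner_wickExp_eq_of_expPairing h ?_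
    rw [hW.expPairing_multipleIntegral hgen (memLp_chaosKernel u₀ n hz t)
      (fun x hx => (chaosKernel_ne_zero u₀ hx).1) h 1]
    simp [chaosPairing]
  simp_rw [h2] at h1
  rw [real_inner_comm]
  exact h1

/-- The duality bound is applied to all degrees at once, so squared norms are added. The triangle
inequality over the degrees would lose the constant 2. -/
theorem norm_sq_chaosSolution_le [IsProbabilityMeasure P] (hW : IsWhiteNoise P W)
    (hgen : IsGeneratedBy P W) {z : ℝ} (hz : 0 ≤ z) (t : ℝ) :
    ‖chaosSolution P W u₀ z t‖ ^ 2 ≤ 2 * ‖u₀‖ ^ 2 := by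
  have hg : HasSum (fun n : ℕ => ‖u₀‖ ^ 2 * (1 / 2) ^ n) (‖u₀‖ ^ 2 * 2) :=
    hasSum_geometric_two.mul_left _
  have hs : Summable fun n => ∫ x, chaosKernel u₀ n z t x ^ 2 ∂(Measure.pi fun _ => quadrant) :=
    .of_nonneg_of_le (fun n => integral_nonneg fun x => sq_nonneg _)
      (fun n => integral_sq_chaosKernel_le u₀ n hz t) hg.summable
  refine (hW.norm_sq_le_of_hasSum_pairing hgen (fun n => memLp_chaosKernel u₀ n hz t)
    (fun n x hx => (chaosKernel_ne_zero u₀ hx).1) hs.hasSum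
    (hW.hasSum_inner_chaosSolution u₀ hgen hz t)).trans ?_
  rw [mul_comm]
  exact hasSum_le (fun n => integral_sq_chaosKernel_le u₀ n hz t) hs.hasSum hg

theorem integral_sq_chaosSolution_le [IsProbabilityMeasure P] (hW : IsWhiteNoise P W)
    (hgen : IsGeneratedBy P W) {z : ℝ} (hz : 0 ≤ z) (t : ℝ) :
    ∫ ω, (chaosSolution P W u₀ z t ω) ^ 2 ∂P ≤ 2 * ‖u₀‖ ^ 2 := by
  refine le_of_eq_of_le ?_ (hW.norm_sq_chaosSolution_le u₀ hgen hz t)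
  rw [← real_inner_self_eq_norm_sq, L2.inner_def]
  simp [sq]

theorem chaosSolution_ae_eq_const [IsProbabilityMeasure P] (hW : IsWhiteNoise P W)
    (hgen : IsGeneratedBy P W) {z : ℝ} (hz : 0 ≤ z) {t : ℝ} (h0 : ∀ y, noiseKernel z t y = 0) :
    chaosSolution P W u₀ z t =ᵐ[P] fun _ => detSolution u₀ z t := by
  have : chaosSolution P W u₀ z t = detSolution u₀ z t • hW.wickExp 0 := by
    refine hW.ext_of_inner_wickExp hgen fun h => ?_
    rw [inner_smul_wickExp_zero, ← chaosPairing_zero u₀ z t h]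
    refine (hW.hasSum_inner_chaosSolution u₀ hgen hz t h).unique (hasSum_single 0 fun n hn => ?_)
    obtain ⟨n, rfl⟩ := Nat.exists_eq_succ_of_ne_zero hn
    simp [chaosPairing_succ u₀ n hz t (Lp.memLp h), h0]
  rw [this]
  filter_upwards [Lp.coeFn_smul (detSolution u₀ z t) (hW.wickExp 0), hW.coeFn_wickExp_zero]
    with ω h1 h2
  simp [h1, h2]

theorem hasBoundaryValues_chaosSolution [IsProbabilityMeasure P] (hW : IsWhiteNoise P W)
    (hgen : IsGeneratedBy P W) :
    HasBoundaryValues P u₀ (fun z t => chaosSolution P W u₀ z t) := by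
  refine ⟨fun z => ?_, fun t ht => ?_⟩
  · filter_upwards [hW.chaosSolution_ae_eq_const u₀ hgen (le_of_lt z.2)
      (noiseKernel_zero_right z)] with ω hω
    have hz : (0 : ℝ) < z := z.2
    simp [hω, detSolution, hz]
  · filter_upwards [hW.chaosSolution_ae_eq_const u₀ hgen le_rfl (noiseKernel_zero_left t)]
      with ω hω
    simp [hω, detSolution]

end IsWhiteNoise

/-! ### Weak measurability and measurable versions -/

/-- Orthonormal vectors are at distance √2, so balls of radius 1/2 around them are disjoint. -/
theorem countable_of_orthonormal {E ι : Type*} [NormedAddCommGroup E] [InnerProductSpace ℝ E]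
    [TopologicalSpace.SeparableSpace E] {b : ι → E} (hb : Orthonormal ℝ b) : Countable ι := by
  rw [← countable_univ_iff]
  refine Set.PairwiseDisjoint.countable_of_isOpen (s := fun i => Metric.ball (b i) (1 / 2)) ?_
    (fun i _ => Metric.isOpen_ball) fun i _ => ⟨b i, Metric.mem_ball_self (by norm_num)⟩
  intro i _ j _ hij
  refine Metric.ball_disjoint_ball ?_
  rw [dist_eq_norm]
  refine le_of_sq_le_sq ?_ (norm_nonneg _)
  rw [norm_sub_sq_real, hb.1 i, hb.1 j, hb.2 hij]
  norm_num

/-- A form of Pettis' theorem: weak measurability passes from S to all vectors, and g is the limit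
of its expansion in a countable Hilbert basis. -/
theorem stronglyMeasurable_of_inner {α E : Type*} [MeasurableSpace α] [NormedAddCommGroup E]
    [InnerProductSpace ℝ E] [CompleteSpace E] [TopologicalSpace.SeparableSpace E] {g : α → E}
    {S : Set E} (hS : (Submodule.span ℝ S).topologicalClosure = ⊤)
    (h : ∀ x ∈ S, Measurable fun p => inner ℝ (g p) x) : StronglyMeasurable g := by
  have hall : ∀ x, Measurable fun p => inner ℝ (g p) x := by
    have hspan : ∀ x ∈ Submodule.span ℝ S, Measurable fun p => inner ℝ (g p) x := by
      intro x hx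
      induction hx using Submodule.span_induction with
      | mem x hx => exact h x hx
      | zero => simp
      | add x y _ _ hx hy =>
        simp_rw [inner_add_right]
        exact hx.add hy
      | smul a x _ hx => simpa only [real_inner_smul_right] using hx.const_mul a
    intro x
    have hx : x ∈ closure (Submodule.span ℝ S : Set E) := by
      rw [← Submodule.topologicalClosure_coe, hS]
      trivial
    obtain ⟨y, hy, hyx⟩ := mem_closure_iff_seq_limit.1 hx
    refine measurable_of_tendsto_metrizable (fun k => hspan _ (hy k)) ?_
    rw [tendsto_pi_nhds]
    exact fun p => (Continuous.inner continuous_const continuous_id).continuousAt.tendsto.comp hyx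
  obtain ⟨w, b, -⟩ := exists_hilbertBasis ℝ E
  have := countable_of_orthonormal b.orthonormal
  refine stronglyMeasurable_of_tendsto (Filter.atTop : Filter (Finset w))
    (f := fun s p => ∑ i ∈ s, b.repr (g p) i • b i) (fun s => ?_) ?_
  · refine Finset.stronglyMeasurable_fun_sum _ fun i _ => ?_
    refine StronglyMeasurable.smul_const ?_ _
    simp_rw [b.repr_apply_apply, real_inner_comm]
    exact (hall _).stronglyMeasurable
  · rw [tendsto_pi_nhds]
    exact fun p => b.hasSum_repr (g p)

/-- Approximating g(p) within 2⁻ʲ from a countable dense set gives jointly measurable functions, and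
the summable squared errors force almost sure convergence for every p. -/
theorem exists_measurable_version {α Ω : Type*} [MeasurableSpace α] [MeasurableSpace Ω]
    {P : Measure Ω} [SecondCountableTopology (Lp ℝ 2 P)] {g : α → Lp ℝ 2 P}
    (hg : StronglyMeasurable g) :
    ∃ v : α → Ω → ℝ, Measurable (fun p : α × Ω => v p.1 p.2) ∧ ∀ p, v p =ᵐ[P] g p := by
  set y := TopologicalSpace.denseSeq (Lp ℝ 2 P)
  have hex (j : ℕ) (p : α) : ∃ i, ‖y i - g p‖ < (1 / 2) ^ j := by
    obtain ⟨i, hi⟩ := Metric.denseRange_iff.1 (TopologicalSpace.denseRange_denseSeq (Lp ℝ 2 P))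
      (g p) ((1 / 2) ^ j) (by positivity)
    exact ⟨i, by rwa [← dist_eq_norm, dist_comm]⟩
  classical
  set k : ℕ → α → ℕ := fun j p => Nat.find (hex j p)
  have hk (j : ℕ) : Measurable (k j) := measurable_find (hex j) fun i =>
    measurableSet_lt (stronglyMeasurable_const.sub hg).norm.measurable measurable_const
  have hky (j : ℕ) (p : α) : ‖y (k j p) - g p‖ < (1 / 2) ^ j := Nat.find_spec (hex j p)
  have hm (j : ℕ) : Measurable fun p : α × Ω => y (k j p.1) p.2 := by
    have h1 : Measurable fun q : ℕ × Ω => y q.1 q.2 :=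
      measurable_from_prod_countable_right fun i => (Lp.stronglyMeasurable (y i)).measurable
    exact h1.comp (f := fun p : α × Ω => (k j p.1, p.2))
      (((hk j).comp measurable_fst).prodMk measurable_snd)
  have hlim (p : α) : ∀ᵐ ω ∂P,
      Filter.Tendsto (fun j => y (k j p) ω) Filter.atTop (nhds (g p ω)) := by
    have hint (j : ℕ) : ∫⁻ ω, ‖(y (k j p) - g p : Lp ℝ 2 P) ω‖ₑ ^ 2 ∂P ≤ (1 / 4) ^ j := by
      have e := Lp.enorm_def (y (k j p) - g p)
      rw [eLpNorm_eq_lintegral_rpow_enorm_toReal (by simp) (by simp)] at e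
      have e2 : ∫⁻ ω, ‖(y (k j p) - g p : Lp ℝ 2 P) ω‖ₑ ^ 2 ∂P = ‖y (k j p) - g p‖ₑ ^ 2 := by
        rw [e, ← ENNReal.rpow_natCast _ 2, ← ENNReal.rpow_mul]
        simp
      rw [e2, ← ofReal_norm, ← ENNReal.ofReal_pow (norm_nonneg _)]
      have h4 : (1 / 4 : ℝ≥0∞) ^ j = ENNReal.ofReal ((1 / 4) ^ j) := by
        rw [ENNReal.ofReal_pow (by norm_num), ENNReal.ofReal_div_of_pos (by norm_num)]
        simp
      rw [h4]
      refine ENNReal.ofReal_le_ofReal ?_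
      calc _ ≤ ((1 / 2 : ℝ) ^ j) ^ 2 := by gcongr; exact (hky j p).le
        _ = _ := by rw [← pow_mul, mul_comm, pow_mul]; norm_num
    have hsum : ∫⁻ ω, ∑' j, ‖(y (k j p) - g p : Lp ℝ 2 P) ω‖ₑ ^ 2 ∂P ≠ ∞ := by
      rw [lintegral_tsum fun j => ((Lp.stronglyMeasurable _).measurable.enorm.pow_const 2).aemeasurable]
      refine ne_top_of_le_ne_top ?_ (ENNReal.tsum_le_tsum hint)
      rw [ENNReal.tsum_geometric]
      refine ENNReal.inv_ne_top.2 ?_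
      rw [Ne, tsub_eq_zero_iff_le, not_le]
      simp
    have hfin := ae_lt_top' (Measurable.tsum fun j =>
      (Lp.stronglyMeasurable (y (k j p) - g p)).measurable.enorm.pow_const 2).aemeasurable hsum
    filter_upwards [hfin, ae_all_iff.2 fun j => Lp.coeFn_sub (y (k j p)) (g p)] with ω h1 h2
    have h3 := ENNReal.tendsto_atTop_zero_of_tsum_ne_top h1.ne
    rw [tendsto_iff_norm_sub_tendsto_zero]
    have h4 := ((ENNReal.tendsto_toReal ENNReal.zero_ne_top).comp h3).sqrt
    simp only [ENNReal.toReal_zero, Real.sqrt_zero, Function.comp_def, ENNReal.toReal_pow,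
      toReal_enorm, Real.sqrt_sq (norm_nonneg _), h2, Pi.sub_apply] at h4
    exact h4
  refine ⟨fun p ω => Filter.limUnder Filter.atTop fun j => y (k j p) ω, ?_, fun p => ?_⟩
  · exact (StronglyMeasurable.limUnder fun j => (hm j).stronglyMeasurable).measurable
  · filter_upwards [hlim p] with ω hω
    exact hω.limUnder_eq

namespace IsWhiteNoise

variable {Ω : Type*} [MeasurableSpace Ω] {P : Measure Ω} {W : NoiseSpace → Ω → ℝ}

instance : SecondCountableTopology NoiseSpace := by
  have : Fact ((2 : ℝ≥0∞) ≠ ∞) := ⟨by simp⟩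
  infer_instance

theorem continuous_wickExp (hW : IsWhiteNoise P W) : Continuous hW.wickExp := by
  rw [continuous_iff_continuousAt]
  intro g
  rw [ContinuousAt, tendsto_iff_norm_sub_tendsto_zero]
  have h (x : NoiseSpace) : ‖hW.wickExp x - hW.wickExp g‖ = Real.sqrt
      (Real.exp (inner ℝ x x) - 2 * Real.exp (inner ℝ x g) + Real.exp (inner ℝ g g)) := by
    rw [← hW.inner_wickExp_wickExp, ← hW.inner_wickExp_wickExp, ← hW.inner_wickExp_wickExp,
      real_inner_self_eq_norm_sq, real_inner_self_eq_norm_sq, ← norm_sub_sq_real,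
      Real.sqrt_sq (norm_nonneg _)]
  simp_rw [h]
  have hc : Continuous fun x : NoiseSpace => Real.sqrt
      (Real.exp (inner ℝ x x) - 2 * Real.exp (inner ℝ x g) + Real.exp (inner ℝ g g)) := by
    fun_prop
  have := hc.tendsto g
  rwa [show Real.exp (inner ℝ g g) - 2 * Real.exp (inner ℝ g g) + Real.exp (inner ℝ g g) = 0 by
    ring, Real.sqrt_zero] at this

theorem secondCountableTopology_Lp (hW : IsWhiteNoise P W) (hgen : IsGeneratedBy P W) :
    SecondCountableTopology (Lp ℝ 2 P) := by
  have h1 := ((TopologicalSpace.isSeparable_range hW.continuous_wickExp).span (R := ℝ)).closure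
  rw [← Submodule.topologicalClosure_coe, hW.topologicalClosure_span_wickExp hgen,
    Submodule.top_coe, TopologicalSpace.isSeparable_univ_iff] at h1
  exact UniformSpace.secondCountable_of_separable _

/-- A jointly measurable modification of the chaos solution. -/
theorem exists_measurable_chaosSolution [IsProbabilityMeasure P] (u₀ : Ioi (0 : ℝ) →ᵇ ℝ)
    (hW : IsWhiteNoise P W) (hgen : IsGeneratedBy P W) :
    ∃ v : ℝ × ℝ → Ω → ℝ, Measurable (fun p : (ℝ × ℝ) × Ω => v p.1 p.2) ∧
      ∀ p : ℝ × ℝ, 0 ≤ p.1 → v p =ᵐ[P] chaosSolution P W u₀ p.1 p.2 := by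
  have := hW.secondCountableTopology_Lp hgen
  -- The pairing formula is available only for z ≥ 0, hence the truncation.
  set g : ℝ × ℝ → Lp ℝ 2 P := fun p => if 0 ≤ p.1 then chaosSolution P W u₀ p.1 p.2 else 0
  have hg : StronglyMeasurable g := by
    refine stronglyMeasurable_of_inner (hW.topologicalClosure_span_wickExp hgen) ?_
    rintro _ ⟨h, rfl⟩
    refine measurable_of_tendsto_metrizable (f := fun N (p : ℝ × ℝ) =>
      if 0 ≤ p.1 then ∑ n ∈ Finset.range N, chaosPairing u₀ n p.1 p.2 h else 0) (fun N => ?_) ?_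
    · refine Measurable.ite (measurableSet_le measurable_const measurable_fst) ?_ measurable_const
      exact Finset.measurable_fun_sum _ fun n _ =>
        measurable_chaosPairing u₀ n (Lp.stronglyMeasurable h).measurable
    · rw [tendsto_pi_nhds]
      intro p
      by_cases hp : 0 ≤ p.1
      · simp only [g, if_pos hp]
        exact (hW.hasSum_inner_chaosSolution u₀ hgen hp p.2 h).tendsto_sum_nat
      · simp [g, if_neg hp]
  obtain ⟨v, hv, hvg⟩ := exists_measurable_version hg
  refine ⟨v, hv, fun p hp => ?_⟩
  simpa [g, if_pos hp] using hvg p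

end IsWhiteNoise

/-! ### Random elements of the noise space -/

section Sections

theorem memLp_two_iff_lintegral {α E : Type*} [MeasurableSpace α] {μ : Measure α}
    [NormedAddCommGroup E] {f : α → E} (hf : AEStronglyMeasurable f μ) :
    MemLp f 2 μ ↔ ∫⁻ x, ‖f x‖ₑ ^ 2 ∂μ ≠ ∞ := by
  rw [MemLp, and_iff_right hf,
    eLpNorm_lt_top_iff_lintegral_rpow_enorm_lt_top (by norm_num) (by norm_num), lt_top_iff_ne_top]
  simp

theorem enorm_toLp_sq {α E : Type*} [MeasurableSpace α] {μ : Measure α} [NormedAddCommGroup E]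
    {f : α → E} (hf : MemLp f 2 μ) : ‖hf.toLp f‖ₑ ^ 2 = ∫⁻ x, ‖f x‖ₑ ^ 2 ∂μ := by
  rw [Lp.enorm_toLp, eLpNorm_eq_lintegral_rpow_enorm_toReal (by simp) (by simp),
    ← ENNReal.rpow_natCast _ 2, ← ENNReal.rpow_mul]
  simp

variable {Ω : Type*} [MeasurableSpace Ω] {P : Measure Ω} {φ : ℝ × ℝ → Ω → ℝ}

theorem exists_Lp_section (hφ : Measurable fun p : (ℝ × ℝ) × Ω => φ p.1 p.2)
    (hfin : ∫⁻ ω, ∫⁻ x, ‖φ x ω‖ₑ ^ 2 ∂quadrant ∂P ≠ ∞) :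
    ∃ Φ : Lp NoiseSpace 2 P, ∀ᵐ ω ∂P, Φ ω =ᵐ[quadrant] fun x => φ x ω := by
  have hsec (ω : Ω) : AEStronglyMeasurable (fun x => φ x ω) quadrant :=
    (hφ.comp measurable_prodMk_right).aestronglyMeasurable
  have hN : Measurable fun ω => ∫⁻ x, ‖φ x ω‖ₑ ^ 2 ∂quadrant :=
    (hφ.enorm.pow_const 2).lintegral_prod_left'
  classical
  set Φ : Ω → NoiseSpace := fun ω =>
    if h : MemLp (fun x => φ x ω) 2 quadrant then h.toLp else 0 with hΦ
  have hae : ∀ᵐ ω ∂P, MemLp (fun x => φ x ω) 2 quadrant := by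
    filter_upwards [ae_lt_top hN hfin] with ω hω
    exact (memLp_two_iff_lintegral (hsec ω)).2 hω.ne
  have hmeas : StronglyMeasurable Φ := by
    refine stronglyMeasurable_of_inner (S := univ)
      (by rw [Submodule.span_univ]; exact top_le_iff.1 (Submodule.le_topologicalClosure _)) fun g _ => ?_
    have e : (fun ω => inner ℝ (Φ ω) g) = fun ω =>
        if ∫⁻ x, ‖φ x ω‖ₑ ^ 2 ∂quadrant ≠ ∞ then ∫ x, φ x ω * g x ∂quadrant else 0 := by
      ext ω
      by_cases h : MemLp (fun x => φ x ω) 2 quadrant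
      · rw [if_pos ((memLp_two_iff_lintegral (hsec ω)).1 h)]
        simp only [hΦ, dif_pos h]
        rw [← integral_coeFn_mul]
        refine integral_congr_ae ?_
        filter_upwards [h.coeFn_toLp] with x hx
        rw [hx]
      · rw [if_neg fun h' => h ((memLp_two_iff_lintegral (hsec ω)).2 h')]
        simp only [hΦ, dif_neg h, inner_zero_left]
    rw [e]
    refine Measurable.ite (measurableSet_eq_fun hN measurable_const).compl ?_ measurable_const
    have hm : Measurable fun p : (ℝ × ℝ) × Ω => φ p.1 p.2 * g p.1 :=
      hφ.mul ((Lp.stronglyMeasurable g).measurable.comp measurable_fst)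
    exact hm.stronglyMeasurable.integral_prod_left'.measurable
  have hL : MemLp Φ 2 P := by
    rw [memLp_two_iff_lintegral hmeas.aestronglyMeasurable]
    refine ne_top_of_le_ne_top hfin (lintegral_mono_ae ?_)
    filter_upwards [hae] with ω hω
    simp only [hΦ, dif_pos hω]
    rw [enorm_toLp_sq]
  refine ⟨hL.toLp, ?_⟩
  filter_upwards [hae, hL.coeFn_toLp] with ω h1 h2
  rw [h2]
  simp only [hΦ, dif_pos h1]
  exact h1.coeFn_toLp

variable [SFinite P]

theorem memLp_prod_of_section (hφ : Measurable fun p : (ℝ × ℝ) × Ω => φ p.1 p.2)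
    {Φ : Lp NoiseSpace 2 P} (hΦ : ∀ᵐ ω ∂P, Φ ω =ᵐ[quadrant] fun x => φ x ω) :
    MemLp (fun p : (ℝ × ℝ) × Ω => φ p.1 p.2) 2 (quadrant.prod P) := by
  rw [memLp_two_iff_lintegral hφ.aestronglyMeasurable,
    lintegral_prod_symm' _ (hφ.enorm.pow_const 2)]
  have := (memLp_two_iff_lintegral (Lp.aestronglyMeasurable Φ)).1 (Lp.memLp Φ)
  convert this using 1
  refine lintegral_congr_ae ?_
  filter_upwards [hΦ] with ω hω
  have e : Φ ω = (Lp.memLp (Φ ω)).toLp (Φ ω) := (Lp.toLp_coeFn _ _).symm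
  rw [e, enorm_toLp_sq]
  refine lintegral_congr_ae ?_
  filter_upwards [hω] with x hx
  rw [hx]

/-- Fubini for the pairing of the Malliavin derivative with Φ. The target F covers both complex
exponentials and real powers of the noise. -/
theorem integral_inner_smul_of_section {F : Type*} [NormedAddCommGroup F] [NormedSpace ℝ F]
    [CompleteSpace F]
    (hφ : Measurable fun p : (ℝ × ℝ) × Ω => φ p.1 p.2)
    {Φ : Lp NoiseSpace 2 P} (hΦ : ∀ᵐ ω ∂P, Φ ω =ᵐ[quadrant] fun x => φ x ω) (g : NoiseSpace)
    {X : Ω → F} (hX : MemLp X 2 P) :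
    ∫ ω, inner ℝ g (Φ ω) • X ω ∂P = ∫ x, g x • ∫ ω, φ x ω • X ω ∂P ∂quadrant := by
  have h1 : MemLp (fun p : (ℝ × ℝ) × Ω => g p.1 • X p.2) 2 (quadrant.prod P) := by
    have hg := (Lp.aestronglyMeasurable g)
    refine (memLp_two_iff_lintegral (hg.comp_fst.smul hX.1.comp_snd)).2 ?_
    simp_rw [Pi.smul_apply', enorm_smul, mul_pow]
    rw [lintegral_prod_mul (hg.enorm.pow_const 2) (hX.1.enorm.pow_const 2)]
    exact ENNReal.mul_ne_top ((memLp_two_iff_lintegral hg).1 (Lp.memLp g))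
      ((memLp_two_iff_lintegral hX.1).1 hX)
  have h2 : Integrable (fun p : (ℝ × ℝ) × Ω => φ p.1 p.2 • (g p.1 • X p.2)) (quadrant.prod P) :=
    memLp_one_iff_integrable.1 (h1.smul (memLp_prod_of_section hφ hΦ))
  calc ∫ ω, inner ℝ g (Φ ω) • X ω ∂P
      = ∫ ω, ∫ x, φ x ω • (g x • X ω) ∂quadrant ∂P := by
        refine integral_congr_ae ?_
        filter_upwards [hΦ] with ω hω
        rw [← integral_coeFn_mul, ← integral_smul_const]
        refine integral_congr_ae ?_
        filter_upwards [hω] with x hx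
        rw [hx, smul_smul, mul_comm]
    _ = ∫ x, ∫ ω, φ x ω • (g x • X ω) ∂P ∂quadrant := by
        rw [← integral_prod_symm _ h2, integral_prod _ h2]
    _ = _ := by
        congr 1
        ext x
        rw [← integral_smul]
        congr 1
        ext ω
        rw [smul_comm]

end Sections

/-! ### The exponential transform of the mild equation -/

namespace IsWhiteNoise

variable {Ω : Type*} [MeasurableSpace Ω] {P : Measure Ω} [IsProbabilityMeasure P]
  {W : NoiseSpace → Ω → ℝ} (u₀ : Ioi (0 : ℝ) →ᵇ ℝ)

theorem expPairing_chaosSolution_eq (hW : IsWhiteNoise P W) (hgen : IsGeneratedBy P W)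
    {z : ℝ} (hz : 0 ≤ z) (t : ℝ) (h : NoiseSpace) (ζ : ℂ) :
    hW.expPairing h ζ (chaosSolution P W u₀ z t) =
      Complex.exp (ζ ^ 2 * ‖h‖ ^ 2 / 2) * (detSolution u₀ z t : ℂ) +
      ζ * ∫ y, (noiseKernel z t y * h y) • hW.expPairing h ζ (chaosSolution P W u₀ y.1 y.2)
        ∂quadrant := by
  set c := Complex.exp (ζ ^ 2 * ‖h‖ ^ 2 / 2) with hc
  have hKh : Integrable (fun y => noiseKernel z t y * h y) quadrant :=
    (memLp_noiseKernel hz t).integrable_mul (Lp.memLp h)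
  set a : ℕ → ℝ × ℝ → ℂ := fun n y => c * (ζ ^ n * (chaosPairing u₀ n y.1 y.2 h : ℂ)) with ha
  set r : ℝ := Real.sqrt (1 / 2)
  have hr1 : r < 1 := by
    rw [Real.sqrt_lt' one_pos]
    norm_num
  have hsr : Summable fun n => r ^ n := summable_geometric_of_lt_one (Real.sqrt_nonneg _) hr1
  set C : ℝ := ‖hW.expPairing h ζ‖ * ‖u₀‖ with hC
  -- A geometric bound uniform in y, allowing the series to be exchanged with the integral by
  -- dominated convergence.
  have ha_le (n : ℕ) {y : ℝ × ℝ} (hy : 0 ≤ y.1) : ‖a n y‖ ≤ C * r ^ n := by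
    have e := hW.expPairing_multipleIntegral hgen (memLp_chaosKernel u₀ n hy y.2)
      (fun x hx => (chaosKernel_ne_zero u₀ hx).1) h ζ
    change ‖c * (ζ ^ n * ((∫ x, chaosKernel u₀ n y.1 y.2 x * tensorPow n h x
      ∂(Measure.pi fun _ => quadrant) : ℝ) : ℂ))‖ ≤ _
    rw [hc, ← e, hC, mul_assoc]
    refine (ContinuousLinearMap.le_opNorm _ _).trans ?_
    gcongr
    exact hW.norm_multipleIntegral_chaosKernel_le u₀ hgen n hy y.2
  have hint : HasSum (fun n => ∫ y, (noiseKernel z t y * h y) • a n y ∂quadrant)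
      (∫ y, (noiseKernel z t y * h y) • hW.expPairing h ζ (chaosSolution P W u₀ y.1 y.2)
        ∂quadrant) := by
    refine hasSum_integral_of_dominated_convergence
      (fun n y => ‖noiseKernel z t y * h y‖ * (C * r ^ n)) (fun n => ?_) (fun n => ?_)
      (.of_forall fun y => (hsr.mul_left C).mul_left _) ?_ ?_
    · refine hKh.aestronglyMeasurable.smul (Measurable.aestronglyMeasurable ?_)
      exact ((Complex.measurable_ofReal.comp
        (measurable_chaosPairing u₀ n (Lp.stronglyMeasurable h).measurable)).const_mul _).const_mul _
    · filter_upwards [ae_quadrant_pos] with y hy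
      rw [norm_smul]
      gcongr
      exact ha_le n hy.1.le
    · simp_rw [tsum_mul_left]
      exact hKh.norm.mul_const _
    · filter_upwards [ae_quadrant_pos] with y hy
      exact (hW.hasSum_expPairing_chaosSolution u₀ hgen hy.1.le y.2 h ζ).const_smul _
  have hterm (n : ℕ) : ∫ y, (noiseKernel z t y * h y) • a n y ∂quadrant =
      c * (ζ ^ n * (chaosPairing u₀ (n + 1) z t h : ℂ)) := by
    rw [chaosPairing_succ u₀ n hz t (Lp.memLp h), ← integral_complex_ofReal, ← mul_assoc,
      ← integral_const_mul]
    congr 1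
    ext y
    simp only [ha, Complex.real_smul]
    push_cast
    ring
  simp_rw [hterm] at hint
  have h1 := hW.hasSum_expPairing_chaosSolution u₀ hgen hz t h ζ
  rw [← hasSum_nat_add_iff' 1] at h1
  have h3 := hint.mul_left ζ
  have e (n : ℕ) : ζ * (c * (ζ ^ n * (chaosPairing u₀ (n + 1) z t h : ℂ))) =
      c * (ζ ^ (n + 1) * (chaosPairing u₀ (n + 1) z t h : ℂ)) := by ring
  simp_rw [e] at h3
  rw [← h1.unique h3]
  simp [chaosPairing_zero, hc]

end IsWhiteNoise

/-! ### Integration by parts from characteristic functions -/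

section Schwartz

open scoped SchwartzMap FourierTransform LineDeriv

variable {Ω : Type*} [MeasurableSpace Ω] {P : Measure Ω}

section

variable [SFinite P] {E : Type*} [NormedAddCommGroup E] [InnerProductSpace ℝ E]
  [FiniteDimensional ℝ E] [MeasurableSpace E] [BorelSpace E]

/-- Fourier inversion for G followed by Fubini: expectations of Schwartz functions of V are
superpositions of expectations of characters. -/
theorem integral_smul_schwartzMap {Z : Ω → ℝ} (hZ : Integrable Z P) {V : Ω → E}
    (hV : Measurable V) (G : 𝓢(E, ℂ)) :
    Integrable (fun ξ => 𝓕 G ξ *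
      ∫ ω, Z ω • Complex.exp ((2 * Real.pi * inner ℝ ξ (V ω) : ℝ) * Complex.I) ∂P) ∧
    ∫ ω, Z ω • G (V ω) ∂P = ∫ ξ, 𝓕 G ξ *
      ∫ ω, Z ω • Complex.exp ((2 * Real.pi * inner ℝ ξ (V ω) : ℝ) * Complex.I) ∂P := by
  have hi : Integrable (fun p : Ω × E => Z p.1 •
      (Complex.exp ((2 * Real.pi * inner ℝ p.2 (V p.1) : ℝ) * Complex.I) • 𝓕 G p.2))
      (P.prod volume) := by
    have h0 : Integrable (fun p : Ω × E => Z p.1 • 𝓕 G p.2) (P.prod volume) :=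
      hZ.smul_prod (𝓕 G).integrable
    have hm : Measurable fun p : Ω × E =>
        Complex.exp ((2 * Real.pi * inner ℝ p.2 (V p.1) : ℝ) * Complex.I) := by
      have : Measurable fun p : Ω × E => (inner ℝ p.2 (V p.1) : ℝ) :=
        measurable_snd.inner (hV.comp measurable_fst)
      fun_prop
    have h1 := h0.bdd_mul (c := 1) hm.aestronglyMeasurable
      (.of_forall fun p => (Complex.norm_exp_ofReal_mul_I _).le)
    refine h1.congr (.of_forall fun p => ?_)
    simp only [smul_eq_mul, Complex.real_smul]
    ring
  have e (ξ : E) : ∫ ω, Z ω •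
      (Complex.exp ((2 * Real.pi * inner ℝ ξ (V ω) : ℝ) * Complex.I) • 𝓕 G ξ) ∂P = 𝓕 G ξ *
      ∫ ω, Z ω • Complex.exp ((2 * Real.pi * inner ℝ ξ (V ω) : ℝ) * Complex.I) ∂P := by
    rw [← integral_const_mul]
    congr 1
    ext ω
    simp only [smul_eq_mul, Complex.real_smul]
    ring
  refine ⟨by simpa only [e] using hi.integral_prod_right, ?_⟩
  simp_rw [← e]
  rw [← integral_prod_symm _ hi, integral_prod _ hi]
  congr 1
  ext ω
  refine Eq.trans ?_ (integral_smul (Z ω) fun ξ : E =>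
    Complex.exp ((2 * Real.pi * inner ℝ ξ (V ω) : ℝ) * Complex.I) • 𝓕 G ξ).symm
  congr 1
  have := congrArg (fun f : 𝓢(E, ℂ) => f (V ω)) 
    (FourierTransform.fourierInv_fourier_eq (F := 𝓢(E, ℂ)) G)
  rw [← this]
  simp only [SchwartzMap.fourierInv_coe, Real.fourierInv_eq']

end

namespace IsWhiteNoise

variable {W : NoiseSpace → Ω → ℝ} {Φ : Lp NoiseSpace 2 P} {Y : Lp ℝ 2 P}

/-- The random vector `(W(h₁), …, W(h_N))`. -/
def noiseVector (W : NoiseSpace → Ω → ℝ) {N : ℕ} (h : Fin N → NoiseSpace) (ω : Ω) :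
    EuclideanSpace ℝ (Fin N) := WithLp.toLp 2 fun j => W (h j) ω

theorem measurable_noiseVector (hW : IsWhiteNoise P W) {N : ℕ} (h : Fin N → NoiseSpace) :
    Measurable (noiseVector W h) :=
  (WithLp.measurable_toLp 2 _).comp (measurable_pi_lambda _ fun j => hW.measurable (h j))

theorem memLp_inner_left (g : NoiseSpace) (Φ : Lp NoiseSpace 2 P) :
    MemLp (fun ω => (inner ℝ g (Φ ω) : ℝ)) 2 P :=
  (Lp.memLp Φ).const_inner g

/-- On characters the integration by parts is the hypothesis for h = ∑ 2π ξⱼ hⱼ. The factor 2πi ξⱼ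
is also what differentiation along the j-th coordinate produces on the Fourier side. -/
theorem integral_smul_schwartzMap_noiseVector [IsProbabilityMeasure P] (hW : IsWhiteNoise P W)
    (hE : ∀ h, ∫ ω, Y ω • Complex.exp (W h ω * Complex.I) ∂P =
      Complex.I * ∫ ω, (inner ℝ h (Φ ω) : ℝ) • Complex.exp (W h ω * Complex.I) ∂P)
    {N : ℕ} (h : Fin N → NoiseSpace) (G : 𝓢(EuclideanSpace ℝ (Fin N), ℂ)) :
    ∫ ω, Y ω • G (noiseVector W h ω) ∂P = ∑ j, ∫ ω, (inner ℝ (h j) (Φ ω) : ℝ) •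
      (fderiv ℝ G (noiseVector W h ω) (EuclideanSpace.single j 1)) ∂P := by
  set V := noiseVector W h with hVdef
  have hV := hW.measurable_noiseVector h
  have hY : Integrable Y P := (Lp.memLp Y).integrable (by norm_num)
  have hZ (g : NoiseSpace) : Integrable (fun ω => (inner ℝ g (Φ ω) : ℝ)) P :=
    (memLp_inner_left g Φ).integrable (by norm_num)
  set k : EuclideanSpace ℝ (Fin N) → NoiseSpace := fun ξ => ∑ j, (2 * Real.pi * ξ j) • h j with hk
  have hkV (ξ : EuclideanSpace ℝ (Fin N)) :
      ∀ᵐ ω ∂P, 2 * Real.pi * inner ℝ ξ (V ω) = W (k ξ) ω := by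
    filter_upwards [hW.map_sum Finset.univ (fun j => 2 * Real.pi * ξ j) h] with ω hω
    rw [hω, PiLp.inner_apply, Finset.mul_sum]
    refine Finset.sum_congr rfl fun j _ => ?_
    simp [V, noiseVector]
    ring
  set e : EuclideanSpace ℝ (Fin N) → Ω → ℂ := fun ξ ω =>
    Complex.exp ((2 * Real.pi * inner ℝ ξ (V ω) : ℝ) * Complex.I) with he
  have key (ξ : EuclideanSpace ℝ (Fin N)) : ∫ ω, Y ω • e ξ ω ∂P =
      ∑ j, (2 * Real.pi * Complex.I * ξ j) * ∫ ω, (inner ℝ (h j) (Φ ω) : ℝ) • e ξ ω ∂P := by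
    have e1 : ∀ᵐ ω ∂P, e ξ ω = Complex.exp (W (k ξ) ω * Complex.I) := by
      filter_upwards [hkV ξ] with ω hω
      rw [he, ← hω]
    rw [integral_congr_ae (g := fun ω => Y ω • Complex.exp (W (k ξ) ω * Complex.I)) (by
      filter_upwards [e1] with ω hω
      rw [hω]), hE, integral_congr_ae (g := fun ω => ∑ j, ((2 * Real.pi * ξ j : ℝ) : ℂ) *
        ((inner ℝ (h j) (Φ ω) : ℝ) • e ξ ω)) (by
      filter_upwards [e1] with ω hω
      rw [← hω, hk, sum_inner, Finset.sum_smul]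
      refine Finset.sum_congr rfl fun j _ => ?_
      rw [real_inner_smul_left, mul_smul, Complex.real_smul]), integral_finsetSum, Finset.mul_sum]
    · refine Finset.sum_congr rfl fun j _ => ?_
      rw [integral_const_mul]
      push_cast
      ring
    · intro j _
      refine Integrable.const_mul ?_ _
      refine (hZ (h j)).smul_bdd (C := 1) ?_ (.of_forall fun ω =>
        (Complex.norm_exp_ofReal_mul_I _).le)
      have : Measurable fun ω => (inner ℝ ξ (V ω) : ℝ) := measurable_const.inner hV
      exact Measurable.aestronglyMeasurable (by fun_prop)
  have hfour (j : Fin N) (ξ : EuclideanSpace ℝ (Fin N)) :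
      𝓕 (∂_{EuclideanSpace.single j (1 : ℝ)} G) ξ = 2 * Real.pi * Complex.I * ξ j * 𝓕 G ξ := by
    have ht : (fun x : EuclideanSpace ℝ (Fin N) =>
        inner ℝ x (EuclideanSpace.single j (1 : ℝ))).HasTemperateGrowth := by fun_prop
    rw [SchwartzMap.fourier_lineDerivOp_eq]
    rw [_root_.smul_apply, SchwartzMap.smulLeftCLM_apply_apply ht,
      EuclideanSpace.inner_single_right]
    simp
    ring
  rw [(integral_smul_schwartzMap hY hV G).2]
  simp_rw [← SchwartzMap.lineDerivOp_apply_eq_fderiv]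
  have hj (j : Fin N) := integral_smul_schwartzMap (hZ (h j)) hV
    (∂_{EuclideanSpace.single j (1 : ℝ)} G)
  rw [Finset.sum_congr rfl fun j _ => (hj j).2, ← integral_finsetSum _ fun j _ => (hj j).1]
  congr 1
  ext ξ
  rw [key ξ, Finset.mul_sum]
  refine Finset.sum_congr rfl fun j _ => ?_
  rw [hfour]
  ring

theorem integral_mul_noiseVector [IsProbabilityMeasure P] (hW : IsWhiteNoise P W)
    (hE : ∀ h, ∫ ω, Y ω • Complex.exp (W h ω * Complex.I) ∂P =
      Complex.I * ∫ ω, (inner ℝ h (Φ ω) : ℝ) • Complex.exp (W h ω * Complex.I) ∂P)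
    {N : ℕ} (h : Fin N → NoiseSpace) {F : EuclideanSpace ℝ (Fin N) → ℝ}
    (hF : ContDiff ℝ (⊤ : ℕ∞) F) (hc : HasCompactSupport F) :
    ∫ ω, Y ω * F (noiseVector W h ω) ∂P = ∫ ω, ∑ j, inner ℝ (h j) (Φ ω) *
      fderiv ℝ F (noiseVector W h ω) (EuclideanSpace.single j 1) ∂P := by
  have hc' : HasCompactSupport fun x => (F x : ℂ) := hc.comp_left (g := fun r : ℝ => (r : ℂ)) rfl
  have hF' : ContDiff ℝ (⊤ : ℕ∞) fun x => (F x : ℂ) := Complex.ofRealCLM.contDiff.comp hF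
  have h1 := hW.integral_smul_schwartzMap_noiseVector hE h (hc'.toSchwartzMap hF')
  have hd (x v : EuclideanSpace ℝ (Fin N)) :
      fderiv ℝ (fun x => (F x : ℂ)) x v = (fderiv ℝ F x v : ℝ) := by
    have := (Complex.ofRealCLM.hasFDerivAt (x := F x)).comp x
      (hF.differentiable (by simp) x).hasFDerivAt
    have e := this.fderiv
    change fderiv ℝ (fun x => (F x : ℂ)) x = _ at e
    rw [e]
    rfl
  have hcoe : ⇑(hc'.toSchwartzMap hF') = fun x => (F x : ℂ) := rfl
  have hi (j : Fin N) : Integrable (fun ω => inner ℝ (h j) (Φ ω) *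
      fderiv ℝ F (noiseVector W h ω) (EuclideanSpace.single j 1)) P := by
    have hcont : Continuous fun x => fderiv ℝ F x (EuclideanSpace.single j 1) :=
      (hF.continuous_fderiv (by simp)).clm_apply continuous_const
    obtain ⟨C, hC⟩ := (hc.fderiv_apply (𝕜 := ℝ) (EuclideanSpace.single j (1 : ℝ))
      ).exists_bound_of_continuous hcont
    exact ((memLp_inner_left (h j) Φ).integrable (by norm_num)).mul_bdd (c := C)
      (hcont.measurable.comp (hW.measurable_noiseVector h)).aestronglyMeasurable
      (.of_forall fun ω => hC _)
  rw [integral_finsetSum _ fun j _ => hi j]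
  apply Complex.ofReal_injective
  rw [Complex.ofReal_sum]
  simp_rw [← integral_complex_ofReal]
  simp only [hcoe, hd, Complex.real_smul] at h1
  push_cast
  exact h1

/-- F is cut off by χ(rₙ x) with rₙ = 1/(n+1). The derivative of the cutoff carries the factor rₙ
and disappears in the limit; square integrability of X and DX gives domination, so no growth
condition on F is used. -/
theorem integral_mul_eq_of_smooth [IsProbabilityMeasure P] (hW : IsWhiteNoise P W)
    (hE : ∀ h, ∫ ω, Y ω • Complex.exp (W h ω * Complex.I) ∂P =
      Complex.I * ∫ ω, (inner ℝ h (Φ ω) : ℝ) • Complex.exp (W h ω * Complex.I) ∂P)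
    {N : ℕ} (h : Fin N → NoiseSpace) {F : EuclideanSpace ℝ (Fin N) → ℝ}
    (hF : ContDiff ℝ (⊤ : ℕ∞) F) {X : Lp ℝ 2 P} {DX : Lp NoiseSpace 2 P}
    (hX : X =ᵐ[P] fun ω => F (noiseVector W h ω))
    (hDX : DX =ᵐ[P] fun ω =>
      ∑ j, fderiv ℝ F (noiseVector W h ω) (EuclideanSpace.single j 1) • h j) :
    ∫ ω, Y ω * X ω ∂P = ∫ ω, inner ℝ (DX ω) (Φ ω) ∂P := by
  set V := noiseVector W h with hVdef
  have hV := hW.measurable_noiseVector h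
  let χ : ContDiffBump (0 : EuclideanSpace ℝ (Fin N)) := ⟨1, 2, one_pos, one_lt_two⟩
  set r : ℕ → ℝ := fun n => ((n : ℝ) + 1)⁻¹
  have hr0 (n : ℕ) : 0 < r n := by positivity
  have hr1 (n : ℕ) : r n ≤ 1 := inv_le_one_of_one_le₀ (by linarith [(Nat.cast_nonneg n : (0:ℝ) ≤ n)])
  have hrlim : Filter.Tendsto r Filter.atTop (nhds 0) := by
    simpa [r, one_div] using tendsto_one_div_add_atTop_nhds_zero_nat (𝕜 := ℝ)
  have hχd : ContDiff ℝ (⊤ : ℕ∞) χ := χ.contDiff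
  obtain ⟨C, hC⟩ := (χ.hasCompactSupport.fderiv (𝕜 := ℝ)).exists_bound_of_continuous
    (hχd.continuous_fderiv (by simp))
  have hχev (x : EuclideanSpace ℝ (Fin N)) : ∀ᶠ n in Filter.atTop, χ (r n • x) = 1 := by
    have : Filter.Tendsto (fun n => r n * ‖x‖) Filter.atTop (nhds 0) := by
      simpa using hrlim.mul_const ‖x‖
    filter_upwards [this.eventually_le_const one_pos] with n hn
    refine χ.one_of_mem_closedBall ?_
    rw [mem_closedBall_zero_iff, norm_smul, Real.norm_of_nonneg (hr0 n).le]
    exact hn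
  set Fn : ℕ → EuclideanSpace ℝ (Fin N) → ℝ := fun n x => χ (r n • x) * F x with hFn
  have hFnd (n : ℕ) : ContDiff ℝ (⊤ : ℕ∞) (Fn n) :=
    (hχd.comp (contDiff_const_smul (r n))).mul hF
  have hFnc (n : ℕ) : HasCompactSupport (Fn n) :=
    (χ.hasCompactSupport.comp_smul (hr0 n).ne').mul_right
  have hder (n : ℕ) (x v : EuclideanSpace ℝ (Fin N)) : fderiv ℝ (Fn n) x v =
      χ (r n • x) * fderiv ℝ F x v + F x * (r n * fderiv ℝ χ (r n • x) v) := by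
    have h1 : HasFDerivAt (fun x => χ (r n • x))
        ((fderiv ℝ χ (r n • x)).comp (r n • ContinuousLinearMap.id ℝ _)) x :=
      (hχd.differentiable (by simp) (r n • x)).hasFDerivAt.comp x
        ((hasFDerivAt_id x).const_smul (r n))
    have h2 := h1.mul (hF.differentiable (by simp) x).hasFDerivAt
    have h3 : fderiv ℝ (Fn n) x = _ := h2.fderiv
    rw [h3]
    simp
  set T : Ω → ℝ := fun ω => inner ℝ (DX ω) (Φ ω)
  have hT : Integrable T P := L2.integrable_inner (𝕜 := ℝ) DX Φ
  have hTe : ∀ᵐ ω ∂P, T ω = ∑ j, inner ℝ (h j) (Φ ω) *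
      fderiv ℝ F (V ω) (EuclideanSpace.single j 1) := by
    filter_upwards [hDX] with ω hω
    simp only [T]
    rw [hω, sum_inner]
    refine Finset.sum_congr rfl fun j _ => ?_
    rw [real_inner_smul_left, mul_comm]
  have hYX : Integrable (fun ω => Y ω * X ω) P := (Lp.memLp Y).integrable_mul (Lp.memLp X)
  have hZX (j : Fin N) : Integrable (fun ω => |(X ω : ℝ)| * |(inner ℝ (h j) (Φ ω) : ℝ)|) P :=
    (Lp.memLp X).abs.integrable_mul (memLp_inner_left (h j) Φ).abs
  have hid (n : ℕ) : ∫ ω, χ (r n • V ω) * (Y ω * X ω) ∂P =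
      ∫ ω, (χ (r n • V ω) * T ω + X ω * (r n * ∑ j, inner ℝ (h j) (Φ ω) *
        fderiv ℝ χ (r n • V ω) (EuclideanSpace.single j 1))) ∂P := by
    refine Eq.trans ?_ ((hW.integral_mul_noiseVector hE h (hFnd n) (hFnc n)).trans ?_)
    · refine integral_congr_ae ?_
      filter_upwards [hX] with ω hω
      rw [hω]
      simp only [Fn]
      ring
    · refine integral_congr_ae ?_
      filter_upwards [hX, hTe] with ω h1 h2
      rw [h1, h2, Finset.mul_sum, Finset.mul_sum, Finset.mul_sum, ← Finset.sum_add_distrib]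
      refine Finset.sum_congr rfl fun j _ => ?_
      rw [hder]
      ring
  have hχm (n : ℕ) : Measurable fun ω => χ (r n • V ω) :=
    χ.continuous.measurable.comp (hV.const_smul (r n))
  have hL : Filter.Tendsto (fun n => ∫ ω, χ (r n • V ω) * (Y ω * X ω) ∂P) Filter.atTop
      (nhds (∫ ω, Y ω * X ω ∂P)) := by
    refine tendsto_integral_of_dominated_convergence (fun ω => ‖Y ω * X ω‖)
      (fun n => (hχm n).aestronglyMeasurable.mul hYX.1) hYX.norm (fun n => ?_) ?_
    · refine .of_forall fun ω => ?_
      rw [norm_mul, Real.norm_of_nonneg χ.nonneg]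
      exact mul_le_of_le_one_left (norm_nonneg _) χ.le_one
    · refine .of_forall fun ω => tendsto_const_nhds.congr' ?_
      filter_upwards [hχev (V ω)] with n hn
      rw [hn, one_mul]
  have hR : Filter.Tendsto (fun n => ∫ ω, (χ (r n • V ω) * T ω +
      X ω * (r n * ∑ j, inner ℝ (h j) (Φ ω) *
        fderiv ℝ χ (r n • V ω) (EuclideanSpace.single j 1))) ∂P) Filter.atTop
      (nhds (∫ ω, T ω ∂P)) := by
    have hsum (n : ℕ) (ω : Ω) : |∑ j, inner ℝ (h j) (Φ ω) *
        fderiv ℝ χ (r n • V ω) (EuclideanSpace.single j 1)| ≤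
        ∑ j, |(inner ℝ (h j) (Φ ω) : ℝ)| * C := by
      refine (Finset.abs_sum_le_sum_abs _ _).trans (Finset.sum_le_sum fun j _ => ?_)
      rw [abs_mul]
      gcongr
      refine ((fderiv ℝ χ (r n • V ω)).le_opNorm _).trans ?_
      simpa using hC (r n • V ω)
    refine tendsto_integral_of_dominated_convergence
      (fun ω => ‖T ω‖ + |X ω| * ∑ j, |(inner ℝ (h j) (Φ ω) : ℝ)| * C) (fun n => ?_) ?_
      (fun n => ?_) ?_
    · refine ((hχm n).aestronglyMeasurable.mul hT.1).add ((Lp.aestronglyMeasurable X).mul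
        (AEStronglyMeasurable.const_mul ?_ _))
      refine Finset.aestronglyMeasurable_fun_sum _ fun j _ => (memLp_inner_left (h j) Φ).1.mul ?_
      refine Measurable.aestronglyMeasurable ?_
      have : Continuous fun x => fderiv ℝ χ x (EuclideanSpace.single j 1) :=
        (hχd.continuous_fderiv (by simp)).clm_apply continuous_const
      exact this.measurable.comp (hV.const_smul (r n))
    · refine hT.norm.add ?_
      simp_rw [Finset.mul_sum, ← mul_assoc]
      exact integrable_finsetSum _ fun j _ => (hZX j).mul_const C
    · refine .of_forall fun ω => (norm_add_le _ _).trans (add_le_add ?_ ?_)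
      · rw [norm_mul, Real.norm_of_nonneg χ.nonneg]
        exact mul_le_of_le_one_left (norm_nonneg _) χ.le_one
      · rw [norm_mul, norm_mul, Real.norm_of_nonneg (hr0 n).le]
        refine mul_le_mul_of_nonneg_left ?_ (norm_nonneg _)
        exact (mul_le_of_le_one_left (norm_nonneg _) (hr1 n)).trans (hsum n ω)
    · refine .of_forall fun ω => ?_
      have h1 : Filter.Tendsto (fun n => χ (r n • V ω) * T ω) Filter.atTop (nhds (T ω)) := by
        refine tendsto_const_nhds.congr' ?_
        filter_upwards [hχev (V ω)] with n hn
        rw [hn, one_mul]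
      have h2 : Filter.Tendsto (fun n => r n * ∑ j, inner ℝ (h j) (Φ ω) *
          fderiv ℝ χ (r n • V ω) (EuclideanSpace.single j 1)) Filter.atTop (nhds 0) :=
        hrlim.zero_mul_isBoundedUnder_le ⟨∑ j, |(inner ℝ (h j) (Φ ω) : ℝ)| * C,
          Filter.eventually_map.2 (.of_forall fun n => hsum n ω)⟩
      simpa using h1.add (h2.const_mul (X ω))
  exact tendsto_nhds_unique hL (hR.congr fun n => (hid n).symm)

/-- The duality relation is closed in the pair (X, DX), so it extends from smooth random variables
to the whole Malliavin graph. -/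
theorem isSkorohodIntegral_of_integral_exp [IsProbabilityMeasure P] (hW : IsWhiteNoise P W)
    (hE : ∀ h, ∫ ω, Y ω • Complex.exp (W h ω * Complex.I) ∂P =
      Complex.I * ∫ ω, (inner ℝ h (Φ ω) : ℝ) • Complex.exp (W h ω * Complex.I) ∂P) :
    IsSkorohodIntegral P W Φ Y := by
  have hinner (p : Lp ℝ 2 P × Lp NoiseSpace 2 P) :
      (∫ ω, Y ω * p.1 ω ∂P = ∫ ω, inner ℝ (p.2 ω) (Φ ω) ∂P) ↔
        inner ℝ p.1 Y = (inner ℝ p.2 Φ : ℝ) := by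
    rw [L2.inner_def, L2.inner_def]
    rfl
  suffices H : malliavinGraph P W ⊆ {p | inner ℝ p.1 Y = (inner ℝ p.2 Φ : ℝ)} from
    fun p hp => (hinner p).2 (H hp)
  refine closure_minimal ?_ (isClosed_eq (by fun_prop) (by fun_prop))
  rintro p ⟨N, F, h, hF, h1, h2⟩
  refine (hinner p).1 ?_
  let L := EuclideanSpace.equiv (Fin N) ℝ
  have hd (x v : EuclideanSpace ℝ (Fin N)) :
      fderiv ℝ (fun x => F (L x)) x v = fderiv ℝ F (L x) (L v) := by
    have := ((hF.1.differentiable (by simp) (L x)).hasFDerivAt.comp x L.hasFDerivAt).fderiv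
    change fderiv ℝ (fun x => F (L x)) x = _ at this
    rw [this]
    rfl
  refine hW.integral_mul_eq_of_smooth hE h (F := fun x => F (L x))
    (hF.1.comp L.contDiff) h1 (h2.trans (.of_forall fun ω => ?_))
  simp only [hd]
  refine Finset.sum_congr rfl fun j _ => ?_
  congr 2

end IsWhiteNoise

end Schwartz

namespace IsWhiteNoise

variable {Ω : Type*} [MeasurableSpace Ω] {P : Measure Ω} {W : NoiseSpace → Ω → ℝ}
  {u₀ : Ioi (0 : ℝ) →ᵇ ℝ}

/-! ### Moments against the noise -/

theorem expPairing_wickExp_zero (hW : IsWhiteNoise P W) (h : NoiseSpace) (ζ : ℂ) :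
    hW.expPairing h ζ (hW.wickExp 0) = Complex.exp (ζ ^ 2 * ‖h‖ ^ 2 / 2) := by
  rw [expPairing_apply, ← hW.integral_cexp_mul]
  refine integral_congr_ae ?_
  filter_upwards [hW.coeFn_wickExp_zero] with ω hω
  simp [hω]

theorem memLp_pow (hW : IsWhiteNoise P W) (h : NoiseSpace) (n : ℕ) :
    MemLp (fun ω => W h ω ^ n) 2 P := by
  simpa using hW.memLp_prod fun _ : Fin n => h

theorem ae_eq_of_hasBoundaryValues {u v : ℝ → ℝ → Ω → ℝ}
    (huv : ∀ z t, 0 < z → 0 < t → u z t =ᵐ[P] v z t) (hu : HasBoundaryValues P u₀ u)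
    (hv : HasBoundaryValues P u₀ v) {z t : ℝ} (hz : 0 ≤ z) (ht : 0 ≤ t) (hne : (z, t) ≠ (0, 0)) :
    u z t =ᵐ[P] v z t := by
  rcases hz.eq_or_lt with rfl | hz
  · have ht' : 0 < t := ht.lt_of_ne fun h => hne (by rw [h])
    exact (hu.2 t ht').trans (hv.2 t ht').symm
  · rcases ht.eq_or_lt with rfl | ht
    · exact (hu.1 ⟨z, hz⟩).trans (hv.1 ⟨z, hz⟩).symm
    · exact huv z t hz ht

/-- `(W(h) ^ n, n W(h) ^ (n - 1) h)` belongs to the graph of the Malliavin derivative. -/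
theorem exists_mem_malliavinGraph_pow (hW : IsWhiteNoise P W) (h : NoiseSpace) (n : ℕ) :
    ∃ p ∈ malliavinGraph P W, (p.1 =ᵐ[P] fun ω => W h ω ^ n) ∧
      p.2 =ᵐ[P] fun ω => (n * W h ω ^ (n - 1) : ℝ) • h := by
  have hD : MemLp (fun ω => (n * W h ω ^ (n - 1) : ℝ) • h) 2 P :=
    (ContinuousLinearMap.toSpanSingleton ℝ h).comp_memLp' ((hW.memLp_pow h (n - 1)).const_mul n)
  refine ⟨((hW.memLp_pow h n).toLp, hD.toLp), subset_closure ?_, (hW.memLp_pow h n).coeFn_toLp,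
    hD.coeFn_toLp⟩
  refine ⟨1, fun x => x 0 ^ n, fun _ => h,
    (ContinuousLinearMap.proj (R := ℝ) (φ := fun _ : Fin 1 => ℝ) 0).hasTemperateGrowth.pow n,
    (hW.memLp_pow h n).coeFn_toLp, hD.coeFn_toLp.trans (.of_forall fun ω => ?_)⟩
  have hd (x : Fin 1 → ℝ) := ((ContinuousLinearMap.proj (R := ℝ) (φ := fun _ : Fin 1 => ℝ)
    0).hasFDerivAt (x := x)).pow n
  have hd' (x : Fin 1 → ℝ) : fderiv ℝ (fun x : Fin 1 → ℝ => x 0 ^ n) x = _ := (hd x).fderiv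
  simp [hd']

/-- The exponential is expanded in powers under the expectation, dominated by |X| exp|W(h)|. Powers
are the convenient tests for uniqueness because, unlike exp, they have temperate growth. -/
theorem eq_zero_of_integral_mul_pow (hW : IsWhiteNoise P W) (hgen : IsGeneratedBy P W)
    {X : Lp ℝ 2 P} (hX : ∀ h n, ∫ ω, X ω * W h ω ^ n ∂P = 0) : X = 0 := by
  refine hW.eq_zero_of_integral_mul_exp hgen X fun h => ?_
  have hXi (n : ℕ) : Integrable (fun ω => X ω * W h ω ^ n) P :=
    (Lp.memLp X).integrable_mul (hW.memLp_pow h n)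
  have habs : Integrable (fun ω => |X ω| * Real.exp |W h ω|) P := by
    have hm := hW.measurable h
    refine (Lp.memLp X).abs.integrable_mul (MemLp.of_le
      ((hW.memLp_exp_mul h 1).add (hW.memLp_exp_mul h (-1)))
      (Measurable.aestronglyMeasurable (by fun_prop)) (.of_forall fun ω => ?_))
    rw [Real.norm_of_nonneg (Real.exp_pos _).le, Pi.add_apply,
      Real.norm_of_nonneg (add_pos (Real.exp_pos _) (Real.exp_pos _)).le]
    have h1 := Real.exp_pos (W h ω)
    have h2 := Real.exp_pos (-W h ω)
    rcases abs_cases (W h ω) with ⟨e, -⟩ | ⟨e, -⟩ <;> rw [e] <;> simp <;> linarith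
  have hs : HasSum (fun n => ∫ ω, X ω * (W h ω ^ n / (n.factorial : ℝ)) ∂P)
      (∫ ω, X ω * Real.exp (W h ω) ∂P) := by
    refine hasSum_integral_of_dominated_convergence
      (fun n ω => |X ω| * (|W h ω| ^ n / (n.factorial : ℝ))) (fun n => ?_) (fun n => ?_)
      (.of_forall fun ω => ((hasSum_pow_div_factorial |W h ω|).mul_left |X ω|).summable) ?_
      (.of_forall fun ω => (hasSum_pow_div_factorial (W h ω)).mul_left (X ω))
    · exact (Lp.aestronglyMeasurable X).mul
        (((hW.measurable h).pow_const n).div_const _).aestronglyMeasurable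
    · refine .of_forall fun ω => le_of_eq ?_
      rw [norm_mul, norm_div, norm_pow, Real.norm_natCast]
      rfl
    · refine habs.congr (.of_forall fun ω => ?_)
      exact ((hasSum_pow_div_factorial |W h ω|).mul_left |X ω|).tsum_eq.symm
  have h0 (n : ℕ) : ∫ ω, X ω * (W h ω ^ n / (n.factorial : ℝ)) ∂P = 0 := by
    simp_rw [mul_div_assoc', integral_div, hX, zero_div]
  simp_rw [h0] at hs
  exact hs.unique hasSum_zero

variable [IsProbabilityMeasure P]

/-! ### The chaos series is a mild solution -/

theorem isMildSolution_chaosSolution (hW : IsWhiteNoise P W) (hgen : IsGeneratedBy P W) :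
    IsMildSolution P W u₀ (fun z t => chaosSolution P W u₀ z t) := by
  obtain ⟨v, hv, hvu⟩ := hW.exists_measurable_chaosSolution u₀ hgen
  refine ⟨fun z t _ _ => Lp.memLp _, fun z t ω => v (z, t) ω, ?_, fun z t hz _ => hvu (z, t) hz, ?_⟩
  · exact hv.comp (f := fun p : ℝ × ℝ × Ω => ((p.1, p.2.1), p.2.2)) (by fun_prop)
  intro z t hz ht
  set φ : ℝ × ℝ → Ω → ℝ := fun x ω => noiseKernel z t x * v x ω with hφdef
  have hφ : Measurable fun p : (ℝ × ℝ) × Ω => φ p.1 p.2 :=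
    ((measurable_noiseKernel z t).comp measurable_fst).mul hv
  have hfin : ∫⁻ ω, ∫⁻ x, ‖φ x ω‖ₑ ^ 2 ∂quadrant ∂P ≠ ∞ := by
    rw [lintegral_lintegral_swap (f := fun ω x => ‖φ x ω‖ₑ ^ 2)
      ((hφ.enorm.pow_const 2).comp measurable_swap).aemeasurable]
    have hle : ∀ᵐ x ∂quadrant, ∫⁻ ω, ‖φ x ω‖ₑ ^ 2 ∂P ≤
        ‖noiseKernel z t x‖ₑ ^ 2 * ENNReal.ofReal (2 * ‖u₀‖ ^ 2) := by
      filter_upwards [ae_quadrant_pos] with x hx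
      simp_rw [hφdef, enorm_mul, mul_pow]
      rw [lintegral_const_mul' _ _ (by simp)]
      refine mul_le_mul_right ?_ _
      have e : ∫⁻ ω, ‖v x ω‖ₑ ^ 2 ∂P = ‖chaosSolution P W u₀ x.1 x.2‖ₑ ^ 2 := by
        conv_rhs => rw [← Lp.toLp_coeFn (chaosSolution P W u₀ x.1 x.2) (Lp.memLp _)]
        rw [enorm_toLp_sq]
        refine lintegral_congr_ae ?_
        filter_upwards [hvu x hx.1.le] with ω hω
        rw [hω]
      rw [e, ← ofReal_norm, ← ENNReal.ofReal_pow (norm_nonneg _)]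
      exact ENNReal.ofReal_le_ofReal (hW.norm_sq_chaosSolution_le u₀ hgen hx.1.le x.2)
    refine ne_top_of_le_ne_top ?_ (lintegral_mono_ae hle)
    rw [lintegral_mul_const' _ _ ENNReal.ofReal_ne_top]
    exact ENNReal.mul_ne_top (ne_top_of_le_ne_top (by simp) (lintegral_sq_noiseKernel_le hz.le t))
      ENNReal.ofReal_ne_top
  obtain ⟨Φ, hΦ⟩ := exists_Lp_section hφ hfin
  -- The Skorohod integral must be the solution minus its deterministic part; `wickExp 0` is the
  -- constant 1.
  refine ⟨Φ, chaosSolution P W u₀ z t - detSolution u₀ z t • hW.wickExp 0, ?_, ?_, ?_⟩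
  · filter_upwards [hΦ] with ω hω
    refine hω.trans (.of_forall fun x => ?_)
    exact (indicator_kernel_mul z t x fun τ => v (x.1, τ) ω).symm
  · refine hW.isSkorohodIntegral_of_integral_exp fun h => ?_
    have hexp : MemLp (fun ω => Complex.exp (W h ω * Complex.I)) 2 P := by
      simpa only [mul_comm] using hW.memLp_cexp_mul h Complex.I
    have hpair (Z : Lp ℝ 2 P) : ∫ ω, Z ω • Complex.exp (W h ω * Complex.I) ∂P =
        hW.expPairing h Complex.I Z := by
      rw [expPairing_apply]
      simp only [Complex.real_smul, mul_comm Complex.I]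
    rw [hpair, map_sub, _root_.map_smul, expPairing_wickExp_zero,
      hW.expPairing_chaosSolution_eq u₀ hgen hz.le t h Complex.I, Complex.real_smul,
      integral_inner_smul_of_section hφ hΦ h hexp, mul_comm (detSolution u₀ z t : ℂ),
      add_sub_cancel_left]
    congr 1
    refine integral_congr_ae ?_
    filter_upwards [ae_quadrant_pos] with x hx
    rw [← hpair, mul_smul, smul_comm, ← integral_smul]
    congr 1
    refine integral_congr_ae ?_
    filter_upwards [hvu x hx.1.le] with ω hω
    rw [hφdef, mul_smul, ← hω]
  · filter_upwards [Lp.coeFn_sub (chaosSolution P W u₀ z t) (detSolution u₀ z t • hW.wickExp 0),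
      Lp.coeFn_smul (detSolution u₀ z t) (hW.wickExp 0), hW.coeFn_wickExp_zero] with ω h1 h2 h3
    rw [h1, Pi.sub_apply, h2, Pi.smul_apply, h3]
    simp

/-! ### Uniqueness -/

/-- The Skorohod duality tested against W(h)ⁿ lowers the exponent by one. At n = 0 the truncated `n
- 1` is harmless, since the factor n vanishes. -/
theorem integral_mul_pow_eq (hW : IsWhiteNoise P W) {z t : ℝ} {u : Ω → ℝ} {v : ℝ → ℝ → Ω → ℝ}
    (hv : Measurable fun p : ℝ × ℝ × Ω => v p.1 p.2.1 p.2.2) {Φ : Lp NoiseSpace 2 P}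
    {Y : Lp ℝ 2 P}
    (hΦ : ∀ᵐ ω ∂P, Φ ω =ᵐ[quadrant] fun x : ℝ × ℝ =>
      (Ioo 0 t).indicator (fun τ => kimuraKernel z x.1 (t - τ) * v x.1 τ ω) x.2)
    (hY : IsSkorohodIntegral P W Φ Y) (hu : u =ᵐ[P] fun ω => detSolution u₀ z t + Y ω)
    (h : NoiseSpace) (n : ℕ) :
    ∫ ω, u ω * W h ω ^ n ∂P = detSolution u₀ z t * ∫ ω, W h ω ^ n ∂P +
      ∫ x, h x * (noiseKernel z t x *
        (n * ∫ ω, v x.1 x.2 ω * W h ω ^ (n - 1) ∂P)) ∂quadrant := by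
  set φ : ℝ × ℝ → Ω → ℝ := fun x ω => noiseKernel z t x * v x.1 x.2 ω with hφdef
  have hφ : Measurable fun p : (ℝ × ℝ) × Ω => φ p.1 p.2 :=
    ((measurable_noiseKernel z t).comp measurable_fst).mul
      (hv.comp (f := fun p : (ℝ × ℝ) × Ω => (p.1.1, p.1.2, p.2)) (by fun_prop))
  have hΦ' : ∀ᵐ ω ∂P, Φ ω =ᵐ[quadrant] fun x => φ x ω := by
    filter_upwards [hΦ] with ω hω
    exact hω.trans (.of_forall fun x => indicator_kernel_mul z t x fun τ => v x.1 τ ω)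
  obtain ⟨p, hp, hp1, hp2⟩ := hW.exists_mem_malliavinGraph_pow h n
  have hS := hY p hp
  have hYi : Integrable (fun ω => Y ω * W h ω ^ n) P :=
    (Lp.memLp Y).integrable_mul (hW.memLp_pow h n)
  have hWi : Integrable (fun ω => W h ω ^ n) P := (hW.memLp_pow h n).integrable (by norm_num)
  calc ∫ ω, u ω * W h ω ^ n ∂P
      = ∫ ω, (detSolution u₀ z t * W h ω ^ n + Y ω * W h ω ^ n) ∂P := by
        refine integral_congr_ae ?_
        filter_upwards [hu] with ω hω
        rw [hω, add_mul]
    _ = detSolution u₀ z t * ∫ ω, W h ω ^ n ∂P + ∫ ω, Y ω * p.1 ω ∂P := by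
        rw [integral_add (hWi.const_mul _) hYi, integral_const_mul]
        congr 1
        refine integral_congr_ae ?_
        filter_upwards [hp1] with ω hω
        rw [hω]
    _ = detSolution u₀ z t * ∫ ω, W h ω ^ n ∂P +
        ∫ ω, inner ℝ h (Φ ω) • (n * W h ω ^ (n - 1) : ℝ) ∂P := by
        rw [hS]
        congr 1
        refine integral_congr_ae ?_
        filter_upwards [hp2] with ω hω
        rw [hω, real_inner_smul_left, smul_eq_mul, mul_comm]
    _ = _ := by
        rw [integral_inner_smul_of_section hφ hΦ' h ((hW.memLp_pow h (n - 1)).const_mul (n : ℝ))]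
        congr 1
        refine integral_congr_ae (.of_forall fun x => ?_)
        dsimp only
        rw [smul_eq_mul]
        congr 1
        rw [← integral_const_mul, ← integral_const_mul]
        refine integral_congr_ae (ae_of_all _ fun ω => ?_)
        simp only [hφdef, smul_eq_mul]
        ring

/-- Induction on n at all points (z, t) simultaneously, because the right-hand side of the moment
recursion integrates over the whole past. No Gronwall argument is needed. -/
theorem integral_mul_pow_eq_of_isMildSolution (hW : IsWhiteNoise P W) {u v : ℝ → ℝ → Ω → ℝ}
    (hu : IsMildSolution P W u₀ u) (hv : IsMildSolution P W u₀ v) (h : NoiseSpace) (n : ℕ)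
    {z t : ℝ} (hz : 0 < z) (ht : 0 < t) :
    ∫ ω, u z t ω * W h ω ^ n ∂P = ∫ ω, v z t ω * W h ω ^ n ∂P := by
  obtain ⟨-, u', hum, huu, hus⟩ := hu
  obtain ⟨-, v', hvm, hvv, hvs⟩ := hv
  induction n generalizing z t with
  | zero =>
    obtain ⟨Φ, Y, h1, h2, h3⟩ := hus z t hz ht
    obtain ⟨Φ', Y', h1', h2', h3'⟩ := hvs z t hz ht
    rw [hW.integral_mul_pow_eq hum h1 h2 h3, hW.integral_mul_pow_eq hvm h1' h2' h3']
    simp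
  | succ n ih =>
    obtain ⟨Φ, Y, h1, h2, h3⟩ := hus z t hz ht
    obtain ⟨Φ', Y', h1', h2', h3'⟩ := hvs z t hz ht
    rw [hW.integral_mul_pow_eq hum h1 h2 h3, hW.integral_mul_pow_eq hvm h1' h2' h3']
    congr 1
    refine integral_congr_ae ?_
    filter_upwards [ae_quadrant_pos] with x hx
    have e : ∫ ω, u' x.1 x.2 ω * W h ω ^ n ∂P = ∫ ω, v' x.1 x.2 ω * W h ω ^ n ∂P := by
      rw [integral_congr_ae (g := fun ω => u x.1 x.2 ω * W h ω ^ n) (by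
        filter_upwards [huu x.1 x.2 hx.1.le hx.2.le] with ω hω
        rw [hω]), ih hx.1 hx.2]
      refine integral_congr_ae ?_
      filter_upwards [hvv x.1 x.2 hx.1.le hx.2.le] with ω hω
      rw [hω]
    rw [Nat.add_sub_cancel, e]

theorem ae_eq_of_isMildSolution (hW : IsWhiteNoise P W) (hgen : IsGeneratedBy P W)
    {u v : ℝ → ℝ → Ω → ℝ} (hu : IsMildSolution P W u₀ u) (hv : IsMildSolution P W u₀ v)
    {z t : ℝ} (hz : 0 < z) (ht : 0 < t) : u z t =ᵐ[P] v z t := by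
  have hu2 := hu.1 z t hz.le ht.le
  have hv2 := hv.1 z t hz.le ht.le
  have h0 : hu2.toLp - hv2.toLp = 0 := by
    refine hW.eq_zero_of_integral_mul_pow hgen fun h n => ?_
    have hui : Integrable (fun ω => u z t ω * W h ω ^ n) P := hu2.integrable_mul (hW.memLp_pow h n)
    have hvi : Integrable (fun ω => v z t ω * W h ω ^ n) P := hv2.integrable_mul (hW.memLp_pow h n)
    rw [← sub_eq_zero.2 (hW.integral_mul_pow_eq_of_isMildSolution hu hv h n hz ht),
      ← integral_sub hui hvi]
    refine integral_congr_ae ?_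
    filter_upwards [Lp.coeFn_sub hu2.toLp hv2.toLp, hu2.coeFn_toLp, hv2.coeFn_toLp]
      with ω h1 h2 h3
    rw [h1, Pi.sub_apply, h2, h3, sub_mul]
  exact (MemLp.toLp_eq_toLp_iff hu2 hv2).1 (sub_eq_zero.1 h0)

end IsWhiteNoise

end StochasticKimura

end

theorem mainTheorem1 {Ω : Type*} [MeasurableSpace Ω] (P : Measure Ω) [IsProbabilityMeasure P]
    (W : NoiseSpace → Ω → ℝ) (hW : IsWhiteNoise P W) (hgen : IsGeneratedBy P W)
    (u₀ : Ioi (0 : ℝ) →ᵇ ℝ) :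
    -- the kernels are square integrable and the chaos series converges in `L²(Ω)`
    (∀ z t : ℝ, 0 ≤ z → 0 ≤ t →
      (∀ n : ℕ, MemLp (chaosKernel u₀ n z t) 2 (Measure.pi fun _ : Fin n => quadrant)) ∧
      Summable (fun n : ℕ => multipleIntegral P W n (chaosKernel u₀ n z t))) ∧
    -- uniform second moment bound
    (∀ z t : ℝ, 0 ≤ z → 0 ≤ t →
      ∫ ω, (chaosSolution P W u₀ z t ω) ^ 2 ∂P ≤ 2 * ‖u₀‖ ^ 2) ∧
    -- the sum is a mild solution with the right initial and boundary values
    IsMildSolution P W u₀ (fun z t => chaosSolution P W u₀ z t) ∧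
    HasBoundaryValues P u₀ (fun z t => chaosSolution P W u₀ z t) ∧
    -- every mild solution is a modification of it
    ∀ v : ℝ → ℝ → Ω → ℝ, IsMildSolution P W u₀ v →
      (∀ z t : ℝ, 0 < z → 0 < t → v z t =ᵐ[P] chaosSolution P W u₀ z t) ∧
      (HasBoundaryValues P u₀ v → ∀ z t : ℝ, 0 ≤ z → 0 ≤ t → (z, t) ≠ (0, 0) →
        v z t =ᵐ[P] chaosSolution P W u₀ z t) := by
  refine ⟨fun z t hz _ => ⟨fun n => memLp_chaosKernel u₀ n hz t,
    hW.summable_multipleIntegral_chaosKernel u₀ hgen hz t⟩,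
    fun z t hz _ => hW.integral_sq_chaosSolution_le u₀ hgen hz t,
    hW.isMildSolution_chaosSolution hgen, hW.hasBoundaryValues_chaosSolution u₀ hgen,
    fun v hv => ?_⟩
  have huniq : ∀ z t : ℝ, 0 < z → 0 < t → v z t =ᵐ[P] chaosSolution P W u₀ z t :=
    fun z t hz ht => hW.ae_eq_of_isMildSolution hgen hv (hW.isMildSolution_chaosSolution hgen) hz ht
  exact ⟨huniq, fun hb z t hz ht hne => IsWhiteNoise.ae_eq_of_hasBoundaryValues huniq hb
    (hW.hasBoundaryValues_chaosSolution u₀ hgen) hz ht hne⟩
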